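/- For an integer $n\ge 1$ let $r_1(n)$ be the number of pairs $(a,p)$ with $a>0$ an integer, $p$ a prime and $n=a^2+p^2$; let $\omega(n)$ be the number of distinct prime factors of $n$ and $\omega^*(n)$ the number of distinct odd prime factors of $n$. For real $x$ write $L=\log\log x$. (i) For every integer $\ell\ge 1$ there are constants $B_\ell\geq 0$ and $C_\ell>0$, depending only on $\ell$, such that for every $A>0$, for all sufficiently large $x$ (in terms of $\ell$ and $A$) and all integers $k$ with $0\le k\le A\log\log x$, $$\sum_{\substack{n\le x\\ \omega^*(n)=k}}\binom{r_1(n)}{\ell}\;\le\; C_\ell\,\frac{x\,L^{B_\ell}}{(\log x)^{\ell+1}}\cdot\frac{(2^{\ell-1}L)^k}{k!}.$$ (ii) There are constants $B\geq 0$ and $C>0$ such that for all $0<c\le A$, for all sufficiently large $x$ (in terms of $c$ and $A$) and all integers $k$ with $c\log\log x\le k\le A\log\log x$, $$\sum_{\substack{n\le x\\ \omega(n)=k}}\binom{r_1(n)}{2}\;\le\; C\,\frac{x\,L^{B}}{(\log x)^{3}}\cdot\frac{(2L)^k}{k!}.$$ -/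

import Mathlib

namespace SquarePlusPrimeSquare

/-- The representations of `n` as `a ^ 2 + p ^ 2` with `a` a positive integer and `p` prime,
as a finite set of pairs `(a, p)`. -/
def reps (n : ℕ) : Finset (ℕ × ℕ) :=
  (Finset.range (n + 1) ×ˢ Finset.range (n + 1)).filter
    (fun q => 0 < q.1 ∧ q.2.Prime ∧ q.1 ^ 2 + q.2 ^ 2 = n)

/-- The bounding box in `reps` excludes nothing. -/
theorem mem_reps {n : ℕ} {q : ℕ × ℕ} :
    q ∈ reps n ↔ 0 < q.1 ∧ q.2.Prime ∧ q.1 ^ 2 + q.2 ^ 2 = n := by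
  unfold reps
  simp only [Finset.mem_filter, Finset.mem_product, Finset.mem_range, and_iff_right_iff_imp]
  rintro ⟨-, -, h⟩
  constructor <;> nlinarith [Nat.le_self_pow two_ne_zero q.1, Nat.le_self_pow two_ne_zero q.2]

/-- The number of representations `n = a ^ 2 + p ^ 2` with `a > 0` an integer and `p` prime. -/
def r₁ (n : ℕ) : ℕ := (reps n).card

/-- The number of distinct odd prime factors of `n`. -/
def omegaStar (n : ℕ) : ℕ := (n.primeFactors.filter (fun p => Odd p)).card

end SquarePlusPrimeSquare

/-! The binomial coefficient counts sets of `ℓ` representations of `n`. Put `z = exp(log x / L^4)`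
and `w = exp(log x / L^2)`. Call `n` exceptional if it is at most `x / w`, has a square divisor
`d^2` with `d ≥ w`, or has a representation with `p ≤ z`. There are at most `4x/w` such integers,
and a pointwise bound of size `exp(O(L^2))` for the summand makes them negligible, since `w`
dominates every `exp(O(L^2))`.

A non-exceptional `n` has at most `k + 1` prime factors and exceeds `(w^3)^(k+1)`, so it has a
simple prime factor `q ≥ w` (`exists_large_prime`). Write `n = mq`, so that `m` has `k - 1` odd
prime factors, and `q = u^2 + v^2`. By divisibility in the Gaussian integers, the prime of each
representation of `n` is a linear form `c u + b v` with `c^2 + b^2 = m`. A set of `ℓ`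
representations thus gives `ℓ` pairwise non-proportional points of norm `m`, together with a point
`(u, v)` at which the norm form and `ℓ` linear forms all take prime values greater than `z`
(`exists_unfolded`).

For fixed `m` and fixed forms, Brun's pure sieve bounds the number of `(u, v)` by `(x/m) L^B / (log
x)^(ℓ+1)` (`exists_card_sifted_le`). The sieve has dimension `ℓ + 1`: modulo `p` the product of the
forms has about `(ℓ + 1 + χ(p)) p` zeros, and the character `χ` modulo `4` contributes only a
bounded amount because `L(1, χ) ≠ 0`. Pure sieving up to `z` and the primes at which the forms
degenerate cost only powers of `L`.

There remains the sum of `r(m)^ℓ / m` over `m` with `k - 1` odd prime factors, where `r(m)` counts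
integer points of norm `m`. Removing one prime power at a time bounds it by `S^(k-1)/(k-1)!` up to a
constant (`momentSum_le`). A prime contributes a factor `2` to `r` if it is `1` modulo `4` and `0`
if it is `3` modulo `4`, so `S ≤ 2^(ℓ-1) L + O(1)`. Passing from `k - 1` to `k` costs a constant
depending on `A`, which one more factor `L` absorbs.

Part (ii) follows because the total number of prime factors exceeds the number of odd ones by at
most one. -/

namespace SquarePlusPrimeSquare

/-! ### Elementary symmetric functions and truncated inclusion-exclusion. -/

/-- The elementary symmetric function of degree `j` of the family `g` on the finite set `W`. -/
noncomputable def elemSymm {ι : Type*} (W : Finset ι) (g : ι → ℝ) (j : ℕ) : ℝ :=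
  ∑ T ∈ W.powersetCard j, ∏ p ∈ T, g p

theorem elemSymm_zero {ι : Type*} (W : Finset ι) (g : ι → ℝ) : elemSymm W g 0 = 1 := by
  simp [elemSymm]

theorem elemSymm_empty_succ {ι : Type*} (g : ι → ℝ) (j : ℕ) :
    elemSymm (∅ : Finset ι) g (j + 1) = 0 := by
  rw [elemSymm, Finset.powersetCard_eq_empty.2 (by simp), Finset.sum_empty]

theorem elemSymm_insert {ι : Type*} [DecidableEq ι] {W : Finset ι} {a : ι} (ha : a ∉ W)
    (g : ι → ℝ) (j : ℕ) :
    elemSymm (insert a W) g (j + 1) = elemSymm W g (j + 1) + g a * elemSymm W g j := by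
  unfold elemSymm
  rw [Finset.powersetCard_succ_insert ha, Finset.sum_union, Finset.sum_image, Finset.mul_sum]
  · congr 1
    refine Finset.sum_congr rfl fun T hT => ?_
    rw [Finset.prod_insert]
    exact fun h => ha ((Finset.mem_powersetCard.1 hT).1 h)
  · intro S hS T hT h
    have hS' : a ∉ S := fun h => ha ((Finset.mem_powersetCard.1 hS).1 h)
    have hT' : a ∉ T := fun h => ha ((Finset.mem_powersetCard.1 hT).1 h)
    have := congrArg (fun U => Finset.erase U a) h
    simpa [Finset.erase_insert hS', Finset.erase_insert hT'] using this
  · rw [Finset.disjoint_left]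
    intro T hT hT'
    obtain ⟨S, -, rfl⟩ := Finset.mem_image.1 hT'
    exact ha ((Finset.mem_powersetCard.1 hT).1 (Finset.mem_insert_self a S))

/-- Induction on the set: by `elemSymm_insert` it suffices that `(g a + S)^(j+1)` is at least the
sum of the two leading terms of its binomial expansion. -/
theorem elemSymm_le {ι : Type*} [DecidableEq ι] (W : Finset ι) {g : ι → ℝ} (hg : ∀ i, 0 ≤ g i)
    (j : ℕ) : elemSymm W g j ≤ (∑ i ∈ W, g i) ^ j / (j.factorial : ℝ) := by
  induction W using Finset.induction_on generalizing j with
  | empty =>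
    cases j with
    | zero => simp [elemSymm_zero]
    | succ j => simp [elemSymm_empty_succ]
  | insert a W ha ih =>
    cases j with
    | zero => simp [elemSymm_zero]
    | succ j =>
      rw [elemSymm_insert ha, Finset.sum_insert ha]
      set S := ∑ i ∈ W, g i with hS
      have hS0 : 0 ≤ S := Finset.sum_nonneg fun i _ => hg i
      have h1 := ih (j + 1)
      have h2 := mul_le_mul_of_nonneg_left (ih j) (hg a)
      have h3 : ∀ i : ℕ, S ^ (i + 1) + (i + 1) * g a * S ^ i ≤ (g a + S) ^ (i + 1) := by
        intro i
        induction i with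
        | zero => simp; linarith
        | succ i hi =>
          have := mul_le_mul_of_nonneg_left hi (add_nonneg (hg a) hS0)
          have h4 : 0 ≤ (i + 1) * g a * g a * S ^ i := by have := hg a; positivity
          push_cast
          calc _ ≤ (g a + S) * (S ^ (i + 1) + (i + 1) * g a * S ^ i) := by ring_nf at h4 ⊢; linarith
            _ ≤ _ := this.trans_eq (by ring)
      calc _ ≤ S ^ (j + 1) / ((j + 1).factorial : ℝ) + g a * (S ^ j / (j.factorial : ℝ)) := by
            linarith
        _ = (S ^ (j + 1) + (j + 1) * g a * S ^ j) / ((j + 1).factorial : ℝ) := by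
            rw [Nat.factorial_succ]; push_cast
            have : (j.factorial : ℝ) ≠ 0 := by positivity
            have : (j + 1 : ℝ) ≠ 0 := by positivity
            field_simp
        _ ≤ _ := by gcongr; exact h3 j

/-- The truncated inclusion-exclusion sums exceed the full product, or fall short of it, by at
most the first omitted term. -/
theorem bonferroni {ι : Type*} [DecidableEq ι] (W : Finset ι) {g : ι → ℝ} (hg : ∀ i, 0 ≤ g i)
    (hg1 : ∀ i, g i ≤ 1) (r : ℕ) :
    0 ≤ (-1) ^ r * (∑ j ∈ Finset.range (r + 1), (-1) ^ j * elemSymm W g j - ∏ i ∈ W, (1 - g i)) ∧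
    (-1) ^ r * (∑ j ∈ Finset.range (r + 1), (-1) ^ j * elemSymm W g j - ∏ i ∈ W, (1 - g i)) ≤
      elemSymm W g (r + 1) := by
  induction W using Finset.induction_on generalizing r with
  | empty =>
    rw [Finset.sum_range_succ']
    simp [elemSymm_zero, elemSymm_empty_succ]
  | insert a W ha ih =>
    rw [Finset.prod_insert ha]
    cases r with
    | zero =>
      have h := ih 0
      have h0 : 0 ≤ ∏ i ∈ W, (1 - g i) := Finset.prod_nonneg fun i _ => sub_nonneg.2 (hg1 i)
      simp only [pow_zero, one_mul, zero_add, Finset.sum_range_one, elemSymm_zero] at h ⊢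
      rw [show (1 : ℕ) = 0 + 1 from rfl, elemSymm_insert ha, elemSymm_zero, zero_add]
      have h1 := mul_nonneg (hg a) h0
      have h2 := mul_le_mul_of_nonneg_left (sub_nonneg.1 h.1) (hg a)
      constructor <;> linarith [h.1, h.2]
    | succ r =>
      -- The truncated sums obey a recursion parallel to that of the product, so the defect at level
      -- `r + 1` for the larger set is the defect at `r + 1` plus `g a` times the defect at `r`,
      -- with matching signs.
      have e : ∑ j ∈ Finset.range (r + 1 + 1), (-1) ^ j * elemSymm (insert a W) g j =
          ∑ j ∈ Finset.range (r + 1 + 1), (-1) ^ j * elemSymm W g j -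
          g a * ∑ j ∈ Finset.range (r + 1), (-1) ^ j * elemSymm W g j := by
        rw [Finset.sum_range_succ', Finset.sum_range_succ' (n := r + 1), Finset.mul_sum]
        simp only [elemSymm_insert ha, elemSymm_zero]
        rw [add_sub_right_comm, ← Finset.sum_sub_distrib]
        congr 1
        exact Finset.sum_congr rfl fun j _ => by ring
      rw [e, elemSymm_insert ha]
      obtain ⟨h1, h2⟩ := ih (r + 1)
      obtain ⟨h3, h4⟩ := ih r
      have h5 := mul_nonneg (hg a) h3
      have h6 := mul_le_mul_of_nonneg_left h4 (hg a)
      constructor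
      · refine (add_nonneg h1 h5).trans_eq ?_
        ring
      · refine Eq.trans_le ?_ (add_le_add h2 h6)
        ring

end SquarePlusPrimeSquare

/-! ### Mertens' first theorem, and Euler products near `s = 1`. -/

namespace SquarePlusPrimeSquare

open Filter Topology

theorem pow_div_dvd_factorial {p : ℕ} (hp : 0 < p) (N : ℕ) : p ^ (N / p) ∣ N.factorial := by
  have h1 : ∀ k : ℕ, p ^ k ∣ (p * k).factorial := by
    intro k
    induction k with
    | zero => simp
    | succ k ih =>
      have h2 : (p * k).factorial * p ∣ (p * (k + 1)).factorial := by
        obtain ⟨t, rfl⟩ : ∃ t, p = t + 1 := ⟨p - 1, by omega⟩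
        rw [show (t + 1) * (k + 1) = ((t + 1) * k + t) + 1 by ring, Nat.factorial_succ, mul_comm]
        refine mul_dvd_mul ⟨k + 1, by ring⟩ (Nat.factorial_dvd_factorial (by omega))
      exact (pow_succ p k).symm ▸ (mul_dvd_mul_right ih p).trans h2
  exact (h1 _).trans (Nat.factorial_dvd_factorial (Nat.mul_div_le N p))

/-- Mertens' first theorem, the upper bound. -/
theorem sum_log_div_prime_le {N : ℕ} (hN : 1 ≤ N) :
    ∑ p ∈ Nat.primesLE N, Real.log p / p ≤ Real.log N + Real.log 4 := by
  have hN0 : (0 : ℝ) < N := by exact_mod_cast hN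
  have hpr : ∀ p ∈ Nat.primesLE N, p.Prime := fun p hp => (Nat.mem_primesLE.1 hp).2
  have hdvd : ∏ p ∈ Nat.primesLE N, p ^ (N / p) ∣ N.factorial := by
    refine Finset.prod_dvd_of_isRelPrime ?_ fun p hp => pow_div_dvd_factorial (hpr p hp).pos N
    intro p hp q hq hpq
    exact Nat.coprime_iff_isRelPrime.1
      (Nat.Coprime.pow _ _ ((Nat.coprime_primes (hpr p hp) (hpr q hq)).2 hpq))
  have hle : ∏ p ∈ Nat.primesLE N, p ^ (N / p) ≤ N ^ N :=
    (Nat.le_of_dvd N.factorial_pos hdvd).trans (Nat.factorial_le_pow N)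
  have hlog : ∑ p ∈ Nat.primesLE N, ((N / p : ℕ) : ℝ) * Real.log p ≤ N * Real.log N := by
    have h1 : Real.log ((∏ p ∈ Nat.primesLE N, p ^ (N / p) : ℕ) : ℝ) ≤ Real.log ((N ^ N : ℕ) : ℝ) :=
      Real.log_le_log (by
        exact_mod_cast Finset.prod_pos fun p hp => pow_pos (hpr p hp).pos _) (by exact_mod_cast hle)
    push_cast at h1
    rw [Real.log_prod, Real.log_pow] at h1
    · simpa only [Real.log_pow] using h1
    · intro p hp
      have := (hpr p hp).pos
      positivity
  -- Replacing `⌊N/p⌋` by `N/p` costs at most `log p` for each prime, in total Chebyshev's `θ(N)`.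
  have hth : ∑ p ∈ Nat.primesLE N, Real.log p ≤ Real.log 4 * N := by
    rw [← Chebyshev.theta_eq_sum_primesLE_log]
    exact Chebyshev.theta_le_log4_mul_x hN0.le
  have hmain : N * ∑ p ∈ Nat.primesLE N, Real.log p / p ≤ N * (Real.log N + Real.log 4) := by
    calc N * ∑ p ∈ Nat.primesLE N, Real.log p / p
        = ∑ p ∈ Nat.primesLE N, (N / p : ℝ) * Real.log p := by
          rw [Finset.mul_sum]; exact Finset.sum_congr rfl fun p _ => by ring
      _ ≤ ∑ p ∈ Nat.primesLE N, (((N / p : ℕ) : ℝ) * Real.log p + Real.log p) := by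
          refine Finset.sum_le_sum fun p hp => ?_
          have h1 : (N / p : ℝ) ≤ ((N / p : ℕ) : ℝ) + 1 := by
            have := Nat.lt_floor_add_one ((N : ℝ) / p)
            rw [Nat.floor_div_eq_div] at this
            exact this.le
          have h2 : 0 ≤ Real.log p := Real.log_natCast_nonneg p
          nlinarith
      _ ≤ _ := by rw [Finset.sum_add_distrib]; linarith
  exact le_of_mul_le_mul_left hmain hN0

theorem neg_log_one_sub_bounds {t : ℝ} (ht : |t| ≤ 1 / 2) :
    t ≤ -Real.log (1 - t) ∧ -Real.log (1 - t) ≤ t + 2 * t ^ 2 := by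
  obtain ⟨h1, h2⟩ := abs_le.1 ht
  have h3 : 0 < 1 - t := by linarith
  refine ⟨by linarith [Real.log_le_sub_one_of_pos h3], ?_⟩
  have h4 := Real.log_le_sub_one_of_pos (inv_pos.2 h3)
  rw [Real.log_inv] at h4
  refine h4.trans ?_
  rw [sub_le_iff_le_add, inv_le_iff_one_le_mul₀ h3]
  nlinarith [sq_nonneg t]

/-- Passing from the logarithm of an Euler product to the sum over primes. -/
theorem exists_abs_tsum_primes_sub_log_le : ∃ C : ℝ, ∀ (f : ℕ → ℝ) (s : ℝ) (Z : ℂ),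
    (∀ n, |f n| ≤ 1) → 1 < s →
    Complex.exp (∑' p : Nat.Primes, -Complex.log (1 - (f p : ℂ) * (p : ℂ) ^ (-(s : ℂ)))) = Z →
    |∑' p : Nat.Primes, f p * (p : ℝ) ^ (-s) - Real.log ‖Z‖| ≤ C := by
  have hsum2 : Summable fun p : Nat.Primes => (p : ℝ) ^ (-2 : ℝ) :=
    Nat.Primes.summable_rpow.2 (by norm_num)
  -- Each factor differs from its linear term by at most `2 t^2 ≤ 2 p^(-2)`, which makes the
  -- constant independent of `f` and `s`.
  refine ⟨2 * ∑' p : Nat.Primes, (p : ℝ) ^ (-2 : ℝ), fun f s Z hf hs hZ => ?_⟩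
  set t : Nat.Primes → ℝ := fun p => f p * (p : ℝ) ^ (-s) with ht
  have hp1 : ∀ p : Nat.Primes, (1 : ℝ) ≤ p := fun p => by exact_mod_cast p.2.one_le
  have hp2 : ∀ p : Nat.Primes, (2 : ℝ) ≤ p := fun p => by exact_mod_cast p.2.two_le
  have htle : ∀ p, |t p| ≤ (p : ℝ) ^ (-s) := fun p => by
    rw [ht]; simp only [abs_mul]
    rw [abs_of_nonneg (Real.rpow_nonneg (Nat.cast_nonneg _) _)]
    exact mul_le_of_le_one_left (Real.rpow_nonneg (Nat.cast_nonneg _) _) (hf p)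
  have hple : ∀ p : Nat.Primes, (p : ℝ) ^ (-s) ≤ (p : ℝ) ^ (-1 : ℝ) := fun p =>
    Real.rpow_le_rpow_of_exponent_le (hp1 p) (by linarith)
  have hinv : ∀ p : Nat.Primes, (p : ℝ) ^ (-1 : ℝ) ≤ 1 / 2 := fun p => by
    rw [Real.rpow_neg_one, ← one_div]
    exact one_div_le_one_div_of_le (by norm_num) (hp2 p)
  have hthalf : ∀ p, |t p| ≤ 1 / 2 := fun p => (htle p).trans ((hple p).trans (hinv p))
  have htsq : ∀ p, t p ^ 2 ≤ (p : ℝ) ^ (-2 : ℝ) := fun p => by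
    have h1 := (htle p).trans (hple p)
    rw [← sq_abs]
    calc |t p| ^ 2 ≤ ((p : ℝ) ^ (-1 : ℝ)) ^ 2 := by gcongr
      _ = _ := by
        rw [← Real.rpow_natCast, ← Real.rpow_mul (Nat.cast_nonneg _)]; norm_num
  have hsumt : Summable t := by
    refine Summable.of_norm_bounded (Nat.Primes.summable_rpow.2 (by linarith : -s < -1)) ?_
    exact htle
  have hsumsq : Summable fun p => t p ^ 2 :=
    Summable.of_nonneg_of_le (fun p => sq_nonneg _) htsq hsum2
  have hlogb := fun p => neg_log_one_sub_bounds (hthalf p)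
  have hsuml : Summable fun p => -Real.log (1 - t p) := by
    have h1 : Summable fun p => -Real.log (1 - t p) - t p :=
      Summable.of_nonneg_of_le (fun p => by linarith [(hlogb p).1])
        (fun p => by linarith [(hlogb p).2]) (hsumsq.mul_left 2)
    simpa using h1.add hsumt
  have hterm : ∀ p : Nat.Primes, -Complex.log (1 - (f p : ℂ) * (p : ℂ) ^ (-(s : ℂ))) =
      ((-Real.log (1 - t p) : ℝ) : ℂ) := fun p => by
    have h1 : (0 : ℝ) ≤ 1 - t p := by linarith [(abs_le.1 (hthalf p)).2]
    rw [Complex.ofReal_neg, Complex.ofReal_log h1, ht]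
    push_cast
    rw [Complex.ofReal_cpow (Nat.cast_nonneg _)]
    push_cast
    rfl
  have hZ' : Real.log ‖Z‖ = ∑' p, -Real.log (1 - t p) := by
    rw [← hZ, tsum_congr hterm, ← Complex.ofReal_tsum, Complex.norm_exp, Complex.ofReal_re,
      Real.log_exp]
  rw [hZ', abs_sub_comm, abs_of_nonneg]
  · rw [← hsuml.tsum_sub hsumt, ← tsum_mul_left]
    refine Summable.tsum_le_tsum (fun p => ?_) (hsuml.sub hsumt) (hsum2.mul_left 2)
    linarith [(hlogb p).2, htsq p]
  · rw [sub_nonneg]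
    exact Summable.tsum_le_tsum (fun p => (hlogb p).1) hsumt hsuml

theorem tendsto_ofReal_nhdsGT_one :
    Tendsto (fun s : ℝ => (s : ℂ)) (𝓝[>] 1) (𝓝[≠] (1 : ℂ)) := by
  refine tendsto_nhdsWithin_iff.2 ⟨?_, ?_⟩
  · exact (Complex.continuous_ofReal.tendsto' 1 1 (by simp)).mono_left nhdsWithin_le_nhds
  · filter_upwards [self_mem_nhdsWithin] with s hs
    simpa using (ne_of_gt hs : s ≠ 1)

/-- The prime zeta function near `s = 1`. -/
theorem exists_abs_primeZeta_le : ∃ C : ℝ, ∀ᶠ s : ℝ in 𝓝[>] 1,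
    |∑' p : Nat.Primes, (p : ℝ) ^ (-s) + Real.log (s - 1)| ≤ C := by
  obtain ⟨C, hC⟩ := exists_abs_tsum_primes_sub_log_le
  have h1 := (riemannZeta_residue_one.comp tendsto_ofReal_nhdsGT_one).norm
  rw [norm_one] at h1
  have h2 := (h1.log one_ne_zero).abs
  refine ⟨C + 1, ?_⟩
  filter_upwards [self_mem_nhdsWithin, h2.eventually_lt_const (u := 1) (by simp)] with s hs hlt
  have hs : 1 < s := hs
  have hz : riemannZeta (s : ℂ) ≠ 0 := riemannZeta_ne_zero_of_one_le_re (by simpa using hs.le)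
  have h3 := hC (fun _ => 1) s (riemannZeta s) (by simp) hs (by
    simpa using riemannZeta_eulerProduct_exp_log (s := (s : ℂ)) (by simpa using hs))
  simp only [one_mul] at h3
  simp only [Function.comp, norm_mul] at hlt
  have h4 : ‖(s : ℂ) - 1‖ = s - 1 := by
    rw [← Complex.ofReal_one, ← Complex.ofReal_sub, Complex.norm_of_nonneg (by linarith)]
  rw [h4, Real.log_mul (by linarith) (norm_ne_zero_iff.2 hz)] at hlt
  rw [abs_le] at *
  rw [abs_lt] at hlt
  constructor <;> linarith [h3.1, h3.2, hlt.1, hlt.2]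

/-- The nontrivial character modulo `4`, with real values. -/
noncomputable def chi (n : ℕ) : ℝ := ((ZMod.χ₄ (n : ZMod 4) : ℤ) : ℝ)

theorem abs_chi_le (n : ℕ) : |chi n| ≤ 1 := by
  unfold chi
  have : ∀ a : ZMod 4, |ZMod.χ₄ a| ≤ 1 := by decide
  exact_mod_cast this n

/-- The function `L(s, χ)` is continuous and nonzero at `1`, so its logarithm stays bounded as `s`
decreases to `1`. -/
theorem exists_abs_tsum_chi_le : ∃ C : ℝ, ∀ᶠ s : ℝ in 𝓝[>] 1,
    |∑' p : Nat.Primes, chi p * (p : ℝ) ^ (-s)| ≤ C := by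
  obtain ⟨C, hC⟩ := exists_abs_tsum_primes_sub_log_le
  let χ : DirichletCharacter ℂ 4 := ZMod.χ₄.ringHomComp (Int.castRingHom ℂ)
  have hχ : χ ≠ 1 := by
    intro h
    have h1 : χ 3 = 1 := by rw [h]; exact MulChar.one_apply (by decide)
    have h2 : χ 3 = -1 := by
      have : ZMod.χ₄ 3 = -1 := by decide
      simp [χ, MulChar.ringHomComp_apply, this]
    rw [h1] at h2
    norm_num at h2
  have hne := DirichletCharacter.LFunction_apply_one_ne_zero hχ
  have h1 : Tendsto (fun s : ℝ => Real.log ‖DirichletCharacter.LFunction χ s‖) (𝓝[>] 1)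
      (𝓝 (Real.log ‖DirichletCharacter.LFunction χ 1‖)) := by
    refine Tendsto.log (Tendsto.norm ?_) (norm_ne_zero_iff.2 hne)
    exact ((DirichletCharacter.differentiable_LFunction hχ).continuous.tendsto 1).comp
      (tendsto_ofReal_nhdsGT_one.mono_right nhdsWithin_le_nhds)
  refine ⟨C + (|Real.log ‖DirichletCharacter.LFunction χ 1‖| + 1), ?_⟩
  filter_upwards [self_mem_nhdsWithin, h1.abs.eventually_lt_const (lt_add_one _)] with s hs hlt
  have hs : 1 < s := hs
  have hs' : 1 < (s : ℂ).re := by simpa using hs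
  have h3 := hC chi s (DirichletCharacter.LFunction χ s) abs_chi_le hs (by
    rw [DirichletCharacter.LFunction_eq_LSeries χ hs',
      ← DirichletCharacter.LSeries_eulerProduct_exp_log χ hs']
    simp [χ, chi, MulChar.ringHomComp_apply])
  rw [abs_lt] at hlt
  rw [abs_le] at *
  constructor <;> linarith [h3.1, h3.2, hlt.1, hlt.2]

end SquarePlusPrimeSquare

/-! ### Mertens-type bounds for weighted sums of reciprocals of primes. -/

namespace SquarePlusPrimeSquare

open Filter Topology

theorem sum_primesLE_le_tsum {g : ℕ → ℝ} (hg : ∀ n, 0 ≤ g n)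
    (hs : Summable fun p : Nat.Primes => g p) (N : ℕ) :
    ∑ p ∈ Nat.primesLE N, g p ≤ ∑' p : Nat.Primes, g p := by
  let W : Finset Nat.Primes := (Nat.primesLE N).subtype Nat.Prime
  have h1 : ∑ p ∈ W, g p ≤ _ := hs.sum_le_tsum W (fun p _ => hg p)
  have h2 := Finset.sum_subtype_of_mem (p := Nat.Prime) (s := Nat.primesLE N) g
    (fun p hp => (Nat.mem_primesLE.1 hp).2)
  exact h2 ▸ h1

theorem summable_primes_mul {f : ℕ → ℝ} {K : ℝ} (hf : ∀ n, |f n| ≤ K) {s : ℝ} (hs : 1 < s) :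
    Summable fun p : Nat.Primes => f p * (p : ℝ) ^ (-s) := by
  refine Summable.of_norm_bounded
    ((Nat.Primes.summable_rpow.2 (by linarith : -s < -1)).mul_left K) fun p => ?_
  rw [norm_mul, Real.norm_of_nonneg (Real.rpow_nonneg (Nat.cast_nonneg _) _)]
  exact mul_le_mul_of_nonneg_right (hf p) (Real.rpow_nonneg (Nat.cast_nonneg _) _)

theorem tendsto_one_add_nhdsGT {f : ℝ → ℝ} (h : Tendsto f atTop (𝓝 0))
    (h' : ∀ᶠ x in atTop, 0 < f x) : Tendsto (fun x => 1 + f x) atTop (𝓝[>] 1) := by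
  refine tendsto_nhdsWithin_iff.2 ⟨by simpa using h.const_add 1, ?_⟩
  filter_upwards [h'] with x hx
  simpa using hx

/-- With `s = 1 + 1/log X`, replacing `1/p` by `p^(-s)` costs at most `log p / (p log X)`. Mertens'
first theorem bounds the total cost by `2K`. -/
theorem sum_weighted_primes_le {f : ℕ → ℝ} {K : ℝ} (hf0 : ∀ n, 0 ≤ f n) (hf : ∀ n, f n ≤ K)
    {X : ℝ} (hX : Real.exp 2 ≤ X) :
    ∑ p ∈ Nat.primesLE ⌊X⌋₊, f p / p ≤
      ∑' p : Nat.Primes, f p * (p : ℝ) ^ (-(1 + 1 / Real.log X)) + 2 * K := by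
  have hK : 0 ≤ K := (hf0 0).trans (hf 0)
  have hX0 : 0 < X := (Real.exp_pos 2).trans_le hX
  have hlog : 2 ≤ Real.log X := (Real.le_log_iff_exp_le hX0).2 hX
  have hX1 : 1 ≤ X := by linarith [Real.add_one_le_exp 2]
  have hfl : 1 ≤ ⌊X⌋₊ := Nat.le_floor (by simpa using hX1)
  have h1 : ∀ p ∈ Nat.primesLE ⌊X⌋₊, f p / p ≤
      f p * (p : ℝ) ^ (-(1 + 1 / Real.log X)) + K / Real.log X * (Real.log p / p) := by
    intro p hp
    have hp0 : (0 : ℝ) < p := by exact_mod_cast (Nat.mem_primesLE.1 hp).2.pos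
    have hlp : 0 ≤ Real.log p := Real.log_natCast_nonneg p
    have h2 : (1 - Real.log p / Real.log X) / p ≤ (p : ℝ) ^ (-(1 + 1 / Real.log X)) := by
      rw [neg_add, Real.rpow_add hp0, Real.rpow_neg_one, div_eq_inv_mul]
      gcongr
      rw [Real.rpow_def_of_pos hp0]
      have := Real.add_one_le_exp (Real.log p * -(1 / Real.log X))
      refine le_trans (le_of_eq ?_) this
      ring
    have h3 := mul_le_mul_of_nonneg_left h2 (hf0 p)
    have h4 : f p * (Real.log p / Real.log X / p) ≤ K * (Real.log p / Real.log X / p) :=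
      mul_le_mul_of_nonneg_right (hf p) (by positivity)
    calc f p / p = f p * ((1 - Real.log p / Real.log X) / p) +
        f p * (Real.log p / Real.log X / p) := by ring
      _ ≤ _ := add_le_add h3 (h4.trans_eq (by ring))
  have h5 : Real.log ⌊X⌋₊ ≤ Real.log X :=
    Real.log_le_log (by exact_mod_cast hfl) (Nat.floor_le hX0.le)
  have h6 : Real.log 4 ≤ 2 := by
    rw [show (4 : ℝ) = 2 ^ 2 by norm_num, Real.log_pow]
    have := Real.log_two_lt_d9
    push_cast; linarith
  calc _ ≤ ∑ p ∈ Nat.primesLE ⌊X⌋₊, f p * (p : ℝ) ^ (-(1 + 1 / Real.log X)) +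
        K / Real.log X * ∑ p ∈ Nat.primesLE ⌊X⌋₊, Real.log p / p := by
        rw [Finset.mul_sum, ← Finset.sum_add_distrib]; exact Finset.sum_le_sum h1
    _ ≤ _ := by
      refine add_le_add ?_ ?_
      · refine sum_primesLE_le_tsum (g := fun n => f n * (n : ℝ) ^ (-(1 + 1 / Real.log X)))
          (fun n => mul_nonneg (hf0 n) (Real.rpow_nonneg (Nat.cast_nonneg _) _)) ?_ _
        refine summable_primes_mul (K := K) (fun n => ?_) ?_
        · rw [abs_of_nonneg (hf0 n)]; exact hf n
        · have : 0 < 1 / Real.log X := by positivity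
          linarith
      · calc _ ≤ K / Real.log X * (2 * Real.log X) := by
              gcongr
              exact (sum_log_div_prime_le hfl).trans (by linarith)
          _ = _ := by field_simp

theorem tendsto_one_div_log : Tendsto (fun X : ℝ => 1 / Real.log X) atTop (𝓝 0) := by
  exact Real.tendsto_log_atTop.inv_tendsto_atTop.congr fun x => by simp

theorem eventually_log_pos : ∀ᶠ X : ℝ in atTop, 0 < Real.log X :=
  Real.tendsto_log_atTop.eventually_gt_atTop 0

/-- Mertens' second theorem, the upper bound. -/
theorem exists_sum_inv_prime_le : ∃ C : ℝ, 0 ≤ C ∧ ∀ᶠ X : ℝ in atTop,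
    ∑ p ∈ Nat.primesLE ⌊X⌋₊, 1 / (p : ℝ) ≤ Real.log (Real.log X) + C := by
  obtain ⟨C, hC⟩ := exists_abs_primeZeta_le
  have ht := tendsto_one_add_nhdsGT tendsto_one_div_log
    (by filter_upwards [eventually_log_pos] with X hX; positivity)
  refine ⟨|C| + 2, by positivity, ?_⟩
  filter_upwards [ht.eventually hC, eventually_ge_atTop (Real.exp 2)] with X h1 h2
  have h3 := sum_weighted_primes_le (f := fun _ => 1) (K := 1) (by simp) (by simp) h2
  have h4 : Real.log (1 + 1 / Real.log X - 1) = -Real.log (Real.log X) := by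
    rw [add_sub_cancel_left, one_div, Real.log_inv]
  rw [h4] at h1
  simp only [one_mul] at h3
  linarith [(abs_le.1 h1).2, le_abs_self C]

/-- The upper bound in Mertens' theorem for primes congruent to `1` modulo `4`. -/
theorem exists_sum_one_add_chi_le : ∃ C : ℝ, 0 ≤ C ∧ ∀ᶠ X : ℝ in atTop,
    ∑ p ∈ Nat.primesLE ⌊X⌋₊, (1 + chi p) / (p : ℝ) ≤ Real.log (Real.log X) + C := by
  obtain ⟨C, hC⟩ := exists_abs_primeZeta_le
  obtain ⟨C', hC'⟩ := exists_abs_tsum_chi_le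
  have ht := tendsto_one_add_nhdsGT tendsto_one_div_log
    (by filter_upwards [eventually_log_pos] with X hX; positivity)
  refine ⟨|C| + |C'| + 4, by positivity, ?_⟩
  filter_upwards [ht.eventually hC, ht.eventually hC', ht.eventually self_mem_nhdsWithin,
    eventually_ge_atTop (Real.exp 2)] with X h1 h1' hs h2
  have h3 := sum_weighted_primes_le (f := fun n => 1 + chi n) (K := 2)
    (fun n => by linarith [(abs_le.1 (abs_chi_le n)).1])
    (fun n => by linarith [(abs_le.1 (abs_chi_le n)).2]) h2
  have h4 : Real.log (1 + 1 / Real.log X - 1) = -Real.log (Real.log X) := by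
    rw [add_sub_cancel_left, one_div, Real.log_inv]
  rw [h4] at h1
  have hS1 := summable_primes_mul (f := fun _ => 1) (K := 1) (by simp) hs
  simp only [add_mul] at h3
  rw [hS1.tsum_add (summable_primes_mul abs_chi_le hs)] at h3
  simp only [one_mul] at h3
  linarith [(abs_le.1 h1).2, le_abs_self C, (abs_le.1 h1').2, le_abs_self C']

/-- A lower bound for a weighted sum of reciprocals of primes. -/
theorem exists_sum_add_chi_ge (κ : ℕ) (hκ : 1 ≤ κ) : ∃ C : ℝ, ∀ᶠ X : ℝ in atTop,
    κ * (Real.log (Real.log X) - Real.log (Real.log (Real.log X))) - C ≤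
      ∑ p ∈ Nat.primesLE ⌊X⌋₊, (κ + chi p) / (p : ℝ) := by
  obtain ⟨C, hC⟩ := exists_abs_primeZeta_le
  obtain ⟨C', hC'⟩ := exists_abs_tsum_chi_le
  have hlim : Tendsto (fun X : ℝ => Real.log (Real.log X) / Real.log X) atTop (𝓝 0) :=
    (Real.isLittleO_log_id_atTop.comp_tendsto Real.tendsto_log_atTop).tendsto_div_nhds_zero
  have hll : ∀ᶠ X : ℝ in atTop, 1 ≤ Real.log (Real.log X) :=
    (Real.tendsto_log_atTop.comp Real.tendsto_log_atTop).eventually_ge_atTop 1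
  have ht1 := tendsto_one_add_nhdsGT hlim
    (by filter_upwards [eventually_log_pos, hll] with X hX hX'; positivity)
  have ht2 := tendsto_one_add_nhdsGT (f := fun X => 2 * (Real.log (Real.log X) / Real.log X))
    (by simpa using hlim.const_mul 2)
    (by filter_upwards [eventually_log_pos, hll] with X hX hX'; positivity)
  refine ⟨κ * (|C| + Real.log 2) + |C'| + (κ + 1) * (1 + |C|), ?_⟩
  filter_upwards [ht1.eventually hC, ht2.eventually hC, ht2.eventually hC', eventually_log_pos, hll,
    ht1.eventually self_mem_nhdsWithin, ht2.eventually self_mem_nhdsWithin,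
    Real.tendsto_log_atTop.eventually_ge_atTop 1, eventually_gt_atTop 0]
    with X h1 h2 h3 hlog hloglog hs1 hs2 hlog1 hX0
  -- The series is evaluated at `1 + 2η`. Primes beyond `X` then contribute at most `X^(-η) = 1/log
  -- X` times the prime zeta function at `1 + η`, which is about `log log X`, so the tail is
  -- bounded. The price is the triple logarithm coming from `log (2η)`.
  set η := Real.log (Real.log X) / Real.log X with hη
  have hη0 : 0 < η := by positivity
  have hκ0 : (1 : ℝ) ≤ κ := by exact_mod_cast hκ
  have hchi0 : ∀ n, 0 ≤ κ + chi n := fun n => by linarith [(abs_le.1 (abs_chi_le n)).1]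
  have hchi1 : ∀ n, κ + chi n ≤ κ + 1 := fun n => by linarith [(abs_le.1 (abs_chi_le n)).2]
  have hchiabs : ∀ n, |κ + chi n| ≤ κ + 1 := fun n => by rw [abs_of_nonneg (hchi0 n)]; exact hchi1 n
  have hXη : X ^ (-η) = 1 / Real.log X := by
    rw [Real.rpow_def_of_pos hX0, hη, show Real.log X * -(Real.log (Real.log X) / Real.log X) =
      -Real.log (Real.log X) by field_simp, Real.exp_neg, Real.exp_log hlog, one_div]
  let W : Finset Nat.Primes := (Nat.primesLE ⌊X⌋₊).subtype Nat.Prime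
  have hW : ∑ p ∈ W, (κ + chi p) / (p : ℝ) =
      ∑ p ∈ Nat.primesLE ⌊X⌋₊, (κ + chi p) / (p : ℝ) :=
    Finset.sum_subtype_of_mem (p := Nat.Prime) (s := Nat.primesLE ⌊X⌋₊)
      (fun n : ℕ => (κ + chi n) / (n : ℝ)) (fun p hp => (Nat.mem_primesLE.1 hp).2)
  have hS := summable_primes_mul hchiabs hs2
  have hS1 : Summable fun p : Nat.Primes => (p : ℝ) ^ (-(1 + η)) :=
    Nat.Primes.summable_rpow.2 (by linarith)
  have hsplit : ∑' p : Nat.Primes, (κ + chi p) * (p : ℝ) ^ (-(1 + 2 * η)) ≤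
      ∑ p ∈ W, (κ + chi p) / (p : ℝ) +
        (κ + 1) * X ^ (-η) * ∑' p : Nat.Primes, (p : ℝ) ^ (-(1 + η)) := by
    rw [← tsum_mul_left]
    have hfin : HasSum (fun p : Nat.Primes => if p ∈ W then (κ + chi p) / (p : ℝ) else 0)
        (∑ p ∈ W, (κ + chi p) / (p : ℝ)) := by
      have h := hasSum_sum_of_ne_finset_zero (s := W) (L := SummationFilter.unconditional _)
        (f := fun p : Nat.Primes => if p ∈ W then (κ + chi p) / (p : ℝ) else 0)
        (fun p hp => if_neg hp)
      rwa [Finset.sum_congr rfl fun p hp => if_pos hp] at h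
    rw [← hfin.tsum_eq, ← hfin.summable.tsum_add (hS1.mul_left _)]
    refine Summable.tsum_le_tsum (fun p => ?_) hS (hfin.summable.add (hS1.mul_left _))
    have hp1 : (1 : ℝ) ≤ p := by exact_mod_cast p.2.one_le
    have hp0 : (0 : ℝ) < p := by linarith
    by_cases hp : p ∈ W
    · rw [if_pos hp]
      have h4 : (p : ℝ) ^ (-(1 + 2 * η)) ≤ 1 / p := by
        rw [one_div, ← Real.rpow_neg_one]
        exact Real.rpow_le_rpow_of_exponent_le hp1 (by linarith)
      have h5 : 0 ≤ (κ + 1) * X ^ (-η) * (p : ℝ) ^ (-(1 + η)) := by positivity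
      have h6 := mul_le_mul_of_nonneg_left h4 (hchi0 p)
      rw [mul_one_div] at h6
      linarith
    · rw [if_neg hp, zero_add]
      have hpX : X ≤ p := by
        by_contra hcon
        refine hp (Finset.mem_subtype.2 (Nat.mem_primesLE.2 ⟨Nat.le_floor (not_le.1 hcon).le, p.2⟩))
      have h4 : (p : ℝ) ^ (-η) ≤ X ^ (-η) :=
        Real.rpow_le_rpow_of_nonpos hX0 hpX (by linarith)
      rw [show -(1 + 2 * η) = -η + -(1 + η) by ring, Real.rpow_add hp0, ← mul_assoc]
      gcongr
      linarith [hchi1 p]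
  rw [hW, hXη] at hsplit
  have hlogη : -Real.log (1 + η - 1) ≤ Real.log (Real.log X) := by
    rw [add_sub_cancel_left, hη, Real.log_div (by positivity) (by positivity)]
    linarith [Real.log_nonneg hloglog]
  have hlog2η : Real.log (1 + 2 * η - 1) =
      Real.log 2 + Real.log (Real.log (Real.log X)) - Real.log (Real.log X) := by
    rw [add_sub_cancel_left, Real.log_mul (by norm_num) hη0.ne', hη,
      Real.log_div (by positivity) (by positivity)]
    ring
  have htail : (κ + 1) * (1 / Real.log X) * ∑' p : Nat.Primes, (p : ℝ) ^ (-(1 + η)) ≤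
      (κ + 1) * (1 + |C|) := by
    rw [mul_assoc]
    gcongr
    rw [one_div, inv_mul_le_iff₀ hlog]
    have h7 : Real.log (Real.log X) ≤ Real.log X :=
      (Real.log_le_sub_one_of_pos hlog).trans (by linarith)
    have h8 : |C| ≤ Real.log X * |C| := le_mul_of_one_le_left (abs_nonneg C) hlog1
    linarith [(abs_le.1 h1).2, le_abs_self C]
  have hmain : ∑' p : Nat.Primes, (κ + chi p) * (p : ℝ) ^ (-(1 + 2 * η)) =
      κ * ∑' p : Nat.Primes, (p : ℝ) ^ (-(1 + 2 * η)) +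
        ∑' p : Nat.Primes, chi p * (p : ℝ) ^ (-(1 + 2 * η)) := by
    have hS2 : Summable fun p : Nat.Primes => (p : ℝ) ^ (-(1 + 2 * η)) :=
      Nat.Primes.summable_rpow.2 (by linarith)
    rw [← tsum_mul_left, ← (hS2.mul_left _).tsum_add (summable_primes_mul abs_chi_le hs2)]
    exact tsum_congr fun p => by ring
  rw [hlog2η] at h2
  have h9 := mul_le_mul_of_nonneg_left (abs_le.1 h2).1 (by linarith : (0 : ℝ) ≤ κ)
  have h10 := mul_le_mul_of_nonneg_left (le_abs_self C) (by linarith : (0 : ℝ) ≤ κ)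
  nlinarith [(abs_le.1 h3).1, le_abs_self C']

/-- The sum of the reciprocals of the prime divisors of a number is at most about the double
logarithm of its logarithm. -/
theorem exists_sum_inv_primeFactors_le : ∃ C : ℝ, 0 ≤ C ∧ ∀ᶠ T : ℝ in atTop, ∀ D : ℕ, D ≠ 0 →
    Real.log D ≤ T → ∑ p ∈ D.primeFactors, 1 / (p : ℝ) ≤ Real.log (Real.log T) + C := by
  obtain ⟨C, hC0, hC⟩ := exists_sum_inv_prime_le
  refine ⟨C + 1, by positivity, ?_⟩
  filter_upwards [hC, eventually_ge_atTop 3] with T h1 hT D hD hlog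
  have hlogs : ∑ p ∈ D.primeFactors, Real.log p ≤ Real.log D := by
    rw [← Real.log_prod (fun p hp => by
      have := (Nat.prime_of_mem_primeFactors hp).pos; positivity)]
    refine Real.log_le_log (Finset.prod_pos fun p hp => by
      exact_mod_cast (Nat.prime_of_mem_primeFactors hp).pos) ?_
    rw [← Nat.cast_prod]
    exact Nat.cast_le.2 (Nat.le_of_dvd (Nat.pos_of_ne_zero hD) (Nat.prod_primeFactors_dvd D))
  -- Prime factors `p ≥ T` satisfy `1/p ≤ log p / T`, and the logarithms of all the prime factors
  -- add up to at most `log D ≤ T`.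
  have hterm : ∀ p ∈ D.primeFactors, 1 / (p : ℝ) ≤
      (if p ∈ Nat.primesLE ⌊T⌋₊ then 1 / (p : ℝ) else 0) + Real.log p / T := by
    intro p hp
    have hpp := Nat.prime_of_mem_primeFactors hp
    split_ifs with h
    · have : 0 ≤ Real.log p / T := div_nonneg (Real.log_natCast_nonneg p) (by linarith)
      linarith
    · have hpT : T ≤ p := by
        by_contra hcon
        exact h (Nat.mem_primesLE.2 ⟨Nat.le_floor (not_le.1 hcon).le, hpp⟩)
      have hlp : 1 ≤ Real.log p := by
        rw [Real.le_log_iff_exp_le (by linarith)]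
        linarith [Real.exp_one_lt_d9]
      rw [zero_add]
      have : 0 < (p : ℝ) := by linarith
      calc 1 / (p : ℝ) ≤ 1 / T := one_div_le_one_div_of_le (by linarith) hpT
        _ ≤ _ := by gcongr
  calc _ ≤ _ := Finset.sum_le_sum hterm
    _ = ∑ p ∈ D.primeFactors with p ∈ Nat.primesLE ⌊T⌋₊, 1 / (p : ℝ) +
        (∑ p ∈ D.primeFactors, Real.log p) / T := by
        rw [Finset.sum_add_distrib, ← Finset.sum_filter, Finset.sum_div]
    _ ≤ (Real.log (Real.log T) + C) + 1 := by
        refine add_le_add (le_trans ?_ h1) ?_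
        · exact Finset.sum_le_sum_of_subset_of_nonneg
            (fun p hp => (Finset.mem_filter.1 hp).2) (fun _ _ _ => by positivity)
        · rw [div_le_one (by linarith)]; linarith
    _ = _ := by ring

end SquarePlusPrimeSquare

/-! ### Zeros of the form modulo `d`, and Brun's pure sieve. -/

namespace SquarePlusPrimeSquare

/-- The product of the norm form `u ^ 2 + v ^ 2` with the linear forms `c i * u + b i * v`. -/
def form {R : Type*} [CommRing R] {ℓ : ℕ} (c b : Fin ℓ → ℤ) (u v : R) : R :=
  (u ^ 2 + v ^ 2) * ∏ i, ((c i : R) * u + (b i : R) * v)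

theorem map_form {R S : Type*} [CommRing R] [CommRing S] (f : R →+* S) {ℓ : ℕ} (c b : Fin ℓ → ℤ)
    (u v : R) : f (form c b u v) = form c b (f u) (f v) := by
  simp [form, map_prod]

theorem intCast_form {R : Type*} [CommRing R] {ℓ : ℕ} (c b : Fin ℓ → ℤ) (u v : ℤ) :
    ((form c b u v : ℤ) : R) = form c b (u : R) (v : R) :=
  map_form (Int.castRingHom R) c b u v

/-- The number of zeros of `form c b` modulo `d`. -/
noncomputable def rho {ℓ : ℕ} (c b : Fin ℓ → ℤ) (d : ℕ) : ℕ :=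
  Nat.card {x : ZMod d × ZMod d // form c b x.1 x.2 = 0}

theorem rho_mul {ℓ : ℕ} (c b : Fin ℓ → ℤ) {m n : ℕ} (h : m.Coprime n) :
    rho c b (m * n) = rho c b m * rho c b n := by
  unfold rho
  rw [← Nat.card_prod]
  let e := ZMod.chineseRemainder h
  refine Nat.card_congr (Equiv.trans (Equiv.subtypeEquiv
    ((Equiv.prodCongr e.toEquiv e.toEquiv).trans (Equiv.prodProdProdComm _ _ _ _)) ?_)
    (Equiv.subtypeProdEquivProd (p := fun x : ZMod m × ZMod m => form c b x.1 x.2 = 0)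
      (q := fun x : ZMod n × ZMod n => form c b x.1 x.2 = 0)))
  intro x
  have h1 : form c b x.1 x.2 = 0 ↔ form c b (e x.1) (e x.2) = 0 := by
    rw [← map_eq_zero_iff e e.injective]
    exact Eq.congr_left (map_form e.toRingHom c b x.1 x.2)
  rw [h1, Prod.ext_iff]
  have h2 := map_form (RingHom.fst (ZMod m) (ZMod n)) c b (e x.1) (e x.2)
  have h3 := map_form (RingHom.snd (ZMod m) (ZMod n)) c b (e x.1) (e x.2)
  simp only [RingHom.coe_fst, RingHom.coe_snd] at h2 h3
  rw [h2, h3]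
  rfl

theorem rho_one {ℓ : ℕ} (c b : Fin ℓ → ℤ) : rho c b 1 = 1 := by
  unfold rho
  rw [Nat.card_eq_one_iff_unique]
  exact ⟨inferInstance, ⟨⟨0, Subsingleton.elim _ _⟩⟩⟩

theorem rho_prod {ℓ : ℕ} (c b : Fin ℓ → ℤ) {T : Finset ℕ} (hT : ∀ p ∈ T, p.Prime) :
    rho c b (∏ p ∈ T, p) = ∏ p ∈ T, rho c b p := by
  induction T using Finset.induction_on with
  | empty => simp [rho_one]
  | insert a T ha ih =>
    rw [Finset.prod_insert ha, Finset.prod_insert ha, rho_mul, ih]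
    · exact fun p hp => hT p (Finset.mem_insert_of_mem hp)
    · refine Nat.Coprime.prod_right fun p hp => ?_
      refine (Nat.coprime_primes (hT a (Finset.mem_insert_self a T))
        (hT p (Finset.mem_insert_of_mem hp))).2 ?_
      rintro rfl
      exact ha hp

theorem rho_le_sq {ℓ : ℕ} (c b : Fin ℓ → ℤ) (d : ℕ) : (rho c b d : ℝ) / (d : ℝ) ^ 2 ≤ 1 := by
  rcases Nat.eq_zero_or_pos d with rfl | hd
  · simp
  · have : NeZero d := ⟨hd.ne'⟩
    refine div_le_one_of_le₀ ?_ (by positivity)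
    have : rho c b d ≤ d ^ 2 := by
      unfold rho
      refine (Finite.card_subtype_le _).trans_eq ?_
      rw [Nat.card_prod, Nat.card_zmod, sq]
    exact_mod_cast this

/-- The square of integer points with coordinates of absolute value at most `Y`. -/
noncomputable def box (Y : ℕ) : Finset (ℤ × ℤ) := Finset.Icc (-(Y : ℤ)) Y ×ˢ Finset.Icc (-(Y : ℤ)) Y

theorem abs_card_residue_sub_le (Y : ℕ) {d : ℕ} (hd : 0 < d) (r : ZMod d) :
    |(((Finset.Icc (-(Y : ℤ)) Y).filter fun u : ℤ => (u : ZMod d) = r).card : ℝ) -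
      (2 * Y + 1) / d| ≤ 1 := by
  have : NeZero d := ⟨hd.ne'⟩
  have hd' : (0 : ℚ) < d := by exact_mod_cast hd
  have h1 : (Finset.Icc (-(Y : ℤ)) Y).filter (fun u : ℤ => (u : ZMod d) = r) =
      (Finset.Ioc (-(Y : ℤ) - 1) Y).filter (fun u : ℤ => u ≡ (r.val : ℤ) [ZMOD (d : ℤ)]) := by
    ext u
    simp only [Finset.mem_filter, Finset.mem_Icc, Finset.mem_Ioc]
    rw [← ZMod.intCast_eq_intCast_iff, Int.cast_natCast, ZMod.natCast_zmod_val]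
    constructor <;> rintro ⟨⟨h1, h2⟩, h3⟩ <;> exact ⟨⟨by omega, h2⟩, h3⟩
  have h2 := Int.Ioc_filter_modEq_card (-(Y : ℤ) - 1) Y (r := (d : ℤ)) (by exact_mod_cast hd)
    (r.val : ℤ)
  rw [← h1] at h2
  set N := ((Finset.Icc (-(Y : ℤ)) Y).filter fun u : ℤ => (u : ZMod d) = r).card
  set A : ℚ := ((Y : ℤ) - (r.val : ℤ)) / (d : ℤ) with hA
  set B : ℚ := ((-(Y : ℤ) - 1 : ℤ) - (r.val : ℤ)) / (d : ℤ) with hB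
  have hAB : A - B = (2 * Y + 1) / d := by
    rw [hA, hB]; push_cast; field_simp; ring
  have hBA : B ≤ A := by
    have : 0 ≤ A - B := by rw [hAB]; positivity
    linarith
  rw [max_eq_left (sub_nonneg.2 (Int.floor_le_floor (by exact_mod_cast hBA)))] at h2
  have h3 : |(N : ℚ) - (2 * Y + 1) / d| ≤ 1 := by
    have h4 : (N : ℚ) = (⌊A⌋ : ℚ) - ⌊B⌋ := by exact_mod_cast h2
    rw [h4, ← hAB, abs_le]
    constructor <;> linarith [Int.floor_le A, Int.lt_floor_add_one A, Int.floor_le B,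
      Int.lt_floor_add_one B]
  have h5 := (Rat.cast_le (K := ℝ)).2 h3
  push_cast at h5
  exact h5

/-- Sorted by residue pairs, the points split into one class for each zero. Each class is a product
of two counts within `1` of `M = (2Y+1)/d`, hence the error `2M + 1` per zero. -/
theorem abs_card_box_dvd_sub_le {ℓ : ℕ} (c b : Fin ℓ → ℤ) (Y : ℕ) {d : ℕ} (hd : 0 < d) :
    |(((box Y).filter fun x => (d : ℤ) ∣ form c b x.1 x.2).card : ℝ) -
      rho c b d * ((2 * Y + 1) / d) ^ 2| ≤ (rho c b d : ℝ) * (2 * ((2 * Y + 1) / d) + 1) := by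
  classical
  have : NeZero d := ⟨hd.ne'⟩
  let Z : Finset (ZMod d × ZMod d) := Finset.univ.filter fun x => form c b x.1 x.2 = 0
  let N : ZMod d → ℕ := fun r =>
    ((Finset.Icc (-(Y : ℤ)) Y).filter fun u : ℤ => (u : ZMod d) = r).card
  have hZ : rho c b d = Z.card := by
    rw [rho, Nat.card_eq_fintype_card, Fintype.card_subtype]
  have hmaps : ∀ x ∈ (box Y).filter (fun x => (d : ℤ) ∣ form c b x.1 x.2),
      ((x.1 : ZMod d), (x.2 : ZMod d)) ∈ Z := by
    intro x hx
    rw [Finset.mem_filter, ← ZMod.intCast_zmod_eq_zero_iff_dvd, intCast_form] at hx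
    simpa [Z] using hx.2
  have hcard : ((box Y).filter fun x => (d : ℤ) ∣ form c b x.1 x.2).card =
      ∑ x ∈ Z, N x.1 * N x.2 := by
    rw [Finset.card_eq_sum_card_fiberwise hmaps]
    refine Finset.sum_congr rfl fun x hx => ?_
    rw [← Finset.card_product]
    congr 1
    ext y
    simp only [Finset.mem_filter, box, Finset.mem_product, Prod.ext_iff]
    constructor
    · rintro ⟨⟨⟨h1, h2⟩, h3⟩, h4, h5⟩
      exact ⟨⟨h1, h4⟩, h2, h5⟩
    · rintro ⟨⟨h1, h4⟩, h2, h5⟩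
      refine ⟨⟨⟨h1, h2⟩, ?_⟩, h4, h5⟩
      rw [← ZMod.intCast_zmod_eq_zero_iff_dvd, intCast_form, h4, h5]
      exact (Finset.mem_filter.1 hx).2
  set M : ℝ := (2 * Y + 1) / d with hM
  have hM0 : 0 ≤ M := by positivity
  rw [hcard, hZ, ← nsmul_eq_mul, ← nsmul_eq_mul, ← Finset.sum_const, ← Finset.sum_const]
  push_cast
  rw [← Finset.sum_sub_distrib]
  refine (Finset.abs_sum_le_sum_abs _ _).trans (Finset.sum_le_sum fun x _ => ?_)
  have h1 : |(N x.1 : ℝ) - M| ≤ 1 := abs_card_residue_sub_le Y hd x.1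
  have h2 : |(N x.2 : ℝ) - M| ≤ 1 := abs_card_residue_sub_le Y hd x.2
  calc |(N x.1 : ℝ) * N x.2 - M ^ 2|
      = |(N x.1 - M) * (N x.2 - M) + M * (N x.1 - M) + M * (N x.2 - M)| := by congr 1; ring
    _ ≤ |(N x.1 - M) * (N x.2 - M)| + |M * (N x.1 - M)| + |M * (N x.2 - M)| := abs_add_three _ _ _
    _ ≤ 1 * 1 + M * 1 + M * 1 := by
        rw [abs_mul, abs_mul, abs_mul, abs_of_nonneg hM0]
        gcongr
    _ = _ := by ring

theorem sum_choose_mul_pow_le (w κ J : ℕ) :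
    ∑ j ∈ Finset.range (J + 1), (w.choose j : ℝ) * (κ : ℝ) ^ j ≤ (1 + κ * w) ^ J := by
  rw [add_comm (1 : ℝ), add_pow]
  refine Finset.sum_le_sum fun j hj => ?_
  have h1 : (w.choose j : ℝ) ≤ (w : ℝ) ^ j := by exact_mod_cast Nat.choose_le_pow w j
  have h2 : (1 : ℝ) ≤ J.choose j := by
    exact_mod_cast Nat.choose_pos (Nat.lt_succ_iff.1 (Finset.mem_range.1 hj))
  rw [one_pow, mul_one, mul_pow, mul_comm]
  calc (κ : ℝ) ^ j * w.choose j ≤ (κ : ℝ) ^ j * (w : ℝ) ^ j := by gcongr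
    _ ≤ _ := le_mul_of_one_le_right (by positivity) h2

/-- Brun's pure sieve for the values of `form c b` on a square. -/
theorem brun_sieve {ℓ : ℕ} (c b : Fin ℓ → ℤ) (Y κ J : ℕ) (hJ : Even J) (W : Finset ℕ) {z : ℝ}
    (hW : ∀ p ∈ W, p.Prime) (hκ : ∀ p ∈ W, rho c b p ≤ κ * p) (hz : ∀ p ∈ W, (p : ℝ) ≤ z)
    (hz1 : 1 ≤ z) (hzJ : z ^ J ≤ 2 * Y + 1) :
    (((box Y).filter fun x => ∀ p ∈ W, ¬ (p : ℤ) ∣ form c b x.1 x.2).card : ℝ) ≤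
      (2 * Y + 1) ^ 2 * (∏ p ∈ W, (1 - (rho c b p : ℝ) / (p : ℝ) ^ 2) +
        (∑ p ∈ W, (rho c b p : ℝ) / (p : ℝ) ^ 2) ^ (J + 1) / ((J + 1).factorial : ℝ)) +
      3 * (2 * Y + 1) * (1 + κ * W.card) ^ J := by
  classical
  set M : ℝ := 2 * Y + 1 with hM
  have hM0 : 0 < M := by positivity
  let χ : ℤ × ℤ → ℕ → ℝ := fun x p => if (p : ℤ) ∣ form c b x.1 x.2 then 1 else 0
  have hχ0 : ∀ x p, 0 ≤ χ x p := fun x p => by simp only [χ]; split_ifs <;> norm_num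
  have hχ1 : ∀ x p, χ x p ≤ 1 := fun x p => by simp only [χ]; split_ifs <;> norm_num
  let g : ℕ → ℝ := fun p => (rho c b p : ℝ) / (p : ℝ) ^ 2
  have hg0 : ∀ p, 0 ≤ g p := fun p => by positivity
  have hg1 : ∀ p, g p ≤ 1 := fun p => rho_le_sq c b p
  let cnt : Finset ℕ → ℝ := fun T =>
    (((box Y).filter fun x => ((∏ p ∈ T, p : ℕ) : ℤ) ∣ form c b x.1 x.2).card : ℝ)
  have hprodχ : ∀ x, ∀ T ⊆ W, ∏ p ∈ T, χ x p =
      if ((∏ p ∈ T, p : ℕ) : ℤ) ∣ form c b x.1 x.2 then 1 else 0 := by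
    intro x T hT
    simp only [χ]
    rw [Finset.prod_ite_zero]
    simp only [Finset.prod_const_one]
    refine if_congr ⟨fun h => ?_, fun h p hp => ?_⟩ rfl rfl
    · push_cast
      refine Finset.prod_dvd_of_coprime (fun p hp q hq hpq => ?_) h
      exact Nat.isCoprime_iff_coprime.2
        ((Nat.coprime_primes (hW p (hT hp)) (hW q (hT hq))).2 hpq)
    · exact (Int.natCast_dvd_natCast.2 (Finset.dvd_prod_of_mem _ hp)).trans h
  -- Truncating after an even index gives an upper bound pointwise, with the divisibility indicators
  -- as weights.
  have hstep1 : (((box Y).filter fun x => ∀ p ∈ W, ¬ (p : ℤ) ∣ form c b x.1 x.2).card : ℝ) ≤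
      ∑ j ∈ Finset.range (J + 1), (-1) ^ j * ∑ T ∈ W.powersetCard j, cnt T := by
    have h1 : (((box Y).filter fun x => ∀ p ∈ W, ¬ (p : ℤ) ∣ form c b x.1 x.2).card : ℝ) =
        ∑ x ∈ box Y, ∏ p ∈ W, (1 - χ x p) := by
      rw [Finset.card_filter]
      push_cast
      refine Finset.sum_congr rfl fun x _ => ?_
      have : ∀ p, 1 - χ x p = if ¬ (p : ℤ) ∣ form c b x.1 x.2 then 1 else 0 := fun p => by
        simp only [χ]; split_ifs <;> simp
      simp only [this]
      rw [Finset.prod_ite_zero]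
      simp
    have h2 : ∑ j ∈ Finset.range (J + 1), (-1) ^ j * ∑ T ∈ W.powersetCard j, cnt T =
        ∑ x ∈ box Y, ∑ j ∈ Finset.range (J + 1), (-1) ^ j * elemSymm W (χ x) j := by
      rw [Finset.sum_comm]
      refine Finset.sum_congr rfl fun j _ => ?_
      rw [← Finset.mul_sum]
      congr 1
      unfold elemSymm
      rw [Finset.sum_comm]
      refine Finset.sum_congr rfl fun T hT => ?_
      rw [Finset.sum_congr rfl fun x _ => hprodχ x T (Finset.mem_powersetCard.1 hT).1]
      simp only [cnt]
      rw [Finset.card_filter]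
      push_cast
      rfl
    rw [h1, h2]
    refine Finset.sum_le_sum fun x _ => ?_
    have := (bonferroni W (hχ0 x) (hχ1 x) J).1
    rw [hJ.neg_one_pow, one_mul] at this
    linarith
  have hcnt : ∀ j ∈ Finset.range (J + 1), ∀ T ∈ W.powersetCard j,
      |cnt T - M ^ 2 * ∏ p ∈ T, g p| ≤ 3 * M * (κ : ℝ) ^ j := by
    intro j hj T hT
    obtain ⟨hTW, hTj⟩ := Finset.mem_powersetCard.1 hT
    have hTp : ∀ p ∈ T, p.Prime := fun p hp => hW p (hTW hp)
    set d := ∏ p ∈ T, p with hd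
    have hd0 : 0 < d := Finset.prod_pos fun p hp => (hTp p hp).pos
    have hd0' : (0 : ℝ) < d := by exact_mod_cast hd0
    have hdM : (d : ℝ) ≤ M := by
      refine le_trans ?_ hzJ
      rw [hd]; push_cast
      calc ∏ p ∈ T, (p : ℝ) ≤ ∏ p ∈ T, z :=
            Finset.prod_le_prod (fun p _ => Nat.cast_nonneg p) fun p hp => hz p (hTW hp)
        _ = z ^ T.card := Finset.prod_const z
        _ ≤ z ^ J := pow_le_pow_right₀ hz1 (by
            rw [hTj]; exact Nat.lt_succ_iff.1 (Finset.mem_range.1 hj))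
    have hrho : (rho c b d : ℝ) ≤ (κ : ℝ) ^ j * d := by
      rw [hd, rho_prod c b hTp, ← hTj]
      have : ∏ p ∈ T, rho c b p ≤ ∏ p ∈ T, κ * p :=
        Finset.prod_le_prod' fun p hp => hκ p (hTW hp)
      rw [Finset.prod_mul_distrib, Finset.prod_const] at this
      exact_mod_cast this
    have hmain : M ^ 2 * ∏ p ∈ T, g p = rho c b d * (M / d) ^ 2 := by
      simp only [g]
      rw [Finset.prod_div_distrib, Finset.prod_pow, hd, rho_prod c b hTp]
      push_cast
      ring
    rw [hmain]
    refine (abs_card_box_dvd_sub_le c b Y hd0).trans ?_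
    -- Since `d ≤ z^J ≤ M`, the error `2M/d + 1` is at most `3M/d`, and the factor `d` in the bound
    -- for `rho` cancels.
    have h1 : 1 ≤ M / d := (one_le_div hd0').2 hdM
    calc (rho c b d : ℝ) * (2 * (M / d) + 1) ≤ ((κ : ℝ) ^ j * d) * (3 * (M / d)) := by
          gcongr; linarith
      _ = _ := by field_simp
  have hstep2 : ∑ j ∈ Finset.range (J + 1), (-1) ^ j * ∑ T ∈ W.powersetCard j, cnt T ≤
      M ^ 2 * ∑ j ∈ Finset.range (J + 1), (-1) ^ j * elemSymm W g j +
        3 * M * (1 + κ * W.card) ^ J := by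
    have h1 : ∀ j ∈ Finset.range (J + 1), (-1 : ℝ) ^ j * ∑ T ∈ W.powersetCard j, cnt T ≤
        M ^ 2 * ((-1) ^ j * elemSymm W g j) + 3 * M * ((W.card.choose j : ℝ) * (κ : ℝ) ^ j) := by
      intro j hj
      rw [← sub_le_iff_le_add']
      have h2 : |∑ T ∈ W.powersetCard j, (cnt T - M ^ 2 * ∏ p ∈ T, g p)| ≤
          W.card.choose j * (3 * M * (κ : ℝ) ^ j) := by
        refine (Finset.abs_sum_le_sum_abs _ _).trans ((Finset.sum_le_sum (hcnt j hj)).trans ?_)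
        rw [Finset.sum_const, Finset.card_powersetCard, nsmul_eq_mul]
      calc _ = (-1 : ℝ) ^ j * ∑ T ∈ W.powersetCard j, (cnt T - M ^ 2 * ∏ p ∈ T, g p) := by
            rw [Finset.sum_sub_distrib, ← Finset.mul_sum, elemSymm]; ring
        _ ≤ |(-1 : ℝ) ^ j * ∑ T ∈ W.powersetCard j, (cnt T - M ^ 2 * ∏ p ∈ T, g p)| :=
            le_abs_self _
        _ ≤ _ := by
            rw [abs_mul, abs_pow, abs_neg, abs_one, one_pow, one_mul]
            exact h2.trans_eq (by ring)
    refine (Finset.sum_le_sum h1).trans ?_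
    rw [Finset.sum_add_distrib, ← Finset.mul_sum, ← Finset.mul_sum]
    gcongr
    exact sum_choose_mul_pow_le W.card κ J
  -- Bonferroni is used a second time, now for the local densities and in the opposite direction, to
  -- return from the truncated sum to the product.
  have hstep3 : ∑ j ∈ Finset.range (J + 1), (-1) ^ j * elemSymm W g j ≤
      ∏ p ∈ W, (1 - g p) + (∑ p ∈ W, g p) ^ (J + 1) / ((J + 1).factorial : ℝ) := by
    have h1 := (bonferroni W hg0 hg1 J).2
    rw [hJ.neg_one_pow, one_mul] at h1
    linarith [elemSymm_le W hg0 (J + 1)]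
  refine hstep1.trans (hstep2.trans ?_)
  gcongr

end SquarePlusPrimeSquare

/-! ### Local densities: counting zeros modulo a prime. -/

namespace SquarePlusPrimeSquare

/-- Pairwise non-proportional lines through the origin share no other point, and each carries `|K| -
1` nonzero points, the multiples of `(b i, -c i)`. -/
theorem card_mul_le_card_lines {K ι : Type*} [Field K] [Fintype K] [DecidableEq K] [Fintype ι]
    (c b : ι → K) (hne : ∀ i, c i ≠ 0 ∨ b i ≠ 0)
    (hdet : ∀ i j, i ≠ j → c i * b j - c j * b i ≠ 0) :
    Fintype.card ι * (Fintype.card K - 1) ≤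
      (Finset.univ.filter fun x : K × K => ∃ i, c i * x.1 + b i * x.2 = 0).card := by
  classical
  rw [← Fintype.card_units, ← Fintype.card_prod, ← Finset.card_univ]
  refine Finset.card_le_card_of_injOn (fun x : ι × Kˣ => ((x.2 : K) * b x.1, -((x.2 : K) * c x.1)))
    ?_ ?_
  · intro x _
    simp only [Finset.coe_filter, Finset.mem_univ, true_and, Set.mem_ofPred_eq]
    exact ⟨x.1, by ring⟩
  · rintro ⟨i, t⟩ - ⟨j, s⟩ - h
    simp only [Prod.mk.injEq, neg_inj] at h
    obtain ⟨h1, h2⟩ := h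
    by_cases hij : i = j
    · subst hij
      have : (t : K) = s := by
        rcases hne i with h | h
        · exact mul_right_cancel₀ h h2
        · exact mul_right_cancel₀ h h1
      rw [Units.ext this]
    · refine absurd ?_ (hdet i j hij)
      have h3 : (t : K) * s * (c i * b j - c j * b i) = 0 := by
        linear_combination (s * b j : K) * h2 - (s * c j : K) * h1
      exact (mul_eq_zero.1 h3).resolve_left (mul_ne_zero t.ne_zero s.ne_zero)

theorem card_line_le {K : Type*} [Field K] [Fintype K] [DecidableEq K] {c b : K}
    (h : c ≠ 0 ∨ b ≠ 0) :
    (Finset.univ.filter fun x : K × K => c * x.1 + b * x.2 = 0).card ≤ Fintype.card K := by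
  rw [← Finset.card_univ]
  rcases h with h | h
  · refine Finset.card_le_card_of_injOn Prod.snd (fun _ _ => Finset.mem_coe.2 (Finset.mem_univ _)) ?_
    intro x hx y hy hxy
    simp only [Finset.coe_filter, Finset.mem_univ, true_and, Set.mem_ofPred_eq] at hx hy
    refine Prod.ext (mul_left_cancel₀ h ?_) hxy
    linear_combination hx - hy - b * hxy
  · refine Finset.card_le_card_of_injOn Prod.fst (fun _ _ => Finset.mem_coe.2 (Finset.mem_univ _)) ?_
    intro x hx y hy hxy
    simp only [Finset.coe_filter, Finset.mem_univ, true_and, Set.mem_ofPred_eq] at hx hy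
    refine Prod.ext hxy (mul_left_cancel₀ h ?_)
    linear_combination hx - hy - c * hxy

/-- If `-1` is a square the form splits into two lines; otherwise its only zero is the origin. -/
theorem card_sq_add_sq_eq_zero_le {K : Type*} [Field K] [Fintype K] [DecidableEq K] :
    (Finset.univ.filter fun x : K × K => x.1 ^ 2 + x.2 ^ 2 = 0).card ≤ 2 * Fintype.card K := by
  by_cases hI : ∃ I : K, I ^ 2 = -1
  · obtain ⟨I, hI⟩ := hI
    have hsub : (Finset.univ.filter fun x : K × K => x.1 ^ 2 + x.2 ^ 2 = 0) ⊆
        (Finset.univ.filter fun x : K × K => 1 * x.1 + I * x.2 = 0) ∪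
        (Finset.univ.filter fun x : K × K => 1 * x.1 + -I * x.2 = 0) := by
      intro x hx
      simp only [Finset.mem_filter, Finset.mem_univ, true_and, Finset.mem_union] at hx ⊢
      rw [← mul_eq_zero]
      linear_combination hx - x.2 ^ 2 * hI
    refine (Finset.card_le_card hsub).trans ((Finset.card_union_le _ _).trans ?_)
    rw [two_mul]
    exact add_le_add (card_line_le (Or.inl one_ne_zero)) (card_line_le (Or.inl one_ne_zero))
  · have hsub : (Finset.univ.filter fun x : K × K => x.1 ^ 2 + x.2 ^ 2 = 0) ⊆
        (Finset.univ.filter fun x : K × K => 1 * x.1 + 0 * x.2 = 0) := by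
      intro x hx
      simp only [Finset.mem_filter, Finset.mem_univ, true_and] at hx ⊢
      have h2 : x.2 = 0 := by
        by_contra h
        refine hI ⟨x.1 / x.2, ?_⟩
        field_simp
        linear_combination hx
      rw [h2] at hx
      simpa using hx
    refine (Finset.card_le_card hsub).trans ((card_line_le (Or.inl one_ne_zero)).trans ?_)
    omega

section

variable {ℓ : ℕ} {c b : Fin ℓ → ℤ} {p m : ℕ}

theorem rho_eq_card [Fact p.Prime] :
    rho c b p = (Finset.univ.filter fun x : ZMod p × ZMod p => form c b x.1 x.2 = 0).card := by
  rw [rho, Nat.card_eq_fintype_card, Fintype.card_subtype]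

theorem coeff_ne_zero (hm : ∀ i, c i ^ 2 + b i ^ 2 = m) (hpm : (m : ZMod p) ≠ 0) (i : Fin ℓ) :
    (c i : ZMod p) ≠ 0 ∨ (b i : ZMod p) ≠ 0 := by
  by_contra! h
  have h1 := congrArg (Int.cast : ℤ → ZMod p) (hm i)
  push_cast at h1
  rw [h.1, h.2] at h1
  exact hpm (by rw [← h1]; ring)

theorem rho_le [hp : Fact p.Prime] (hm : ∀ i, c i ^ 2 + b i ^ 2 = m) (hpm : (m : ZMod p) ≠ 0) :
    rho c b p ≤ (ℓ + 2) * p := by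
  have hsub : (Finset.univ.filter fun x : ZMod p × ZMod p => form c b x.1 x.2 = 0) ⊆
      (Finset.univ.filter fun x : ZMod p × ZMod p => x.1 ^ 2 + x.2 ^ 2 = 0) ∪
      Finset.univ.biUnion fun i => (Finset.univ.filter fun x : ZMod p × ZMod p =>
        (c i : ZMod p) * x.1 + (b i : ZMod p) * x.2 = 0) := by
    intro x hx
    simp only [form, Finset.mem_filter, Finset.mem_univ, true_and, Finset.mem_union,
      Finset.mem_biUnion, mul_eq_zero, Finset.prod_eq_zero_iff] at hx ⊢
    exact hx
  rw [rho_eq_card]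
  refine (Finset.card_le_card hsub).trans ((Finset.card_union_le _ _).trans ?_)
  have h1 := card_sq_add_sq_eq_zero_le (K := ZMod p)
  have h2 : (Finset.univ.biUnion fun i => (Finset.univ.filter fun x : ZMod p × ZMod p =>
        (c i : ZMod p) * x.1 + (b i : ZMod p) * x.2 = 0)).card ≤ ℓ * p := by
    refine Finset.card_biUnion_le.trans ?_
    refine (Finset.sum_le_sum fun i _ => card_line_le (coeff_ne_zero hm hpm i)).trans ?_
    simp [ZMod.card]
  rw [ZMod.card] at h1
  linarith

/-- If `p` is `1` modulo `4`, the norm form adds two lines to the `ℓ` given ones, distinct from them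
because a common line would force `c^2 + b^2 = m` to vanish modulo `p`. If `p` is `3` modulo `4`,
only the `ℓ` lines are counted. The character merges both cases. -/
theorem le_rho [hp : Fact p.Prime] (hm : ∀ i, c i ^ 2 + b i ^ 2 = m) (hpm : (m : ZMod p) ≠ 0)
    (hdet : ∀ i j, i ≠ j → ((c i * b j - c j * b i : ℤ) : ZMod p) ≠ 0) (hp2 : p ≠ 2) :
    (ℓ + 1 + chi p) * (p - 1) ≤ rho c b p := by
  have hp1 : ((p - 1 : ℕ) : ℝ) = p - 1 := by
    rw [Nat.cast_sub hp.out.one_le, Nat.cast_one]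
  rw [← hp1]
  rcases hp.out.eq_two_or_odd with h | hodd
  · exact absurd h hp2
  have hmod : p % 4 = 1 ∨ p % 4 = 3 := by omega
  rcases hmod with h4 | h4
  · have hchi : chi p = 1 := by rw [chi, ZMod.χ₄_nat_one_mod_four h4]; simp
    obtain ⟨I, hI⟩ : ∃ I : ZMod p, -1 = I * I :=
      ZMod.exists_sq_eq_neg_one_iff.2 (by omega)
    have h2 : (2 : ZMod p) ≠ 0 := by
      intro h
      have : (p : ℕ) ∣ 2 := (ZMod.natCast_eq_zero_iff 2 p).1 (by exact_mod_cast h)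
      exact hp2 ((Nat.prime_dvd_prime_iff_eq hp.out Nat.prime_two).1 this)
    have hI0 : I ≠ 0 := by rintro rfl; simp at hI
    have hkey : ∀ i (ε : ZMod p), ε * ε = -1 → (c i : ZMod p) * ε - b i ≠ 0 := by
      intro i ε hε h
      have h1 := congrArg (Int.cast : ℤ → ZMod p) (hm i)
      push_cast at h1
      exact hpm (by
        linear_combination -h1 + (c i : ZMod p) ^ 2 * hε - ((c i : ZMod p) * ε + b i) * h)
    let sgn : Bool → ZMod p := fun t => if t then I else -I
    have hsgn : ∀ t, sgn t * sgn t = -1 := by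
      intro t; cases t <;> simp [sgn, hI]
    have h := card_mul_le_card_lines (K := ZMod p) (ι := Fin ℓ ⊕ Bool)
      (Sum.elim (fun i => (c i : ZMod p)) (fun _ => 1)) (Sum.elim (fun i => (b i : ZMod p)) sgn)
      (by
        rintro (i | t)
        · exact coeff_ne_zero hm hpm i
        · exact Or.inl one_ne_zero)
      (by
        rintro (i | t) (j | s) hij
        · have := hdet i j (fun h => hij (by rw [h]))
          push_cast at this
          exact this
        · simpa using hkey i _ (hsgn s)
        · have := hkey j _ (hsgn t)
          simp only [Sum.elim_inl, Sum.elim_inr, one_mul]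
          intro h0
          exact this (by linear_combination -h0)
        · have h3 : (2 : ZMod p) * I ≠ 0 := mul_ne_zero h2 hI0
          cases t <;> cases s <;> simp [sgn] at hij ⊢
          · intro h0; exact h3 (by linear_combination h0)
          · intro h0; exact h3 (by linear_combination -h0))
    have hsub : (Finset.univ.filter fun x : ZMod p × ZMod p => ∃ i : Fin ℓ ⊕ Bool,
        Sum.elim (fun i => (c i : ZMod p)) (fun _ => 1) i * x.1 +
        Sum.elim (fun i => (b i : ZMod p)) sgn i * x.2 = 0) ⊆
        Finset.univ.filter fun x : ZMod p × ZMod p => form c b x.1 x.2 = 0 := by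
      intro x hx
      simp only [Finset.mem_filter, Finset.mem_univ, true_and] at hx ⊢
      obtain ⟨i | t, hi⟩ := hx
      · exact mul_eq_zero_of_right _ (Finset.prod_eq_zero (Finset.mem_univ i) hi)
      · refine mul_eq_zero_of_left ?_ _
        simp only [Sum.elim_inr] at hi
        linear_combination (x.1 - sgn t * x.2) * hi + x.2 ^ 2 * hsgn t
    have h' := h.trans (Finset.card_le_card hsub)
    rw [← rho_eq_card, ZMod.card] at h'
    simp only [Fintype.card_sum, Fintype.card_fin, Fintype.card_bool] at h'
    rw [hchi, show (ℓ + 1 + 1 : ℝ) = ((ℓ + 2 : ℕ) : ℝ) by push_cast; ring]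
    exact_mod_cast h'
  · have hchi : chi p = -1 := by rw [chi, ZMod.χ₄_nat_three_mod_four h4]; simp
    have h := card_mul_le_card_lines (K := ZMod p) (fun i => (c i : ZMod p))
      (fun i => (b i : ZMod p)) (coeff_ne_zero hm hpm)
      (fun i j hij => by
        have := hdet i j hij
        push_cast at this
        exact this)
    have h' := h.trans (Finset.card_le_card (t := Finset.univ.filter
      fun x : ZMod p × ZMod p => form c b x.1 x.2 = 0) fun x hx => by
        simp only [Finset.mem_filter, Finset.mem_univ, true_and] at hx ⊢
        obtain ⟨i, hi⟩ := hx
        exact mul_eq_zero_of_right _ (Finset.prod_eq_zero (Finset.mem_univ i) hi))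
    rw [← rho_eq_card, ZMod.card, Fintype.card_fin] at h'
    rw [hchi, show (ℓ + 1 + -1 : ℝ) = ℓ by ring]
    exact_mod_cast h'

end

end SquarePlusPrimeSquare

/-! ### The sieve estimate for one family of linear forms. -/

namespace SquarePlusPrimeSquare

open Filter Topology

/-- The product of the primes at which a family of linear forms, whose coefficient vectors have
norm `m`, degenerates. -/
def degen {ℓ : ℕ} (c b : Fin ℓ → ℤ) (m : ℕ) : ℕ :=
  2 * m * ∏ i, ∏ j, if i = j then 1 else (c i * b j - c j * b i).natAbs

section

variable {ℓ : ℕ} {c b : Fin ℓ → ℤ} {m : ℕ}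

theorem degen_ne_zero (hm0 : m ≠ 0) (hdet : ∀ i j, i ≠ j → c i * b j - c j * b i ≠ 0) :
    degen c b m ≠ 0 := by
  refine mul_ne_zero (mul_ne_zero two_ne_zero hm0) ?_
  refine Finset.prod_ne_zero_iff.2 fun i _ => Finset.prod_ne_zero_iff.2 fun j _ => ?_
  split_ifs with h
  · exact one_ne_zero
  · exact Int.natAbs_ne_zero.2 (hdet i j h)

theorem degen_le (hm0 : m ≠ 0) (hm : ∀ i, c i ^ 2 + b i ^ 2 = m) :
    degen c b m ≤ 2 * m * m ^ (ℓ * ℓ) := by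
  refine Nat.mul_le_mul_left _ ?_
  have h1 : ∀ i j, (if i = j then 1 else (c i * b j - c j * b i).natAbs) ≤ m := by
    intro i j
    split_ifs with h
    · exact Nat.pos_of_ne_zero hm0
    · zify
      refine abs_le_of_sq_le_sq ?_ (Int.natCast_nonneg m)
      -- By Lagrange's identity the squares of the determinant and of the inner product add up to
      -- `m^2`.
      have h2 : (c i ^ 2 + b i ^ 2) * (c j ^ 2 + b j ^ 2) = (m : ℤ) * m := by rw [hm i, hm j]
      nlinarith [sq_nonneg (c i * c j + b i * b j)]
  calc _ ≤ ∏ _i : Fin ℓ, m ^ ℓ := Finset.prod_le_prod' fun i _ =>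
        (Finset.prod_le_pow_card _ _ m fun j _ => h1 i j).trans_eq (by simp)
    _ = _ := by simp [← pow_mul]

theorem not_dvd_degen {p : ℕ} (h : ¬ p ∣ degen c b m) :
    p ≠ 2 ∧ (m : ZMod p) ≠ 0 ∧
      ∀ i j, i ≠ j → ((c i * b j - c j * b i : ℤ) : ZMod p) ≠ 0 := by
  refine ⟨?_, ?_, ?_⟩
  · rintro rfl
    exact h (Dvd.dvd.mul_right (Dvd.intro _ rfl) _)
  · intro h1
    exact h (Dvd.dvd.mul_right (((ZMod.natCast_eq_zero_iff m p).1 h1).mul_left _) _)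
  · intro i j hij h1
    rw [ZMod.intCast_zmod_eq_zero_iff_dvd, Int.natCast_dvd] at h1
    refine h (Dvd.dvd.mul_left (h1.trans ?_) _)
    refine Dvd.dvd.trans ?_ (Finset.dvd_prod_of_mem _ (Finset.mem_univ i))
    have h2 := Finset.dvd_prod_of_mem
      (fun j => if i = j then 1 else (c i * b j - c j * b i).natAbs) (Finset.mem_univ j)
    rwa [if_neg hij] at h2

end

/-- The level up to which we sieve. -/
noncomputable def sieveLevel (x : ℝ) : ℝ := Real.exp (Real.log x / Real.log (Real.log x) ^ 4)

/-- The sieving primes. -/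
noncomputable def sievePrimes {ℓ : ℕ} (c b : Fin ℓ → ℤ) (m : ℕ) (x : ℝ) : Finset ℕ :=
  (Nat.primesLE ⌊sieveLevel x⌋₊).filter fun p => ¬ p ∣ degen c b m

theorem tendsto_loglog : Tendsto (fun x : ℝ => Real.log (Real.log x)) atTop atTop :=
  Real.tendsto_log_atTop.comp Real.tendsto_log_atTop

theorem tendsto_log_div_loglog_pow (n : ℕ) :
    Tendsto (fun x : ℝ => Real.log x / Real.log (Real.log x) ^ n) atTop atTop := by
  refine ((Real.tendsto_exp_div_pow_atTop n).comp tendsto_loglog).congr' ?_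
  filter_upwards [eventually_log_pos] with x hx
  simp [Real.exp_log hx]

theorem tendsto_sieveLevel : Tendsto sieveLevel atTop atTop :=
  Real.tendsto_exp_atTop.comp (tendsto_log_div_loglog_pow 4)

/-- The lower bound controls the main product of the sieve, and the cruder upper bound its
truncation error. -/
theorem exists_sum_rho_bounds (ℓ : ℕ) : ∃ (B : ℕ) (C : ℝ), ∀ᶠ x : ℝ in atTop,
    ∀ (m : ℕ) (c b : Fin ℓ → ℤ), m ≠ 0 → (m : ℝ) ≤ x → (∀ i, c i ^ 2 + b i ^ 2 = m) →
    (∀ i j, i ≠ j → c i * b j - c j * b i ≠ 0) →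
    (ℓ + 1) * Real.log (Real.log x) - B * Real.log (Real.log (Real.log x)) - C ≤
      ∑ p ∈ sievePrimes c b m x, (rho c b p : ℝ) / (p : ℝ) ^ 2 ∧
    ∑ p ∈ sievePrimes c b m x, (rho c b p : ℝ) / (p : ℝ) ^ 2 ≤
      2 * (ℓ + 2) * Real.log (Real.log x) := by
  obtain ⟨C₁, hC₁⟩ := exists_sum_add_chi_ge (ℓ + 1) (by omega)
  obtain ⟨C₂, hC₂0, hC₂⟩ := exists_sum_inv_primeFactors_le
  obtain ⟨C₃, hC₃0, hC₃⟩ := exists_sum_inv_prime_le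
  have hsum2 : Summable fun n : ℕ => 1 / (n : ℝ) ^ 2 :=
    Real.summable_one_div_nat_pow.2 one_lt_two
  set S₂ := ∑' n : ℕ, 1 / (n : ℝ) ^ 2 with hS₂
  -- The sum reaches `log log z = L - 4 log L`, and the lower Mertens bound loses up to one more
  -- `log L`: together `5(ℓ+1)`. The primes dividing `degen`, whose reciprocals sum to at most `log
  -- L + O(1)`, cost `ℓ + 2`.
  refine ⟨5 * (ℓ + 1) + (ℓ + 2), C₁ + (ℓ + 2) * (Real.log 2 + C₂ + S₂), ?_⟩
  have hT : Tendsto (fun x : ℝ => (ℓ * ℓ + 2) * Real.log x) atTop atTop :=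
    Real.tendsto_log_atTop.const_mul_atTop (by positivity)
  filter_upwards [tendsto_sieveLevel.eventually hC₁, hT.eventually hC₂,
    tendsto_sieveLevel.eventually hC₃, tendsto_loglog.eventually_ge_atTop 1,
    tendsto_loglog.eventually_ge_atTop (Real.log (ℓ * ℓ + 2)),
    tendsto_loglog.eventually_ge_atTop C₃, eventually_ge_atTop 2, eventually_log_pos,
    (tendsto_log_div_loglog_pow 4).eventually_gt_atTop (Real.exp 1)]
    with x h1 h2 h3 hL hL2 hL3 hx2 hlog hlev m c b hm0 hmx hm hdet
  set L := Real.log (Real.log x) with hLdef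
  have hlogz : Real.log (sieveLevel x) = Real.log x / L ^ 4 := by rw [sieveLevel, Real.log_exp]
  have hloglogz : Real.log (Real.log (sieveLevel x)) = L - 4 * Real.log L := by
    rw [hlogz, Real.log_div hlog.ne' (by positivity), Real.log_pow, ← hLdef]; norm_num
  have hlogL : 0 ≤ Real.log L := Real.log_nonneg hL
  have hll1 : 1 ≤ L - 4 * Real.log L := by
    rw [← hloglogz, hlogz]
    rw [Real.le_log_iff_exp_le ((Real.exp_pos 1).trans hlev)]
    exact hlev.le
  have hD0 := degen_ne_zero hm0 hdet
  have hlogD : Real.log (degen c b m) ≤ (ℓ * ℓ + 2) * Real.log x := by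
    have hm' : (1 : ℝ) ≤ m := by exact_mod_cast Nat.pos_of_ne_zero hm0
    have h4 : (degen c b m : ℝ) ≤ x ^ (ℓ * ℓ + 2) := by
      calc (degen c b m : ℝ) ≤ 2 * m * m ^ (ℓ * ℓ) := by exact_mod_cast degen_le hm0 hm
        _ ≤ x * x * x ^ (ℓ * ℓ) := by gcongr
        _ = _ := by ring
    calc _ ≤ Real.log (x ^ (ℓ * ℓ + 2)) :=
          Real.log_le_log (by exact_mod_cast Nat.pos_of_ne_zero hD0) h4
      _ = _ := by rw [Real.log_pow]; push_cast; ring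
  have hpf := h2 _ hD0 hlogD
  have hpf' : ∑ p ∈ (degen c b m).primeFactors, 1 / (p : ℝ) ≤ Real.log 2 + Real.log L + C₂ := by
    refine hpf.trans ?_
    gcongr
    rw [← Real.log_mul (by norm_num) (by positivity),
      Real.log_mul (by positivity) hlog.ne', ← hLdef]
    refine Real.log_le_log (add_pos_of_nonneg_of_pos (Real.log_nonneg ?_) (by linarith))
      (by linarith)
    have : (0 : ℝ) ≤ ℓ * ℓ := by positivity
    linarith
  have hprime : ∀ p ∈ sievePrimes c b m x, p.Prime := fun p hp =>
    (Nat.mem_primesLE.1 (Finset.mem_filter.1 hp).1).2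
  constructor
  · have hterm : ∀ p ∈ Nat.primesLE ⌊sieveLevel x⌋₊, ((ℓ + 1 : ℕ) + chi p) / (p : ℝ) ≤
        (if p ∣ degen c b m then (ℓ + 2) * (1 / (p : ℝ)) else 0) +
        (if ¬ p ∣ degen c b m then (rho c b p : ℝ) / (p : ℝ) ^ 2 else 0) +
          (ℓ + 2) * (1 / (p : ℝ) ^ 2) := by
      intro p hp
      have hpp := (Nat.mem_primesLE.1 hp).2
      have : Fact p.Prime := ⟨hpp⟩
      have hp0 : (0 : ℝ) < p := by exact_mod_cast hpp.pos
      have hchi := (abs_le.1 (abs_chi_le p)).2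
      push_cast
      by_cases hd : p ∣ degen c b m
      · simp only [hd, not_true, if_true, if_false, add_zero]
        have h5 : (ℓ + 1 + chi p) / (p : ℝ) ≤ (ℓ + 2) * (1 / (p : ℝ)) := by
          rw [mul_one_div]
          exact div_le_div_of_nonneg_right (by linarith) hp0.le
        have h6 : 0 ≤ (ℓ + 2) * (1 / (p : ℝ) ^ 2) := by positivity
        linarith
      · simp only [hd, not_false_iff, if_true, if_false, zero_add]
        obtain ⟨hp2, hpm, hpd⟩ := not_dvd_degen hd
        have h5 := le_rho hm hpm hpd hp2
        rw [mul_one_div, ← add_div, div_le_div_iff₀ hp0 (by positivity)]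
        nlinarith
    have h7 := (h1.trans (Finset.sum_le_sum hterm))
    rw [Finset.sum_add_distrib, Finset.sum_add_distrib, ← Finset.sum_filter, ← Finset.sum_filter,
      ← Finset.mul_sum, ← Finset.mul_sum] at h7
    have h8 : ∑ p ∈ Nat.primesLE ⌊sieveLevel x⌋₊ with p ∣ degen c b m, 1 / (p : ℝ) ≤
        Real.log 2 + Real.log L + C₂ := by
      refine le_trans (Finset.sum_le_sum_of_subset_of_nonneg ?_ fun _ _ _ => by positivity) hpf'
      intro p hp
      obtain ⟨hp1, hp2⟩ := Finset.mem_filter.1 hp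
      exact Nat.mem_primeFactors.2 ⟨(Nat.mem_primesLE.1 hp1).2, hp2, hD0⟩
    have h9 : ∑ p ∈ Nat.primesLE ⌊sieveLevel x⌋₊, 1 / (p : ℝ) ^ 2 ≤ S₂ :=
      hsum2.sum_le_tsum _ fun _ _ => by positivity
    have h10 : Real.log (Real.log (Real.log (sieveLevel x))) ≤ Real.log L := by
      rw [hloglogz]
      exact Real.log_le_log (by linarith) (by linarith)
    rw [hloglogz] at h7 h10
    have h11 := mul_le_mul_of_nonneg_left h8 (by positivity : (0 : ℝ) ≤ ℓ + 2)
    have h12 := mul_le_mul_of_nonneg_left h9 (by positivity : (0 : ℝ) ≤ ℓ + 2)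
    have h13 := mul_le_mul_of_nonneg_left h10 (by positivity : (0 : ℝ) ≤ ℓ + 1)
    have h14 : ∑ p ∈ sievePrimes c b m x, (rho c b p : ℝ) / (p : ℝ) ^ 2 =
      ∑ p ∈ Nat.primesLE ⌊sieveLevel x⌋₊ with ¬ p ∣ degen c b m,
        (rho c b p : ℝ) / (p : ℝ) ^ 2 := rfl
    rw [h14]
    push_cast at h7 ⊢
    linarith
  · have hterm : ∀ p ∈ sievePrimes c b m x, (rho c b p : ℝ) / (p : ℝ) ^ 2 ≤
        (ℓ + 2) * (1 / (p : ℝ)) := by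
      intro p hp
      have hpp := hprime p hp
      have : Fact p.Prime := ⟨hpp⟩
      have hp0 : (0 : ℝ) < p := by exact_mod_cast hpp.pos
      have h5 : (rho c b p : ℝ) ≤ (ℓ + 2) * p := by
        exact_mod_cast rho_le hm (not_dvd_degen (Finset.mem_filter.1 hp).2).2.1
      rw [mul_one_div, div_le_div_iff₀ (by positivity) hp0]
      nlinarith
    refine (Finset.sum_le_sum hterm).trans ?_
    rw [← Finset.mul_sum]
    have h8 : ∑ p ∈ sievePrimes c b m x, 1 / (p : ℝ) ≤ 2 * L := by
      refine (Finset.sum_le_sum_of_subset_of_nonneg (Finset.filter_subset _ _)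
        fun _ _ _ => by positivity).trans (h3.trans ?_)
      rw [hloglogz]
      linarith
    calc _ ≤ ((ℓ : ℝ) + 2) * (2 * L) := by gcongr
      _ = _ := by ring

/-- Apply `T^n / n! ≤ exp T` at `T = e S`, with `e < 3`. This makes the first omitted Bonferroni
term tiny once `n` is well beyond `3S`. -/
theorem pow_div_factorial_le {S : ℝ} (hS : 0 ≤ S) (n : ℕ) :
    S ^ n / (n.factorial : ℝ) ≤ Real.exp (3 * S - n) := by
  have h1 := Real.pow_div_factorial_le_exp (Real.exp 1 * S) (by positivity) n
  have h2 : S ^ n / (n.factorial : ℝ) =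
      (Real.exp 1 * S) ^ n / (n.factorial : ℝ) * Real.exp (-(n : ℝ)) := by
    rw [mul_pow, ← Real.exp_nat_mul, mul_one, Real.exp_neg]
    field_simp
  rw [h2, sub_eq_add_neg, Real.exp_add]
  refine mul_le_mul_of_nonneg_right (h1.trans (Real.exp_le_exp.2 ?_)) (Real.exp_nonneg _)
  exact mul_le_mul_of_nonneg_right (by linarith [Real.exp_one_lt_d9]) hS

open Classical in
/-- The points `(u, v)` of the square of side about `2 * √(x / m)` such that `u ^ 2 + v ^ 2` and
all the linear forms are free of primes up to the sieve level. -/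
noncomputable def sifted {ℓ : ℕ} (c b : Fin ℓ → ℤ) (m : ℕ) (x : ℝ) : Finset (ℤ × ℤ) :=
  (box ⌊√(x / m)⌋₊).filter fun y => ∀ p : ℕ, p.Prime → (p : ℝ) ≤ sieveLevel x →
    ¬ (p : ℤ) ∣ form c b y.1 y.2

/-- The sieve bound for the number of sifted points. -/
theorem exists_card_sifted_le (ℓ : ℕ) : ∃ (B : ℕ) (C : ℝ), 0 < C ∧ ∀ᶠ x : ℝ in atTop,
    ∀ (m : ℕ) (c b : Fin ℓ → ℤ), m ≠ 0 →
    m * Real.exp (Real.log x / Real.log (Real.log x) ^ 2) ≤ x →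
    (∀ i, c i ^ 2 + b i ^ 2 = m) → (∀ i j, i ≠ j → c i * b j - c j * b i ≠ 0) →
    ((sifted c b m x).card : ℝ) ≤
      C * (x / m) * Real.log (Real.log x) ^ B / Real.log x ^ (ℓ + 1) := by
  classical
  obtain ⟨B, C, hBC⟩ := exists_sum_rho_bounds ℓ
  -- The truncation index satisfies `J ≥ 2KL = (8ℓ+16)L`, while three times the sum of the densities
  -- is at most `(6ℓ+12)L`. The surplus exceeds the required `(ℓ+1)L`.
  set K : ℕ := 4 * ℓ + 8 with hK
  refine ⟨B, 9 * (Real.exp C + 2), by positivity, ?_⟩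
  filter_upwards [hBC, tendsto_loglog.eventually_ge_atTop (24 * K), eventually_log_pos,
    tendsto_sieveLevel.eventually_ge_atTop (ℓ + 3), eventually_gt_atTop 1,
    (tendsto_log_div_loglog_pow 3).eventually_ge_atTop (4 * (ℓ + 1))]
    with x hsum hL hlog hz hx1 hpow m c b hm0 hmx hm hdet
  set L := Real.log (Real.log x) with hLdef
  set z := sieveLevel x with hzdef
  set w := Real.exp (Real.log x / L ^ 2) with hw
  set X := x / m with hX
  set Y := ⌊√X⌋₊ with hY
  set W := sievePrimes c b m x with hW
  have hKpos : (8 : ℝ) ≤ K := by rw [hK]; push_cast; linarith [Nat.cast_nonneg (α := ℝ) ℓ]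
  have hL1 : 1 ≤ L := by nlinarith
  have hL0 : 0 < L := by linarith
  have hm' : (1 : ℝ) ≤ m := by exact_mod_cast Nat.pos_of_ne_zero hm0
  have hw1 : 1 ≤ w := Real.one_le_exp (by positivity)
  have hwX : w ≤ X := by rw [hX, le_div_iff₀ (by linarith)]; linarith
  have hX1 : 1 ≤ X := hw1.trans hwX
  have hmx' : (m : ℝ) ≤ x := (le_mul_of_one_le_right (by linarith) hw1).trans hmx
  obtain ⟨hlow, hup⟩ := hsum m c b hm0 hmx' hm hdet
  have hprime : ∀ p ∈ W, p.Prime := fun p hp =>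
    (Nat.mem_primesLE.1 (Finset.mem_filter.1 hp).1).2
  have hz0 : 0 ≤ z := by linarith [Nat.cast_nonneg (α := ℝ) ℓ]
  have hz1 : 1 ≤ z := by linarith [Nat.cast_nonneg (α := ℝ) ℓ]
  have hpz : ∀ p ∈ W, (p : ℝ) ≤ z := fun p hp =>
    (Nat.le_floor_iff hz0).1 (Nat.mem_primesLE.1 (Finset.mem_filter.1 hp).1).1
  set J : ℕ := 2 * ⌈(K : ℝ) * L⌉₊ with hJ
  have hJlow : 2 * (K : ℝ) * L ≤ J := by
    rw [hJ]; push_cast; linarith [Nat.le_ceil ((K : ℝ) * L)]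
  have hJup : (J : ℝ) ≤ 3 * K * L := by
    have h1 := Nat.ceil_lt_add_one (show 0 ≤ (K : ℝ) * L by positivity)
    have h2 : (8 : ℝ) * 1 ≤ K * L := mul_le_mul hKpos hL1 zero_le_one (by linarith)
    rw [hJ]; push_cast; linarith
  have hlogxpow : Real.log x ^ (ℓ + 1) = Real.exp ((ℓ + 1) * L) := by
    rw [show ((ℓ : ℝ) + 1) * L = ((ℓ + 1 : ℕ) : ℝ) * L by push_cast; ring, Real.exp_nat_mul, hLdef,
      Real.exp_log hlog]
  -- As `J` is of order `L`, the gap between `L^4` in `log z` and `L^2` in `log w` keeps even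
  -- `z^(2J)` below `w^(1/4)`.
  have hz2J : (z ^ 2) ^ J ≤ Real.exp (Real.log x / L ^ 2 / 4) := by
    rw [← pow_mul, hzdef, sieveLevel, ← Real.exp_nat_mul]
    refine Real.exp_le_exp.2 ?_
    push_cast
    calc 2 * (J : ℝ) * (Real.log x / L ^ 4) ≤ 2 * (3 * K * L) * (Real.log x / L ^ 4) := by gcongr
      _ = (24 * K / L) * (Real.log x / L ^ 2 / 4) := by field_simp; ring
      _ ≤ 1 * (Real.log x / L ^ 2 / 4) := by
          gcongr
          exact (div_le_one hL0).2 hL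
      _ = _ := one_mul _
  have hw4 : Real.exp (Real.log x / L ^ 2 / 4) ^ 4 = w := by
    rw [← Real.exp_nat_mul]; congr 1; push_cast; ring
  set w₄ := Real.exp (Real.log x / L ^ 2 / 4) with hw₄
  have hw₄1 : 1 ≤ w₄ := Real.one_le_exp (by positivity)
  have hw₄X : w₄ ^ 2 ≤ √X := by
    refine Real.le_sqrt_of_sq_le ?_
    rw [← pow_mul]; rw [hw4]; exact hwX
  have hMlow : √X ≤ 2 * (Y : ℝ) + 1 := by
    have := Nat.lt_floor_add_one √X
    rw [← hY] at this
    linarith [Nat.cast_nonneg (α := ℝ) Y]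
  have hsX : 1 ≤ √X := Real.one_le_sqrt.2 hX1
  have hMup : 2 * (Y : ℝ) + 1 ≤ 3 * √X := by
    have := Nat.floor_le (Real.sqrt_nonneg X)
    linarith
  have hzJ : z ^ J ≤ 2 * Y + 1 := by
    calc z ^ J ≤ (z ^ 2) ^ J := by gcongr; exact le_self_pow₀ hz1 two_ne_zero
      _ ≤ w₄ := hz2J
      _ ≤ w₄ ^ 2 := le_self_pow₀ hw₄1 two_ne_zero
      _ ≤ _ := hw₄X.trans hMlow
  have hsieve := brun_sieve c b Y (ℓ + 2) J ⟨_, two_mul _⟩ W hprime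
    (fun p hp => by
      have : Fact p.Prime := ⟨hprime p hp⟩
      exact rho_le hm (not_dvd_degen (Finset.mem_filter.1 hp).2).2.1) hpz hz1 hzJ
  -- Dropping the conditions at the primes dividing `degen` only enlarges the set.
  have hsub : (sifted c b m x).card ≤
      ((box Y).filter fun y : ℤ × ℤ => ∀ p ∈ W, ¬ (p : ℤ) ∣ form c b y.1 y.2).card := by
    refine Finset.card_le_card fun y hy => ?_
    rw [sifted, Finset.mem_filter] at hy
    rw [Finset.mem_filter]
    exact ⟨hy.1, fun p hp => hy.2 p (hprime p hp) (hpz p hp)⟩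
  have hprod : ∏ p ∈ W, (1 - (rho c b p : ℝ) / (p : ℝ) ^ 2) ≤
      Real.exp C * L ^ B / Real.log x ^ (ℓ + 1) := by
    calc _ ≤ ∏ p ∈ W, Real.exp (-((rho c b p : ℝ) / (p : ℝ) ^ 2)) := by
          refine Finset.prod_le_prod (fun p _ => sub_nonneg.2 (rho_le_sq c b p)) fun p _ => ?_
          linarith [Real.add_one_le_exp (-((rho c b p : ℝ) / (p : ℝ) ^ 2))]
      _ = Real.exp (-∑ p ∈ W, (rho c b p : ℝ) / (p : ℝ) ^ 2) := by
          rw [← Real.exp_sum, Finset.sum_neg_distrib]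
      _ ≤ Real.exp (C + B * Real.log L - (ℓ + 1) * L) := Real.exp_le_exp.2 (by linarith)
      _ = _ := by
          rw [Real.exp_sub, Real.exp_add, Real.exp_nat_mul, Real.exp_log hL0, hlogxpow]
  have hinv : Real.exp (-((ℓ + 1) * L)) ≤ L ^ B / Real.log x ^ (ℓ + 1) := by
    rw [Real.exp_neg, hlogxpow, ← one_div]
    gcongr
    exact one_le_pow₀ hL1
  have hfact : (∑ p ∈ W, (rho c b p : ℝ) / (p : ℝ) ^ 2) ^ (J + 1) / ((J + 1).factorial : ℝ) ≤
      L ^ B / Real.log x ^ (ℓ + 1) := by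
    refine le_trans ?_ hinv
    have hS0 : 0 ≤ ∑ p ∈ W, (rho c b p : ℝ) / (p : ℝ) ^ 2 :=
      Finset.sum_nonneg fun p _ => by positivity
    refine (pow_div_factorial_le hS0 (J + 1)).trans (Real.exp_le_exp.2 ?_)
    have h4 : (K : ℝ) = 4 * ℓ + 8 := by rw [hK]; push_cast; ring
    rw [h4] at hJlow
    have h5 : 0 ≤ (ℓ : ℝ) * L := by positivity
    push_cast
    linarith
  -- The remainder is at most `9 √X w^(1/4)`. Since `√X ≥ w^(1/2)`, this saves `w^(1/4)` over `X`,
  -- more than any fixed power of `log x`.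
  have herr : 3 * (2 * (Y : ℝ) + 1) * (1 + ((ℓ + 2 : ℕ) : ℝ) * W.card) ^ J ≤
      9 * X * (L ^ B / Real.log x ^ (ℓ + 1)) := by
    have hWc : (W.card : ℝ) ≤ z := by
      refine le_trans ?_ (Nat.floor_le hz0)
      have : W ⊆ Finset.Icc 1 ⌊z⌋₊ := fun p hp =>
        Finset.mem_Icc.2 ⟨(hprime p hp).one_le, (Nat.mem_primesLE.1 (Finset.mem_filter.1 hp).1).1⟩
      have := Finset.card_le_card this
      rw [Nat.card_Icc, Nat.add_sub_cancel] at this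
      exact_mod_cast this
    have h1 : (1 + ((ℓ + 2 : ℕ) : ℝ) * W.card) ^ J ≤ w₄ := by
      refine le_trans ?_ hz2J
      gcongr
      calc 1 + ((ℓ + 2 : ℕ) : ℝ) * W.card ≤ z + ((ℓ + 2 : ℕ) : ℝ) * z := by gcongr
        _ = (ℓ + 3) * z := by push_cast; ring
        _ ≤ z * z := by gcongr
        _ = _ := (sq z).symm
    have h2 : w₄⁻¹ ≤ L ^ B / Real.log x ^ (ℓ + 1) := by
      refine le_trans ?_ hinv
      rw [hw₄, ← Real.exp_neg]
      refine Real.exp_le_exp.2 (neg_le_neg ?_)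
      calc ((ℓ : ℝ) + 1) * L ≤ (Real.log x / L ^ 3) / 4 * L := by gcongr; linarith
        _ = _ := by field_simp
    calc _ ≤ 3 * (3 * √X) * w₄ := by gcongr
      _ = 9 * √X * (w₄ ^ 2 * w₄⁻¹) := by field_simp; ring
      _ ≤ 9 * √X * (√X * (L ^ B / Real.log x ^ (ℓ + 1))) := by gcongr
      _ = 9 * (√X * √X) * (L ^ B / Real.log x ^ (ℓ + 1)) := by ring
      _ = _ := by rw [Real.mul_self_sqrt (by linarith)]
  have hM2 : (2 * (Y : ℝ) + 1) ^ 2 ≤ 9 * X := by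
    calc (2 * (Y : ℝ) + 1) ^ 2 ≤ (3 * √X) ^ 2 := by gcongr
      _ = _ := by rw [mul_pow, Real.sq_sqrt (by linarith)]; norm_num
  have hrpos : 0 ≤ L ^ B / Real.log x ^ (ℓ + 1) := by positivity
  calc _ ≤ _ := (Nat.cast_le.2 hsub).trans hsieve
    _ ≤ 9 * X * (Real.exp C * L ^ B / Real.log x ^ (ℓ + 1) + L ^ B / Real.log x ^ (ℓ + 1)) +
        9 * X * (L ^ B / Real.log x ^ (ℓ + 1)) := by
        refine add_le_add ?_ herr
        refine (mul_le_mul_of_nonneg_left (add_le_add hprod hfact) (by positivity)).trans ?_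
        gcongr
    _ = _ := by ring

end SquarePlusPrimeSquare

/-! ### Integer points of given norm, and their number under multiplication by prime powers. -/

namespace SquarePlusPrimeSquare

/-- The integer points of norm `m`. -/
noncomputable def normReps (m : ℕ) : Finset (ℤ × ℤ) :=
  (box m).filter fun x => x.1 ^ 2 + x.2 ^ 2 = m

theorem mem_normReps {m : ℕ} {x : ℤ × ℤ} : x ∈ normReps m ↔ x.1 ^ 2 + x.2 ^ 2 = m := by
  have key : ∀ a b : ℤ, a ^ 2 + b ^ 2 = m → a ∈ Finset.Icc (-(m : ℤ)) m := by
    intro a b h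
    have h1 := Int.le_self_sq a
    have h2 := Int.le_self_sq (-a)
    rw [Finset.mem_Icc]
    constructor <;> nlinarith [sq_nonneg b]
  rw [normReps, Finset.mem_filter, box, Finset.mem_product, and_iff_right_iff_imp]
  exact fun h => ⟨key _ _ h, key x.2 x.1 (by rw [← h]; ring)⟩

/-- Division of a sum of two squares by a prime that is itself a sum of two squares. -/
theorem exists_of_sq_add_sq_eq_mul {q : ℕ} (hq : q.Prime) {u v a p m : ℤ} (huv : u ^ 2 + v ^ 2 = q)
    (h : a ^ 2 + p ^ 2 = m * q) :
    ∃ s t : ℤ, s ^ 2 + t ^ 2 = m ∧ a = s * u + t * v ∧ (p = s * v - t * u ∨ p = t * u - s * v) := by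
  have hq' : Prime (q : ℤ) := Nat.prime_iff_prime_int.1 hq
  have hq0 : (q : ℤ) ≠ 0 := hq'.ne_zero
  have key : ∀ v : ℤ, u ^ 2 + v ^ 2 = q → (q : ℤ) ∣ a * v - p * u →
      ∃ s t : ℤ, s ^ 2 + t ^ 2 = m ∧ a = s * u + t * v ∧ p = s * v - t * u := by
    intro v huv hdvd
    obtain ⟨t, ht⟩ := hdvd
    have h1 : (q : ℤ) ∣ a * u + p * v := by
      refine hq'.dvd_of_dvd_pow (n := 2) ⟨q * (m - t ^ 2), ?_⟩
      linear_combination (u ^ 2 + v ^ 2) * h + m * q * huv - (a * v - p * u + q * t) * ht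
    obtain ⟨s, hs⟩ := h1
    refine ⟨s, t, ?_, ?_, ?_⟩
    · refine mul_left_cancel₀ (pow_ne_zero 2 hq0) ?_
      linear_combination (u ^ 2 + v ^ 2) * h + m * q * huv - (a * v - p * u + q * t) * ht -
        (a * u + p * v + q * s) * hs
    · refine mul_left_cancel₀ hq0 ?_
      linear_combination u * hs + v * ht - a * huv
    · refine mul_left_cancel₀ hq0 ?_
      linear_combination v * hs - u * ht - p * huv
  -- In Gaussian terms, `u + iv` or its conjugate divides `a + ip`. Replacing `v` by `-v` reduces
  -- the second case to the first.
  have hprod : (q : ℤ) ∣ (a * v - p * u) * (a * v + p * u) :=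
    ⟨a ^ 2 - m * u ^ 2, by linear_combination a ^ 2 * huv - u ^ 2 * h⟩
  rcases hq'.dvd_or_dvd hprod with hd | hd
  · obtain ⟨s, t, h1, h2, h3⟩ := key v huv hd
    exact ⟨s, t, h1, h2, Or.inl h3⟩
  · obtain ⟨s, t, h1, h2, h3⟩ := key (-v) (by rw [← huv]; ring)
      (by rw [← dvd_neg]; convert! hd using 1; ring)
    exact ⟨s, -t, by rw [← h1]; ring, by rw [h2]; ring, Or.inr (by rw [h3]; ring)⟩

/-- Peeling off factors of `q` one at a time, each is `u + iv` or its conjugate. A point of norm `m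
q^a` is thus determined by the number of factors of the first kind and a point of norm `m`. -/
theorem card_normReps_mul_pow_le {q : ℕ} (hq : q.Prime) (hq4 : q % 4 ≠ 3) (m a : ℕ) :
    (normReps (m * q ^ a)).card ≤ (a + 1) * (normReps m).card := by
  classical
  have : Fact q.Prime := ⟨hq⟩
  obtain ⟨u, v, huv⟩ := Nat.Prime.sq_add_sq hq4
  have huv' : (u : ℤ) ^ 2 + (v : ℤ) ^ 2 = q := by exact_mod_cast huv
  let π : GaussianInt := ⟨u, v⟩
  let π' : GaussianInt := ⟨u, -v⟩
  have hfac : ∀ a : ℕ, ∀ z : GaussianInt, z.re ^ 2 + z.im ^ 2 = (m : ℤ) * q ^ a →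
      ∃ j ≤ a, ∃ g : GaussianInt, g.re ^ 2 + g.im ^ 2 = m ∧ z = π ^ j * π' ^ (a - j) * g := by
    intro a
    induction a with
    | zero => intro z hz; exact ⟨0, le_rfl, z, by simpa using hz, by simp⟩
    | succ a ih =>
      intro z hz
      obtain ⟨s, t, h1, h2, h3⟩ := exists_of_sq_add_sq_eq_mul hq huv' (m := m * q ^ a)
        (hz.trans (by ring))
      rcases h3 with h3 | h3
      · obtain ⟨j, hj, g, hg, hgz⟩ := ih ⟨s, -t⟩ (by simpa using h1)
        refine ⟨j + 1, by omega, g, hg, ?_⟩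
        have : z = π * ⟨s, -t⟩ := by
          ext
          · simp [π, h2]; ring
          · simp [π, h3]; ring
        rw [this, hgz, Nat.add_sub_add_right]
        ring
      · obtain ⟨j, hj, g, hg, hgz⟩ := ih ⟨s, t⟩ (by simpa using h1)
        refine ⟨j, by omega, g, hg, ?_⟩
        have : z = π' * ⟨s, t⟩ := by
          ext
          · simp [π', h2]; ring
          · simp [π', h3]; ring
        rw [this, hgz, Nat.sub_add_comm hj]
        ring
  have hsub : normReps (m * q ^ a) ⊆ (Finset.range (a + 1) ×ˢ normReps m).image fun y =>
      ((π ^ y.1 * π' ^ (a - y.1) * (⟨y.2.1, y.2.2⟩ : GaussianInt)).re,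
        (π ^ y.1 * π' ^ (a - y.1) * (⟨y.2.1, y.2.2⟩ : GaussianInt)).im) := by
    intro x hx
    rw [mem_normReps] at hx
    obtain ⟨j, hj, g, hg, hgz⟩ := hfac a ⟨x.1, x.2⟩ (by rw [hx]; push_cast; rfl)
    refine Finset.mem_image.2 ⟨(j, (g.re, g.im)), Finset.mem_product.2
      ⟨Finset.mem_range.2 (by omega), mem_normReps.2 hg⟩, ?_⟩
    have hg' : (⟨g.re, g.im⟩ : GaussianInt) = g := rfl
    simp only [hg', ← hgz]
  refine (Finset.card_le_card hsub).trans (Finset.card_image_le.trans ?_)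
  rw [Finset.card_product, Finset.card_range]

theorem dvd_of_dvd_sq_add_sq {q : ℕ} (hq : q.Prime) (hq4 : q % 4 = 3) {x y : ℤ}
    (h : (q : ℤ) ∣ x ^ 2 + y ^ 2) : (q : ℤ) ∣ x ∧ (q : ℤ) ∣ y := by
  have : Fact q.Prime := ⟨hq⟩
  have key : ∀ x y : ℤ, (q : ℤ) ∣ x ^ 2 + y ^ 2 → (q : ℤ) ∣ y := by
    intro x y h
    rw [← ZMod.intCast_zmod_eq_zero_iff_dvd] at h ⊢
    push_cast at h
    by_contra hy
    exact ZMod.mod_four_ne_three_of_sq_eq_neg_sq' hy (eq_neg_of_add_eq_zero_left h) hq4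
  exact ⟨key y x (by rwa [add_comm]), key x y h⟩

theorem card_normReps_mul_eq_zero {q : ℕ} (hq : q.Prime) (hq4 : q % 4 = 3) {m : ℕ} (hm : ¬ q ∣ m) :
    (normReps (m * q)).card = 0 := by
  rw [Finset.card_eq_zero, Finset.eq_empty_iff_forall_notMem]
  intro x hx
  rw [mem_normReps] at hx
  have hq0 : (q : ℤ) ≠ 0 := by exact_mod_cast hq.ne_zero
  obtain ⟨⟨s, hs⟩, ⟨t, ht⟩⟩ := dvd_of_dvd_sq_add_sq hq hq4
    (show (q : ℤ) ∣ x.1 ^ 2 + x.2 ^ 2 by rw [hx]; push_cast; exact Dvd.intro_left _ rfl)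
  refine hm (Int.natCast_dvd_natCast.1 ⟨s ^ 2 + t ^ 2, mul_left_cancel₀ hq0 ?_⟩)
  rw [hs, ht] at hx
  push_cast at hx
  linear_combination -hx

/-- Both coordinates are divisible by `q`, so dividing by `q` lowers the exponent by two. Odd
exponents descend to exponent `1`, where no points exist. -/
theorem card_normReps_mul_pow_le_of_three {q : ℕ} (hq : q.Prime) (hq4 : q % 4 = 3) {m : ℕ}
    (hm : ¬ q ∣ m) (a : ℕ) : (normReps (m * q ^ a)).card ≤ (normReps m).card := by
  classical
  induction a using Nat.twoStepInduction with
  | zero => simp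
  | one => rw [pow_one, card_normReps_mul_eq_zero hq hq4 hm]; exact Nat.zero_le _
  | more a ih _ =>
    refine le_trans ?_ ih
    have hq0 : (q : ℤ) ≠ 0 := by exact_mod_cast hq.ne_zero
    have hsub : normReps (m * q ^ (a + 2)) ⊆
        (normReps (m * q ^ a)).image fun y => ((q : ℤ) * y.1, (q : ℤ) * y.2) := by
      intro x hx
      rw [mem_normReps] at hx
      obtain ⟨⟨s, hs⟩, ⟨t, ht⟩⟩ := dvd_of_dvd_sq_add_sq hq hq4
        (show (q : ℤ) ∣ x.1 ^ 2 + x.2 ^ 2 by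
          rw [hx]; push_cast; exact ⟨m * q ^ (a + 1), by ring⟩)
      refine Finset.mem_image.2 ⟨(s, t), mem_normReps.2 ?_, by rw [← hs, ← ht]⟩
      rw [hs, ht] at hx
      push_cast at hx ⊢
      refine mul_left_cancel₀ (pow_ne_zero 2 hq0) ?_
      linear_combination hx
    exact (Finset.card_le_card hsub).trans Finset.card_image_le

/-- Gaussian integers of even norm are multiples of `1 + i`; the map is multiplication by `1 + i`
after conjugation. -/
theorem card_normReps_mul_two_le (m : ℕ) : (normReps (m * 2)).card ≤ (normReps m).card := by
  classical
  have hsub : normReps (m * 2) ⊆ (normReps m).image fun y => (y.1 + y.2, y.1 - y.2) := by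
    intro x hx
    rw [mem_normReps] at hx
    push_cast at hx
    have hev : Even (x.1 + x.2) := by
      have h1 : Even (x.1 ^ 2 + x.2 ^ 2) := by rw [hx]; exact even_two.mul_left _
      simpa [Int.even_add, Int.even_pow] using h1
    obtain ⟨s, hs⟩ := hev
    refine Finset.mem_image.2 ⟨(s, x.1 - s), mem_normReps.2 ?_, ?_⟩
    · simp only
      have h2 : x.2 = 2 * s - x.1 := by linarith
      rw [h2] at hx
      nlinarith
    · ext <;> simp; linarith
  exact (Finset.card_le_card hsub).trans Finset.card_image_le

theorem card_normReps_two_pow_le (a : ℕ) : (normReps (2 ^ a)).card ≤ (normReps 1).card := by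
  induction a with
  | zero => simp
  | succ a ih => rw [pow_succ]; exact (card_normReps_mul_two_le _).trans ih

/-- The local factor in the bound for the number of points of norm `m`. -/
noncomputable def localFactor (p a : ℕ) : ℝ := if a = 1 then 1 + chi p else a + 1

theorem localFactor_nonneg (p a : ℕ) : 0 ≤ localFactor p a := by
  unfold localFactor
  split_ifs
  · linarith [(abs_le.1 (abs_chi_le p)).1]
  · positivity

theorem localFactor_le (p a : ℕ) : localFactor p a ≤ a + 1 := by
  unfold localFactor
  split_ifs with h
  · rw [h]; push_cast; linarith [(abs_le.1 (abs_chi_le p)).2]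
  · exact le_rfl

/-- Exponent `1` needs the exact factor `2` or `0`, which determines the coefficient `2^(ℓ-1)` of
`L`. For higher exponents the crude `a + 1` suffices, as they contribute a convergent sum. -/
theorem card_normReps_le_localFactor {q : ℕ} (hq : q.Prime) (hodd : Odd q) {m : ℕ} (hm : ¬ q ∣ m)
    (a : ℕ) :
    ((normReps (m * q ^ a)).card : ℝ) ≤ localFactor q a * (normReps m).card := by
  obtain ⟨t, ht⟩ := hodd
  have hmod : q % 4 = 1 ∨ q % 4 = 3 := by omega
  rcases hmod with h4 | h4
  · have hchi : chi q = 1 := by rw [chi, ZMod.χ₄_nat_one_mod_four h4]; simp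
    have h1 : localFactor q a = a + 1 := by
      unfold localFactor
      split_ifs with h
      · rw [hchi, h]; norm_num
      · rfl
    rw [h1]
    exact_mod_cast card_normReps_mul_pow_le hq (by omega) m a
  · by_cases ha : a = 1
    · rw [ha, pow_one, card_normReps_mul_eq_zero hq h4 hm, Nat.cast_zero]
      exact mul_nonneg (localFactor_nonneg _ _) (Nat.cast_nonneg _)
    · have h1 := card_normReps_mul_pow_le_of_three hq h4 hm a
      have h2 : ((normReps (m * q ^ a)).card : ℝ) ≤ (normReps m).card := by exact_mod_cast h1
      rw [localFactor, if_neg ha]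
      refine h2.trans (le_mul_of_one_le_left (Nat.cast_nonneg _) ?_)
      linarith [Nat.cast_nonneg (α := ℝ) a]

end SquarePlusPrimeSquare

/-! ### Moments of the number of points of norm `m` over `m` with `j` odd prime factors. -/

namespace SquarePlusPrimeSquare

open Filter Topology

theorem omegaStar_mul_pow {p m a : ℕ} (hp : p.Prime) (hodd : Odd p) (hm : m ≠ 0) (hpm : ¬ p ∣ m)
    (ha : a ≠ 0) : omegaStar (m * p ^ a) = omegaStar m + 1 := by
  unfold omegaStar
  rw [Nat.primeFactors_mul hm (pow_ne_zero a hp.ne_zero), Nat.primeFactors_prime_pow ha hp,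
    Finset.filter_union, Finset.filter_singleton, if_pos hodd, Finset.card_union_of_disjoint,
    Finset.card_singleton]
  rw [Finset.disjoint_singleton_right]
  intro h
  exact hpm (Nat.dvd_of_mem_primeFactors (Finset.mem_filter.1 h).1)

/-- The prime power splitting off an odd prime factor. -/
theorem split_prime {p m : ℕ} (hm : m ≠ 0) (hp : p ∈ m.primeFactors.filter fun p => Odd p) :
    m = ordCompl[p] m * p ^ m.factorization p ∧ m.factorization p ≠ 0 ∧ ¬ p ∣ ordCompl[p] m ∧
      ordCompl[p] m ≠ 0 ∧ omegaStar m = omegaStar (ordCompl[p] m) + 1 := by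
  obtain ⟨hp1, hodd⟩ := Finset.mem_filter.1 hp
  have hpp := Nat.prime_of_mem_primeFactors hp1
  have h1 : m = ordCompl[p] m * p ^ m.factorization p := by
    rw [mul_comm]; exact (Nat.ordProj_mul_ordCompl_eq_self m p).symm
  have h2 : m.factorization p ≠ 0 :=
    (hpp.factorization_pos_of_dvd hm (Nat.dvd_of_mem_primeFactors hp1)).ne'
  have h3 := Nat.not_dvd_ordCompl hpp hm
  have h4 := (Nat.ordCompl_pos p hm).ne'
  refine ⟨h1, h2, h3, h4, ?_⟩
  conv_lhs => rw [h1]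
  exact omegaStar_mul_pow hpp hodd h4 h3 h2

theorem eq_two_pow_of_omegaStar {m : ℕ} (hm : m ≠ 0) (h : omegaStar m = 0) :
    m = 2 ^ m.factorization 2 := by
  have h1 : ∀ q ∈ m.primeFactors, q = 2 := by
    intro q hq
    rcases (Nat.prime_of_mem_primeFactors hq).eq_two_or_odd' with h2 | h2
    · exact h2
    · exact absurd (Finset.mem_filter.2 ⟨hq, h2⟩)
        (Finset.eq_empty_iff_forall_notMem.1 (Finset.card_eq_zero.1 h) q)
  exact Nat.eq_prime_pow_of_unique_prime_dvd hm (fun {q} hq hqm =>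
    h1 q (Nat.mem_primeFactors.2 ⟨hq, hqm, hm⟩)) |>.trans
      (by
        congr 1
        have h2 := Nat.eq_prime_pow_of_unique_prime_dvd hm (fun {q} hq hqm =>
          h1 q (Nat.mem_primeFactors.2 ⟨hq, hqm, hm⟩))
        conv_rhs => rw [h2]
        rw [Nat.Prime.factorization_pow Nat.prime_two]
        simp)

/-- A pointwise bound for the number of points of norm `m`. -/
theorem card_normReps_le {N : ℕ} (k : ℕ) : ∀ m : ℕ, m ≠ 0 → m ≤ N → omegaStar m = k →
    (normReps m).card ≤ (Nat.log 2 N + 1) ^ k * (normReps 1).card := by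
  induction k with
  | zero =>
    intro m hm _ h
    rw [eq_two_pow_of_omegaStar hm h, pow_zero, one_mul]
    exact card_normReps_two_pow_le _
  | succ k ih =>
    intro m hm hmN h
    obtain ⟨p, hp⟩ := Finset.card_pos.1 (show 0 < omegaStar m by omega)
    obtain ⟨h1, h2, h3, h4, h5⟩ := split_prime hm hp
    have hpp := Nat.prime_of_mem_primeFactors (Finset.mem_filter.1 hp).1
    set a := m.factorization p
    have h6 : a ≤ Nat.log 2 N := by
      refine Nat.le_log_of_pow_le one_lt_two ?_
      calc 2 ^ a ≤ p ^ a := Nat.pow_le_pow_left hpp.two_le a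
        _ ≤ m := Nat.le_of_dvd (Nat.pos_of_ne_zero hm) (Dvd.intro_left _ h1.symm)
        _ ≤ N := hmN
    have h7 := card_normReps_le_localFactor hpp (Finset.mem_filter.1 hp).2 h3 a
    rw [← h1] at h7
    have h8 : (normReps m).card ≤ (a + 1) * (normReps (ordCompl[p] m)).card := by
      have := h7.trans (mul_le_mul_of_nonneg_right (localFactor_le p a) (Nat.cast_nonneg _))
      exact_mod_cast this
    have h9 := ih _ h4 ((Nat.ordCompl_le m p).trans hmN) (by omega)
    calc _ ≤ _ := h8
      _ ≤ (Nat.log 2 N + 1) * ((Nat.log 2 N + 1) ^ k * (normReps 1).card) :=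
          Nat.mul_le_mul (by omega) h9
      _ = _ := by ring

/-- The moment sum over integers with `j` odd prime factors. -/
noncomputable def momentSum (ℓ j N : ℕ) : ℝ :=
  ∑ m ∈ (Finset.Icc 1 N).filter (fun m => omegaStar m = j), ((normReps m).card : ℝ) ^ ℓ / m

/-- The sum of the local terms over odd prime powers. -/
noncomputable def primePowerSum (ℓ N : ℕ) : ℝ :=
  ∑ p ∈ (Nat.primesLE N).filter (fun p => Odd p), ∑ a ∈ Finset.Icc 1 N,
    localFactor p a ^ ℓ / (p : ℝ) ^ a

theorem momentSum_zero_le (ℓ N : ℕ) : momentSum ℓ 0 N ≤ 2 * ((normReps 1).card : ℝ) ^ ℓ := by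
  unfold momentSum
  set f : ℕ → ℝ := fun a => ((normReps 1).card : ℝ) ^ ℓ * (1 / 2) ^ a with hf
  have h1 : ∀ m ∈ (Finset.Icc 1 N).filter (fun m => omegaStar m = 0),
      ((normReps m).card : ℝ) ^ ℓ / m ≤ f (m.factorization 2) := by
    intro m hm
    obtain ⟨hm1, hm2⟩ := Finset.mem_filter.1 hm
    have h2 := eq_two_pow_of_omegaStar (by have := (Finset.mem_Icc.1 hm1).1; omega) hm2
    have h3 : ((normReps m).card : ℝ) ≤ (normReps 1).card := by
      rw [h2]; exact_mod_cast card_normReps_two_pow_le _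
    have h4 : ((1 : ℝ) / 2) ^ (m.factorization 2) = 1 / m := by
      conv_rhs => rw [h2]
      push_cast
      rw [one_div_pow]
    rw [hf]; simp only
    rw [h4, mul_one_div]
    exact div_le_div_of_nonneg_right (pow_le_pow_left₀ (Nat.cast_nonneg _) h3 ℓ) (Nat.cast_nonneg _)
  refine (Finset.sum_le_sum h1).trans ?_
  rw [← Finset.sum_image (f := f) (g := fun m : ℕ => m.factorization 2)]
  · have hs : HasSum f (((normReps 1).card : ℝ) ^ ℓ * 2) := hasSum_geometric_two.mul_left _
    refine (sum_le_hasSum _ (fun a _ => by positivity) hs).trans_eq (mul_comm _ _)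
  · intro m hm n hn hmn
    obtain ⟨hm1, hm2⟩ := Finset.mem_filter.1 hm
    obtain ⟨hn1, hn2⟩ := Finset.mem_filter.1 hn
    have hmn' : m.factorization 2 = n.factorization 2 := hmn
    rw [eq_two_pow_of_omegaStar (by have := (Finset.mem_Icc.1 hm1).1; omega) hm2,
      eq_two_pow_of_omegaStar (by have := (Finset.mem_Icc.1 hn1).1; omega) hn2, hmn']

/-- Double counting of pairs `(m, p)` with `p` an odd prime factor of `m`. Each `m` occurs `j + 1`
times, and splitting off the full power of `p` is injective into triples `(m', p, a)`. -/
theorem succ_mul_momentSum_le (ℓ j N : ℕ) :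
    (j + 1) * momentSum ℓ (j + 1) N ≤ momentSum ℓ j N * primePowerSum ℓ N := by
  let h : ℕ → ℝ := fun m => ((normReps m).card : ℝ) ^ ℓ / m
  let F : ℕ × ℕ × ℕ → ℝ := fun y => h y.1 * (localFactor y.2.1 y.2.2 ^ ℓ / (y.2.1 : ℝ) ^ y.2.2)
  have hF : ∀ y, 0 ≤ F y := fun y =>
    mul_nonneg (by positivity) (div_nonneg (pow_nonneg (localFactor_nonneg _ _) _) (by positivity))
  let A : Finset (Σ _ : ℕ, ℕ) := ((Finset.Icc 1 N).filter (fun m => omegaStar m = j + 1)).sigma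
    fun m => m.primeFactors.filter fun p => Odd p
  let Bs : Finset (ℕ × ℕ × ℕ) := ((Finset.Icc 1 N).filter (fun m => omegaStar m = j)) ×ˢ
    ((Nat.primesLE N).filter (fun p => Odd p)) ×ˢ Finset.Icc 1 N
  let φ : (Σ _ : ℕ, ℕ) → ℕ × ℕ × ℕ := fun x => (ordCompl[x.2] x.1, x.2, x.1.factorization x.2)
  have hL : (j + 1) * momentSum ℓ (j + 1) N = ∑ x ∈ A, h x.1 := by
    rw [Finset.sum_sigma, momentSum, Finset.mul_sum]
    refine Finset.sum_congr rfl fun m hm => ?_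
    have : (m.primeFactors.filter fun p => Odd p).card = j + 1 := (Finset.mem_filter.1 hm).2
    exact ((Finset.sum_const (h m)).trans (by rw [this, nsmul_eq_mul]; push_cast; rfl)).symm
  have hR : momentSum ℓ j N * primePowerSum ℓ N = ∑ y ∈ Bs, F y := by
    simp only [Bs, F, Finset.sum_product, momentSum, primePowerSum]
    rw [Finset.sum_mul]
    refine Finset.sum_congr rfl fun m _ => ?_
    rw [Finset.mul_sum]
    refine Finset.sum_congr rfl fun p _ => ?_
    rw [Finset.mul_sum]
  have hA : ∀ x ∈ A, x.1 ≠ 0 ∧ x.1 ≤ N ∧ omegaStar x.1 = j + 1 ∧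
      x.2 ∈ x.1.primeFactors.filter fun p => Odd p := by
    intro x hx
    obtain ⟨h1, h2⟩ := Finset.mem_sigma.1 hx
    obtain ⟨h3, h4⟩ := Finset.mem_filter.1 h1
    obtain ⟨h5, h6⟩ := Finset.mem_Icc.1 h3
    exact ⟨by omega, h6, h4, h2⟩
  have hle : ∀ x ∈ A, h x.1 ≤ F (φ x) := by
    intro x hx
    obtain ⟨hx0, hxN, hxo, hxp⟩ := hA x hx
    obtain ⟨h1, h2, h3, h4, h5⟩ := split_prime hx0 hxp
    have hpp := Nat.prime_of_mem_primeFactors (Finset.mem_filter.1 hxp).1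
    have h7 := card_normReps_le_localFactor hpp (Finset.mem_filter.1 hxp).2 h3
      (x.1.factorization x.2)
    rw [← h1] at h7
    have h8 : (x.1 : ℝ) = (ordCompl[x.2] x.1 : ℕ) * (x.2 : ℝ) ^ x.1.factorization x.2 := by
      exact_mod_cast h1
    simp only [F, φ, h]
    rw [div_mul_div_comm, ← mul_pow, ← h8, mul_comm ((normReps _).card : ℝ)]
    exact div_le_div_of_nonneg_right (pow_le_pow_left₀ (Nat.cast_nonneg _) h7 ℓ) (Nat.cast_nonneg _)
  have hinj : Set.InjOn φ A := by
    intro x hx y hy hxy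
    obtain ⟨hx0, -, -, hxp⟩ := hA x hx
    obtain ⟨hy0, -, -, hyp⟩ := hA y hy
    have h1 := (split_prime hx0 hxp).1
    have h2 := (split_prime hy0 hyp).1
    obtain ⟨x1, x2⟩ := x
    obtain ⟨y1, y2⟩ := y
    have h3 : ordCompl[x2] x1 = ordCompl[y2] y1 := congrArg Prod.fst hxy
    have h4 : x2 = y2 := congrArg (fun t => t.2.1) hxy
    have h5 : x1.factorization x2 = y1.factorization y2 := congrArg (fun t => t.2.2) hxy
    dsimp only at h1 h2
    subst h4
    rw [h3, h5, ← h2] at h1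
    rw [h1]
  have hmaps : A.image φ ⊆ Bs := by
    intro y hy
    obtain ⟨x, hx, rfl⟩ := Finset.mem_image.1 hy
    obtain ⟨hx0, hxN, hxo, hxp⟩ := hA x hx
    obtain ⟨h1, h2, h3, h4, h5⟩ := split_prime hx0 hxp
    have hpp := Nat.prime_of_mem_primeFactors (Finset.mem_filter.1 hxp).1
    simp only [Bs, φ, Finset.mem_product, Finset.mem_filter, Finset.mem_Icc, Nat.mem_primesLE]
    refine ⟨⟨⟨Nat.one_le_iff_ne_zero.2 h4, (Nat.ordCompl_le _ _).trans hxN⟩, by omega⟩,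
      ⟨⟨(Nat.le_of_mem_primeFactors (Finset.mem_filter.1 hxp).1).trans hxN, hpp⟩,
        (Finset.mem_filter.1 hxp).2⟩, by omega, ?_⟩
    calc x.1.factorization x.2 ≤ x.2 ^ x.1.factorization x.2 := (Nat.lt_pow_self hpp.one_lt).le
      _ ≤ x.1 := Nat.le_of_dvd (Nat.pos_of_ne_zero hx0) (Dvd.intro_left _ h1.symm)
      _ ≤ N := hxN
  rw [hL, hR]
  calc ∑ x ∈ A, h x.1 ≤ ∑ x ∈ A, F (φ x) := Finset.sum_le_sum hle
    _ = ∑ y ∈ A.image φ, F y := (Finset.sum_image hinj).symm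
    _ ≤ _ := Finset.sum_le_sum_of_subset_of_nonneg hmaps fun y _ _ => hF y

theorem primePowerSum_nonneg (ℓ N : ℕ) : 0 ≤ primePowerSum ℓ N :=
  Finset.sum_nonneg fun p _ => Finset.sum_nonneg fun a _ =>
    div_nonneg (pow_nonneg (localFactor_nonneg _ _) _) (by positivity)

theorem momentSum_le (ℓ j N : ℕ) :
    momentSum ℓ j N ≤ 2 * ((normReps 1).card : ℝ) ^ ℓ * (primePowerSum ℓ N ^ j / j.factorial) := by
  induction j with
  | zero => simpa using momentSum_zero_le ℓ N
  | succ j ih =>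
    have h1 := succ_mul_momentSum_le ℓ j N
    have h2 := mul_le_mul_of_nonneg_right ih (primePowerSum_nonneg ℓ N)
    have h3 : (0 : ℝ) < j + 1 := by positivity
    refine le_of_mul_le_mul_left (h1.trans (h2.trans_eq ?_)) h3
    rw [Nat.factorial_succ]
    push_cast
    field_simp
    ring

/-- Since `1 + χ(p)` is `0` or `2` for odd `p`, its `ℓ`-th power is `2^(ℓ-1) (1 + χ(p))`, and
Mertens for primes `1` modulo `4` handles exponent `1`. -/
theorem exists_primePowerSum_le (ℓ : ℕ) (hℓ : 1 ≤ ℓ) : ∃ C : ℝ, 0 ≤ C ∧ ∀ᶠ x : ℝ in atTop,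
    primePowerSum ℓ ⌊x⌋₊ ≤ 2 ^ (ℓ - 1) * Real.log (Real.log x) + C := by
  obtain ⟨C₁, hC₁0, hC₁⟩ := exists_sum_one_add_chi_le
  have hs2 : Summable fun n : ℕ => 1 / (n : ℝ) ^ 2 := Real.summable_one_div_nat_pow.2 one_lt_two
  have hsg : Summable fun a : ℕ => ((a : ℝ) + 1) ^ ℓ * (1 / 2) ^ a := by
    have h1 := (summable_nat_add_iff 1).2 (summable_pow_mul_geometric_of_norm_lt_one (R := ℝ) ℓ
      (r := 1 / 2) (by norm_num))
    refine (h1.mul_left 2).congr fun a => ?_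
    push_cast
    ring
  set S₂ := ∑' n : ℕ, 1 / (n : ℝ) ^ 2 with hS₂
  set G := ∑' a : ℕ, ((a : ℝ) + 1) ^ ℓ * (1 / 2) ^ a with hG
  have hS₂0 : 0 ≤ S₂ := tsum_nonneg fun n => by positivity
  have hG0 : 0 ≤ G := tsum_nonneg fun n => by positivity
  refine ⟨2 ^ (ℓ - 1) * C₁ + 4 * G * S₂, by positivity, ?_⟩
  filter_upwards [hC₁] with x hx
  set N := ⌊x⌋₊ with hN
  have hinner : ∀ p ∈ (Nat.primesLE N).filter (fun p => Odd p),
      ∑ a ∈ Finset.Icc 1 N, localFactor p a ^ ℓ / (p : ℝ) ^ a ≤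
        2 ^ (ℓ - 1) * ((1 + chi p) / p) + 4 * G * (1 / (p : ℝ) ^ 2) := by
    intro p hp
    obtain ⟨hp1, hodd⟩ := Finset.mem_filter.1 hp
    have hpp := (Nat.mem_primesLE.1 hp1).2
    have hp2 : (2 : ℝ) ≤ p := by exact_mod_cast hpp.two_le
    have hchi : (1 + chi p) ^ ℓ = 2 ^ (ℓ - 1) * (1 + chi p) := by
      obtain ⟨t, ht⟩ := hodd
      obtain ⟨n, rfl⟩ : ∃ n, ℓ = n + 1 := ⟨ℓ - 1, by omega⟩
      have hmod : p % 4 = 1 ∨ p % 4 = 3 := by omega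
      rcases hmod with h4 | h4
      · have hchi : chi p = 1 := by rw [chi, ZMod.χ₄_nat_one_mod_four h4]; simp
        rw [hchi, Nat.add_sub_cancel, pow_succ]; norm_num
      · have hchi : chi p = -1 := by rw [chi, ZMod.χ₄_nat_three_mod_four h4]; simp
        rw [hchi]; simp
    -- For `a ≥ 2` one has `p^a ≥ p^2 2^(a-2)`, the source of the factor `4`.
    have hterm : ∀ a ∈ Finset.Icc 1 N, localFactor p a ^ ℓ / (p : ℝ) ^ a ≤
        (if a = 1 then 2 ^ (ℓ - 1) * ((1 + chi p) / p) else 0) +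
          4 * (1 / (p : ℝ) ^ 2) * (((a : ℝ) + 1) ^ ℓ * (1 / 2) ^ a) := by
      intro a ha
      have ha1 := (Finset.mem_Icc.1 ha).1
      by_cases h : a = 1
      · rw [if_pos h, localFactor, if_pos h, h, hchi, pow_one, mul_div_assoc]
        have : 0 ≤ 4 * (1 / (p : ℝ) ^ 2) * ((((1 : ℕ) : ℝ) + 1) ^ ℓ * (1 / 2) ^ 1) := by positivity
        linarith
      · rw [if_neg h, localFactor, if_neg h, zero_add]
        obtain ⟨e, rfl⟩ : ∃ e, a = e + 2 := ⟨a - 2, by omega⟩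
        have h1 : (2 : ℝ) ^ e ≤ (p : ℝ) ^ e := by gcongr
        have hp0 : (0 : ℝ) < p := by linarith
        have h2 : 4 * (1 / (p : ℝ) ^ 2) * ((((e + 2 : ℕ) : ℝ) + 1) ^ ℓ * (1 / 2) ^ (e + 2)) =
            (((e + 2 : ℕ) : ℝ) + 1) ^ ℓ / ((p : ℝ) ^ 2 * 2 ^ e) := by
          rw [pow_add, one_div_pow, one_div_pow]; field_simp; norm_num
        rw [h2, pow_add, mul_comm ((p : ℝ) ^ e)]
        gcongr
    refine (Finset.sum_le_sum hterm).trans ?_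
    rw [Finset.sum_add_distrib, ← Finset.mul_sum]
    refine add_le_add ?_ ?_
    · rw [Finset.sum_ite_eq']
      split_ifs
      · exact le_rfl
      · have := (abs_le.1 (abs_chi_le p)).1
        have : 0 ≤ 1 + chi p := by linarith
        positivity
    · have := hsg.sum_le_tsum (Finset.Icc 1 N) fun a _ => by positivity
      calc _ ≤ 4 * (1 / (p : ℝ) ^ 2) * G := by gcongr
        _ = _ := by ring
  unfold primePowerSum
  refine (Finset.sum_le_sum hinner).trans ?_
  rw [Finset.sum_add_distrib, ← Finset.mul_sum, ← Finset.mul_sum]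
  have h1 : ∑ p ∈ (Nat.primesLE N).filter (fun p => Odd p), (1 + chi p) / (p : ℝ) ≤
      Real.log (Real.log x) + C₁ := by
    refine (Finset.sum_le_sum_of_subset_of_nonneg (Finset.filter_subset _ _)
      fun p _ _ => ?_).trans hx
    have := (abs_le.1 (abs_chi_le p)).1
    exact div_nonneg (by linarith) (Nat.cast_nonneg _)
  have h2 : ∑ p ∈ (Nat.primesLE N).filter (fun p => Odd p), 1 / (p : ℝ) ^ 2 ≤ S₂ :=
    hs2.sum_le_tsum _ fun _ _ => by positivity
  calc _ ≤ 2 ^ (ℓ - 1) * (Real.log (Real.log x) + C₁) + 4 * G * S₂ := by gcongr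
    _ = _ := by ring

end SquarePlusPrimeSquare

/-! ### Unfolding sets of representations through a large prime factor. -/

namespace SquarePlusPrimeSquare

theorem card_primeFactors_le (n : ℕ) : n.primeFactors.card ≤ omegaStar n + 1 := by
  unfold omegaStar
  rw [← Finset.card_filter_add_card_filter_not (s := n.primeFactors) (fun p => Odd p)]
  refine Nat.add_le_add_left ?_ _
  refine (Finset.card_le_card (t := {2}) fun p hp => ?_).trans_eq (Finset.card_singleton 2)
  obtain ⟨h1, h2⟩ := Finset.mem_filter.1 hp
  rw [Finset.mem_singleton]
  exact (Nat.prime_of_mem_primeFactors h1).eq_two_or_odd'.resolve_right h2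

/-- A number with few prime factors and no large square divisor has a large simple prime factor. -/
theorem exists_large_prime {n : ℕ} (hn : n ≠ 0) {w : ℝ} (hw : 1 ≤ w)
    (hlarge : (w ^ 3) ^ (omegaStar n + 1) < n) (hsq : ∀ d : ℕ, w ≤ d → ¬ d ^ 2 ∣ n) :
    ∃ q : ℕ, q.Prime ∧ w ≤ q ∧ q ∣ n ∧ ¬ q ^ 2 ∣ n := by
  -- The prime `2` may add one factor to the odd ones, hence `omegaStar n + 1`; by pigeonhole some
  -- prime power component is at least `w^3`.
  obtain ⟨p, hp, hpw⟩ : ∃ p ∈ n.primeFactors, w ^ 3 ≤ ((p ^ n.factorization p : ℕ) : ℝ) := by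
    by_contra! hcon
    have h1 : (n : ℝ) ≤ (w ^ 3) ^ (omegaStar n + 1) := by
      have h2 : (n : ℝ) = ∏ p ∈ n.primeFactors, ((p ^ n.factorization p : ℕ) : ℝ) := by
        rw [← Nat.cast_prod]
        exact_mod_cast (Nat.prod_factorization_pow_eq_self hn).symm
      rw [h2]
      calc _ ≤ ∏ p ∈ n.primeFactors, w ^ 3 :=
            Finset.prod_le_prod (fun p _ => Nat.cast_nonneg _) fun p hp => (hcon p hp).le
        _ = (w ^ 3) ^ n.primeFactors.card := Finset.prod_const _
        _ ≤ _ := pow_le_pow_right₀ (one_le_pow₀ hw) (card_primeFactors_le n)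
    linarith
  have hpp := Nat.prime_of_mem_primeFactors hp
  have hpn := Nat.dvd_of_mem_primeFactors hp
  set a := n.factorization p with ha
  have ha0 : a ≠ 0 := (hpp.factorization_pos_of_dvd hn hpn).ne'
  by_cases ha1 : a = 1
  · refine ⟨p, hpp, ?_, hpn, fun h => ?_⟩
    · rw [ha1, pow_one] at hpw
      exact (le_self_pow₀ hw (by norm_num)).trans hpw
    · have := (hpp.pow_dvd_iff_le_factorization hn).1 h
      omega
  -- For `a ≥ 2` one has `⌊a/2⌋ ≥ a/3`, so `p^⌊a/2⌋ ≥ w` while its square divides `n`.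
  · refine absurd ?_ (hsq (p ^ (a / 2)) ?_)
    · rw [← pow_mul]
      exact (pow_dvd_pow p (by omega)).trans (Nat.ordProj_dvd n p)
    · refine le_of_pow_le_pow_left₀ three_ne_zero (Nat.cast_nonneg _) (hpw.trans ?_)
      rw [← Nat.cast_pow, ← pow_mul]
      exact_mod_cast Nat.pow_le_pow_right hpp.pos (by omega)

/-- If the determinant vanishes, Lagrange's identity makes the inner product `±m`, so the two points
are equal or opposite and `p = ±p'`. This excludes degenerate families. -/
theorem det_ne_zero {m : ℕ} {c b c' b' u v p p' : ℤ} (h : c ^ 2 + b ^ 2 = m)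
    (h' : c' ^ 2 + b' ^ 2 = m) (hp : c * u + b * v = p) (hp' : c' * u + b' * v = p')
    (hpos : 0 < p) (hpos' : 0 < p') (hne : p ≠ p') : c * b' - c' * b ≠ 0 := by
  intro hdet
  have h1 : (c * c' + b * b' - m) * (c * c' + b * b' + m) = 0 := by
    linear_combination (c' ^ 2 + b' ^ 2) * h + m * h' - (c * b' - c' * b) * hdet
  rcases mul_eq_zero.1 h1 with h2 | h2
  · have h3 : (c - c') ^ 2 + (b - b') ^ 2 = 0 := by linear_combination h + h' - 2 * h2
    have h4 : c = c' := by nlinarith [sq_nonneg (c - c'), sq_nonneg (b - b')]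
    have h5 : b = b' := by nlinarith [sq_nonneg (c - c'), sq_nonneg (b - b')]
    exact hne (by rw [← hp, ← hp', h4, h5])
  · have h3 : (c + c') ^ 2 + (b + b') ^ 2 = 0 := by linear_combination h + h' + 2 * h2
    have h4 : c = -c' := by nlinarith [sq_nonneg (c + c'), sq_nonneg (b + b')]
    have h5 : b = -b' := by nlinarith [sq_nonneg (c + c'), sq_nonneg (b + b')]
    have h6 : p = -p' := by rw [← hp, ← hp', h4, h5]; ring
    linarith

theorem reps_ext {n : ℕ} {y y' : ℕ × ℕ} (hy : y ∈ reps n) (hy' : y' ∈ reps n) (h : y.2 = y'.2) :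
    y = y' := by
  obtain ⟨h1, -, h2⟩ := mem_reps.1 hy
  obtain ⟨h3, -, h4⟩ := mem_reps.1 hy'
  refine Prod.ext (Nat.pow_left_injective two_ne_zero ?_) h
  rw [h] at h2
  simp only
  omega

theorem r₁_le_card_normReps (n : ℕ) : r₁ n ≤ (normReps n).card := by
  refine Finset.card_le_card_of_injOn (fun y => ((y.1 : ℤ), (y.2 : ℤ))) ?_ ?_
  · intro y hy
    refine Finset.mem_coe.2 (mem_normReps.2 ?_)
    dsimp only
    exact_mod_cast (mem_reps.1 (Finset.mem_coe.1 hy)).2.2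
  · intro y _ y' _ h
    simpa [Prod.ext_iff] using h

/-- The families of `ℓ` points of norm `m` no two of which are proportional. -/
noncomputable def frames (ℓ m : ℕ) : Finset (Fin ℓ → ℤ × ℤ) :=
  (Fintype.piFinset fun _ => normReps m).filter fun f =>
    ∀ i j, i ≠ j → (f i).1 * (f j).2 - (f j).1 * (f i).2 ≠ 0

theorem card_frames_le (ℓ m : ℕ) : (frames ℓ m).card ≤ (normReps m).card ^ ℓ := by
  refine (Finset.card_filter_le _ _).trans_eq ?_
  simp

/-- The parameters over which the main sum is unfolded. -/
noncomputable def unfolded (ℓ k : ℕ) (x w : ℝ) : Finset (Σ _ : ℕ, Σ _ : Fin ℓ → ℤ × ℤ, ℤ × ℤ) :=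
  ((Finset.Icc 1 ⌊x⌋₊).filter fun m : ℕ => omegaStar m + 1 = k ∧ m * w ≤ x).sigma fun m =>
    (frames ℓ m).sigma fun f => sifted (fun i => (f i).1) (fun i => (f i).2) m x

theorem mem_sifted {ℓ : ℕ} {c b : Fin ℓ → ℤ} {m : ℕ} {x : ℝ} {y : ℤ × ℤ} :
    y ∈ sifted c b m x ↔ y ∈ box ⌊√(x / m)⌋₊ ∧ ∀ p : ℕ, p.Prime → (p : ℝ) ≤ sieveLevel x →
      ¬ (p : ℤ) ∣ form c b y.1 y.2 := by
  classical
  simp only [sifted, Finset.mem_filter]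

/-- Every family of representations of a non-exceptional integer comes from the unfolded
parameters. -/
theorem exists_unfolded {ℓ n k : ℕ} {x w : ℝ} (hℓ : 1 ≤ ℓ) (hn0 : n ≠ 0) (hnx : (n : ℝ) ≤ x)
    (hk : omegaStar n = k) (hw : 2 < w) (hzw : sieveLevel x < w)
    (hlarge : (w ^ 3) ^ (k + 1) < n) (hsq : ∀ d : ℕ, w ≤ d → ¬ d ^ 2 ∣ n)
    (hrep : ∀ y ∈ reps n, sieveLevel x < (y.2 : ℝ)) {S : Finset (ℕ × ℕ)}
    (hS : S ∈ (reps n).powersetCard ℓ) :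
    ∃ t ∈ unfolded ℓ k x w, (t.1 : ℤ) * (t.2.2.1 ^ 2 + t.2.2.2 ^ 2) = n ∧
      (Finset.univ.image fun i => (t.2.1 i).1 * t.2.2.1 + (t.2.1 i).2 * t.2.2.2) =
        S.image fun y => (y.2 : ℤ) := by
  obtain ⟨hSn, hSℓ⟩ := Finset.mem_powersetCard.1 hS
  obtain ⟨q, hq, hqw, ⟨m, hm⟩, hq2⟩ := exists_large_prime hn0 (by linarith) (by rwa [hk]) hsq
  have hx0 : 0 < x := lt_of_lt_of_le (by exact_mod_cast Nat.pos_of_ne_zero hn0) hnx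
  have hqodd : Odd q := hq.eq_two_or_odd'.resolve_left (by rintro rfl; norm_num at hqw; linarith)
  have hm0 : m ≠ 0 := by rintro rfl; exact hn0 (by rw [hm, mul_zero])
  have hm1 : (0 : ℝ) < m := by exact_mod_cast Nat.pos_of_ne_zero hm0
  have hqm : ¬ q ∣ m := fun ⟨e, he⟩ => hq2 ⟨e, by rw [hm, he]; ring⟩
  have homega : omegaStar m + 1 = k := by
    rw [← hk, hm, mul_comm, ← omegaStar_mul_pow hq hqodd hm0 hqm one_ne_zero, pow_one]
  have hnq : (n : ℝ) = q * m := by exact_mod_cast hm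
  have hmw : (m : ℝ) * w ≤ x := by
    calc (m : ℝ) * w ≤ m * q := by gcongr
      _ = n := by rw [hnq, mul_comm]
      _ ≤ x := hnx
  obtain ⟨y₀, hy₀⟩ := Finset.card_pos.1 (show 0 < S.card by omega)
  -- A prime `3` modulo `4` dividing a sum of two squares divides it twice, but `q` is simple.
  have hq4 : q % 4 ≠ 3 := by
    intro h3
    have h4 := (mem_reps.1 (hSn hy₀)).2.2
    have h4' : (y₀.1 : ℤ) ^ 2 + (y₀.2 : ℤ) ^ 2 = n := by exact_mod_cast h4
    obtain ⟨⟨s, hs⟩, ⟨t, ht⟩⟩ := dvd_of_dvd_sq_add_sq hq h3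
      (show (q : ℤ) ∣ (y₀.1 : ℤ) ^ 2 + (y₀.2 : ℤ) ^ 2 by
        rw [h4', hm]; push_cast; exact Dvd.intro _ rfl)
    refine hq2 (Int.natCast_dvd_natCast.1 ⟨s ^ 2 + t ^ 2, ?_⟩)
    rw [← h4', hs, ht]
    push_cast
    ring
  have hfact : Fact q.Prime := ⟨hq⟩
  obtain ⟨u, v, huv⟩ := Nat.Prime.sq_add_sq hq4
  have huv' : (u : ℤ) ^ 2 + (v : ℤ) ^ 2 = q := by exact_mod_cast huv
  -- Only the prime coordinate is kept; the sign ambiguity from the two conjugates goes into the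
  -- coefficients.
  have hform : ∀ y ∈ S, ∃ f : ℤ × ℤ, f.1 ^ 2 + f.2 ^ 2 = m ∧ f.1 * u + f.2 * v = y.2 := by
    intro y hy
    have h4 : (y.1 : ℤ) ^ 2 + (y.2 : ℤ) ^ 2 = m * q := by
      have := (mem_reps.1 (hSn hy)).2.2
      rw [hm, mul_comm] at this
      exact_mod_cast this
    obtain ⟨s, t, h1, -, h2 | h2⟩ := exists_of_sq_add_sq_eq_mul hq huv' h4
    · exact ⟨(-t, s), by rw [← h1]; ring, by rw [h2]; ring⟩
    · exact ⟨(t, -s), by rw [← h1]; ring, by rw [h2]; ring⟩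
  let e : Fin ℓ ≃ S := (S.equivFinOfCardEq hSℓ).symm
  choose g hg1 hg2 using fun i : Fin ℓ => hform (e i) (e i).2
  have hpos : ∀ i, (0 : ℤ) < ((e i : ℕ × ℕ).2 : ℤ) := fun i => by
    exact_mod_cast (mem_reps.1 (hSn (e i).2)).2.1.pos
  refine ⟨⟨m, g, ((u : ℤ), (v : ℤ))⟩, ?_, ?_, ?_⟩
  · refine Finset.mem_sigma.2 ⟨Finset.mem_filter.2 ⟨Finset.mem_Icc.2 ⟨Nat.one_le_iff_ne_zero.2 hm0, ?_⟩, homega, hmw⟩,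
      Finset.mem_sigma.2 ⟨Finset.mem_filter.2 ⟨?_, ?_⟩, ?_⟩⟩
    · refine Nat.le_floor (le_trans ?_ hmw)
      exact le_mul_of_one_le_right hm1.le (by linarith)
    · exact Fintype.mem_piFinset.2 fun i => mem_normReps.2 (hg1 i)
    · intro i j hij
      refine det_ne_zero (hg1 i) (hg1 j) (hg2 i) (hg2 j) (hpos i) (hpos j) fun h => hij ?_
      refine e.injective (Subtype.ext (reps_ext (hSn (e i).2) (hSn (e j).2) ?_))
      exact_mod_cast h
    · refine mem_sifted.2 ?_
      have hsqrt : ∀ s t : ℕ, s ^ 2 + t ^ 2 = q → (s : ℤ) ∈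
          Finset.Icc (-(⌊√(x / m)⌋₊ : ℤ)) ⌊√(x / m)⌋₊ := by
        intro s t hst
        have h1 : s ≤ ⌊√(x / m)⌋₊ := by
          refine Nat.le_floor (Real.le_sqrt_of_sq_le ?_)
          rw [le_div_iff₀ hm1]
          refine le_trans ?_ hnx
          rw [hnq]
          gcongr
          exact_mod_cast (Nat.le_add_right (s ^ 2) (t ^ 2)).trans_eq hst
        exact Finset.mem_Icc.2 ⟨by omega, by exact_mod_cast h1⟩
      refine ⟨Finset.mem_product.2 ⟨hsqrt u v huv, hsqrt v u (by rw [← huv, add_comm])⟩, ?_⟩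
      -- The values of the forms are `q ≥ w > z` and primes greater than `z`, so no prime up to `z`
      -- can divide them.
      intro p hp hpz hdvd
      have hp' : Prime (p : ℤ) := Nat.prime_iff_prime_int.1 hp
      simp only [form, Int.cast_id] at hdvd
      rcases hp'.dvd_or_dvd hdvd with h1 | h1
      · rw [huv', Int.natCast_dvd_natCast, Nat.prime_dvd_prime_iff_eq hp hq] at h1
        rw [h1] at hpz
        linarith
      · obtain ⟨i, -, hi⟩ := (Prime.dvd_finsetProd_iff hp' _).1 h1
        have hi' := (hg2 i) ▸ hi
        rw [Int.natCast_dvd_natCast,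
          Nat.prime_dvd_prime_iff_eq hp (mem_reps.1 (hSn (e i).2)).2.1] at hi'
        have := hrep _ (hSn (e i).2)
        rw [← hi'] at this
        linarith
  · simp only
    rw [huv', hm]
    push_cast
    ring
  · ext a
    simp only [Finset.mem_image, Finset.mem_univ, true_and, hg2]
    constructor
    · rintro ⟨i, rfl⟩
      exact ⟨e i, (e i).2, rfl⟩
    · rintro ⟨y, hy, rfl⟩
      exact ⟨e.symm ⟨y, hy⟩, by simp⟩

/-- The unfolding of the sum over non-exceptional integers. -/
theorem sum_choose_le_card_unfolded {ℓ k : ℕ} {x w : ℝ} (hℓ : 1 ≤ ℓ) (hw : 2 < w)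
    (hzw : sieveLevel x < w) (G : Finset ℕ)
    (hG : ∀ n ∈ G, n ≠ 0 ∧ (n : ℝ) ≤ x ∧ omegaStar n = k ∧ (w ^ 3) ^ (k + 1) < n ∧
      (∀ d : ℕ, w ≤ d → ¬ d ^ 2 ∣ n) ∧ ∀ y ∈ reps n, sieveLevel x < (y.2 : ℝ)) :
    ∑ n ∈ G, (r₁ n).choose ℓ ≤ (unfolded ℓ k x w).card := by
  classical
  let A : Finset (Σ _ : ℕ, Finset (ℕ × ℕ)) := G.sigma fun n => (reps n).powersetCard ℓ
  -- Given `n`, a representation is determined by its prime. A set of representations is therefore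
  -- recovered from `n` and its set of primes, and both can be read off the unfolded parameters.
  let Θ : (Σ _ : ℕ, Finset (ℕ × ℕ)) → ℤ × Finset ℤ := fun s =>
    ((s.1 : ℤ), s.2.image fun y => (y.2 : ℤ))
  let Ψ : (Σ _ : ℕ, Σ _ : Fin ℓ → ℤ × ℤ, ℤ × ℤ) → ℤ × Finset ℤ := fun t =>
    ((t.1 : ℤ) * (t.2.2.1 ^ 2 + t.2.2.2 ^ 2),
      Finset.univ.image fun i => (t.2.1 i).1 * t.2.2.1 + (t.2.1 i).2 * t.2.2.2)
  have hcard : ∑ n ∈ G, (r₁ n).choose ℓ = A.card := by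
    rw [Finset.card_sigma]
    exact Finset.sum_congr rfl fun n _ => (Finset.card_powersetCard _ _).symm
  have hinj : Set.InjOn Θ A := by
    rintro ⟨n, S⟩ hs ⟨n', S'⟩ hs' h
    have h1 : (n : ℤ) = n' := congrArg Prod.fst h
    have h2 : (S.image fun y => (y.2 : ℤ)) = S'.image fun y => (y.2 : ℤ) := congrArg Prod.snd h
    have h1' : n = n' := by exact_mod_cast h1
    subst h1'
    have hSn := (Finset.mem_powersetCard.1 (Finset.mem_sigma.1 hs).2).1
    have hSn' := (Finset.mem_powersetCard.1 (Finset.mem_sigma.1 hs').2).1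
    have key : ∀ T T' : Finset (ℕ × ℕ), T ⊆ reps n → T' ⊆ reps n →
        (T.image fun y => (y.2 : ℤ)) = (T'.image fun y => (y.2 : ℤ)) → T ⊆ T' := by
      intro T T' hT hT' h y hy
      have h3 : (y.2 : ℤ) ∈ T'.image fun y => (y.2 : ℤ) := h ▸ Finset.mem_image_of_mem _ hy
      obtain ⟨y', hy', h4⟩ := Finset.mem_image.1 h3
      rw [← reps_ext (hT' hy') (hT hy) (by exact_mod_cast h4)]
      exact hy'
    rw [Finset.Subset.antisymm (key S S' hSn hSn' h2) (key S' S hSn' hSn h2.symm)]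
  have hsub : A.image Θ ⊆ (unfolded ℓ k x w).image Ψ := by
    intro y hy
    obtain ⟨⟨n, S⟩, hs, rfl⟩ := Finset.mem_image.1 hy
    obtain ⟨hn, hS⟩ := Finset.mem_sigma.1 hs
    obtain ⟨h1, h2, h3, h4, h5, h6⟩ := hG n hn
    obtain ⟨t, ht, h7, h8⟩ := exists_unfolded hℓ h1 h2 h3 hw hzw h4 h5 h6 hS
    exact Finset.mem_image.2 ⟨t, ht, Prod.ext h7 h8⟩
  rw [hcard, ← Finset.card_image_of_injOn hinj]
  exact (Finset.card_le_card hsub).trans Finset.card_image_le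

end SquarePlusPrimeSquare

/-! ### Exceptional integers, and the two contributions. -/

namespace SquarePlusPrimeSquare

open Filter Topology

/-- The exceptional integers up to `x`: the small ones, those with a large square divisor, and
those with a representation by a small prime. -/
def IsExceptional (x w : ℝ) (n : ℕ) : Prop :=
  n * w ≤ x ∨ (∃ d : ℕ, w ≤ d ∧ d ^ 2 ∣ n) ∨ ∃ y ∈ reps n, (y.2 : ℝ) ≤ sieveLevel x

open Classical in
theorem card_small_le {x w : ℝ} (hw : 0 < w) (hx : 0 ≤ x) :
    (((Finset.Icc 1 ⌊x⌋₊).filter fun n : ℕ => n * w ≤ x).card : ℝ) ≤ x / w := by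
  have h : ((Finset.Icc 1 ⌊x⌋₊).filter fun n : ℕ => n * w ≤ x) ⊆ Finset.Icc 1 ⌊x / w⌋₊ := by
    intro n hn
    obtain ⟨h1, h2⟩ := Finset.mem_filter.1 hn
    exact Finset.mem_Icc.2 ⟨(Finset.mem_Icc.1 h1).1, Nat.le_floor ((le_div_iff₀ hw).2 h2)⟩
  have h1 := Finset.card_le_card h
  rw [Nat.card_Icc, Nat.add_sub_cancel] at h1
  exact (Nat.cast_le.2 h1).trans (Nat.floor_le (by positivity))

open Classical in
theorem card_square_dvd_le {x w : ℝ} (hw : 1 < w) (hx : 0 ≤ x) :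
    (((Finset.Icc 1 ⌊x⌋₊).filter fun n : ℕ => ∃ d : ℕ, w ≤ d ∧ d ^ 2 ∣ n).card : ℝ) ≤
      2 * (x / w) := by
  set N := ⌊x⌋₊ with hN
  -- For integers `d`, the condition `d ≥ w` becomes `d > K`, while `K + 1 ≥ w` keeps the tail of
  -- `1/d^2` below `2/w`.
  set K := ⌈w⌉₊ - 1 with hK
  have hceil : 1 ≤ ⌈w⌉₊ := Nat.one_le_ceil_iff.2 (by linarith)
  have hKw : w ≤ (K : ℝ) + 1 := by
    have : ((K + 1 : ℕ) : ℝ) = (⌈w⌉₊ : ℝ) := by rw [hK, Nat.sub_add_cancel hceil]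
    push_cast at this
    rw [this]
    exact Nat.le_ceil w
  have hsub : ((Finset.Icc 1 N).filter fun n : ℕ => ∃ d : ℕ, w ≤ d ∧ d ^ 2 ∣ n) ⊆
      (Finset.Ioo K (N + 1)).biUnion fun d => (Finset.Ioc 0 N).filter fun n => d ^ 2 ∣ n := by
    intro n hn
    obtain ⟨h1, d, hd, hdn⟩ := Finset.mem_filter.1 hn
    obtain ⟨h2, h3⟩ := Finset.mem_Icc.1 h1
    refine Finset.mem_biUnion.2 ⟨d, Finset.mem_Ioo.2 ⟨?_, ?_⟩,
      Finset.mem_filter.2 ⟨Finset.mem_Ioc.2 ⟨h2, h3⟩, hdn⟩⟩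
    · have := Nat.ceil_le.2 hd
      omega
    · have := Nat.le_of_dvd (by omega) hdn
      have := Nat.le_self_pow two_ne_zero d
      omega
  have hcard : ∀ d ∈ Finset.Ioo K (N + 1), (((Finset.Ioc 0 N).filter fun n => d ^ 2 ∣ n).card : ℝ) ≤
      x * ((d : ℝ) ^ 2)⁻¹ := by
    intro d _
    rw [Nat.Ioc_filter_dvd_card_eq_div]
    refine Nat.cast_div_le.trans ?_
    rw [div_eq_mul_inv]
    push_cast
    gcongr
    exact Nat.floor_le hx
  calc _ ≤ _ := Nat.cast_le.2 ((Finset.card_le_card hsub).trans Finset.card_biUnion_le)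
    _ ≤ x * ∑ d ∈ Finset.Ioo K (N + 1), ((d : ℝ) ^ 2)⁻¹ := by
        push_cast
        rw [Finset.mul_sum]
        exact Finset.sum_le_sum hcard
    _ ≤ x * (2 / (K + 1)) := by
        gcongr
        exact sum_Ioo_inv_sq_le K (N + 1)
    _ ≤ x * (2 / w) := by gcongr
    _ = _ := by ring

open Classical in
theorem card_small_prime_le {x : ℝ} (hx : 0 ≤ x) :
    (((Finset.Icc 1 ⌊x⌋₊).filter fun n : ℕ =>
      ∃ y ∈ reps n, (y.2 : ℝ) ≤ sieveLevel x).card : ℝ) ≤ √x * sieveLevel x := by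
  have hz0 : 0 ≤ sieveLevel x := (Real.exp_pos _).le
  have hsub : ((Finset.Icc 1 ⌊x⌋₊).filter fun n : ℕ =>
      ∃ y ∈ reps n, (y.2 : ℝ) ≤ sieveLevel x) ⊆
      (Finset.Icc 1 ⌊√x⌋₊ ×ˢ Finset.Icc 1 ⌊sieveLevel x⌋₊).image fun y => y.1 ^ 2 + y.2 ^ 2 := by
    intro n hn
    obtain ⟨h1, y, hy, hyz⟩ := Finset.mem_filter.1 hn
    obtain ⟨h2, h3, h4⟩ := mem_reps.1 hy
    refine Finset.mem_image.2 ⟨y, Finset.mem_product.2 ⟨Finset.mem_Icc.2 ⟨h2, ?_⟩,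
      Finset.mem_Icc.2 ⟨h3.one_le, Nat.le_floor hyz⟩⟩, h4⟩
    refine Nat.le_floor (Real.le_sqrt_of_sq_le ?_)
    calc (y.1 : ℝ) ^ 2 ≤ n := by exact_mod_cast (Nat.le_add_right _ _).trans_eq h4
      _ ≤ x := (Nat.le_floor_iff hx).1 (Finset.mem_Icc.1 h1).2
  have h1 := (Finset.card_le_card hsub).trans Finset.card_image_le
  rw [Finset.card_product, Nat.card_Icc, Nat.card_Icc, Nat.add_sub_cancel, Nat.add_sub_cancel] at h1
  refine ((Nat.cast_le (α := ℝ)).2 h1).trans ?_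
  push_cast
  exact mul_le_mul (Nat.floor_le (Real.sqrt_nonneg _)) (Nat.floor_le hz0)
    (Nat.cast_nonneg _) (Real.sqrt_nonneg _)

open Classical in
theorem card_exceptional_le {x w : ℝ} (hw : 1 < w) (hx : 0 ≤ x)
    (hz : √x * sieveLevel x ≤ x / w) :
    (((Finset.Icc 1 ⌊x⌋₊).filter (IsExceptional x w)).card : ℝ) ≤ 4 * (x / w) := by
  have h1 : (Finset.Icc 1 ⌊x⌋₊).filter (IsExceptional x w) =
      ((Finset.Icc 1 ⌊x⌋₊).filter fun n : ℕ => n * w ≤ x) ∪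
      (((Finset.Icc 1 ⌊x⌋₊).filter fun n : ℕ => ∃ d : ℕ, w ≤ d ∧ d ^ 2 ∣ n) ∪
        ((Finset.Icc 1 ⌊x⌋₊).filter fun n : ℕ => ∃ y ∈ reps n, (y.2 : ℝ) ≤ sieveLevel x)) := by
    rw [← Finset.filter_or, ← Finset.filter_or]
    exact Finset.filter_congr fun n _ => Iff.rfl
  rw [h1]
  have h2 := (Finset.card_union_le ((Finset.Icc 1 ⌊x⌋₊).filter fun n : ℕ => n * w ≤ x)
    (((Finset.Icc 1 ⌊x⌋₊).filter fun n : ℕ => ∃ d : ℕ, w ≤ d ∧ d ^ 2 ∣ n) ∪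
      ((Finset.Icc 1 ⌊x⌋₊).filter fun n : ℕ => ∃ y ∈ reps n, (y.2 : ℝ) ≤ sieveLevel x))).trans
    (Nat.add_le_add_left (Finset.card_union_le _ _) _)
  refine (Nat.cast_le.2 h2).trans ?_
  push_cast
  linarith [card_small_le (x := x) (w := w) (by linarith) hx, card_square_dvd_le hw hx,
    card_small_prime_le hx]

/-- The contribution of the exceptional integers. -/
theorem eventually_exceptional_le (ℓ : ℕ) (A : ℝ) (hA : 0 < A) : ∀ᶠ x : ℝ in atTop, ∀ k : ℕ,
    (k : ℝ) ≤ A * Real.log (Real.log x) →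
    4 * (x / Real.exp (Real.log x / Real.log (Real.log x) ^ 2)) *
      (((Nat.log 2 ⌊x⌋₊ + 1 : ℕ) : ℝ) ^ k * (normReps 1).card) ^ ℓ ≤
      x / Real.log x ^ (ℓ + 1) *
        ((2 ^ (ℓ - 1) * Real.log (Real.log x)) ^ k / (k.factorial : ℝ)) := by
  set R : ℝ := ((normReps 1).card : ℝ) with hR
  have hR0 : 0 ≤ R := Nat.cast_nonneg _
  have hexp := Real.tendsto_exp_atTop.comp tendsto_loglog
  filter_upwards [tendsto_loglog.eventually_ge_atTop 1, eventually_log_pos, eventually_gt_atTop 1,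
    tendsto_loglog.eventually_ge_atTop A, hexp.eventually_ge_atTop (4 * R ^ ℓ),
    Real.tendsto_log_atTop.eventually_ge_atTop 3,
    (tendsto_log_div_loglog_pow 4).eventually_ge_atTop (1 + 2 * ℓ * A + (ℓ + 1) + A)]
    with x hL1 hlog hx1 hLA hexpR hlog3 hbig k hk
  set L := Real.log (Real.log x) with hL
  simp only [Function.comp] at hexpR
  have hL0 : 0 < L := by linarith
  have hlogx : Real.log x = Real.exp L := (Real.exp_log hlog).symm
  have hN1 : 1 ≤ ⌊x⌋₊ := Nat.le_floor (by simpa using hx1.le)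
  have hbase : ((Nat.log 2 ⌊x⌋₊ + 1 : ℕ) : ℝ) ≤ Real.exp (2 * L) := by
    have h1 : (2 : ℝ) ^ Nat.log 2 ⌊x⌋₊ ≤ x := by
      calc (2 : ℝ) ^ Nat.log 2 ⌊x⌋₊ ≤ ⌊x⌋₊ := by
            exact_mod_cast Nat.pow_log_le_self 2 (by omega)
        _ ≤ x := Nat.floor_le (by linarith)
    have h2 := Real.log_le_log (by positivity) h1
    rw [Real.log_pow] at h2
    have h3 := Real.log_two_gt_d9
    have h4 : (Nat.log 2 ⌊x⌋₊ : ℝ) ≤ 2 * Real.log x := by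
      have : (0 : ℝ) ≤ Nat.log 2 ⌊x⌋₊ := Nat.cast_nonneg _
      nlinarith
    have h5 : Real.exp (2 * L) = Real.log x * Real.log x := by
      rw [two_mul, Real.exp_add, ← hlogx]
    rw [h5]
    push_cast
    nlinarith
  have hpowk : (((Nat.log 2 ⌊x⌋₊ + 1 : ℕ) : ℝ) ^ k * R) ^ ℓ ≤
      Real.exp (2 * ℓ * A * L ^ 2) * R ^ ℓ := by
    rw [mul_pow, ← pow_mul]
    refine mul_le_mul_of_nonneg_right ?_ (pow_nonneg hR0 ℓ)
    calc ((Nat.log 2 ⌊x⌋₊ + 1 : ℕ) : ℝ) ^ (k * ℓ) ≤ Real.exp (2 * L) ^ (k * ℓ) := by gcongr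
      _ = Real.exp ((k * ℓ : ℕ) * (2 * L)) := (Real.exp_nat_mul _ _).symm
      _ ≤ _ := by
        refine Real.exp_le_exp.2 ?_
        push_cast
        calc (k : ℝ) * ℓ * (2 * L) ≤ (A * L) * ℓ * (2 * L) := by gcongr
          _ = _ := by ring
  -- From `k! ≤ k^k ≤ (AL)^k` and `A ≤ exp L`, the target is never smaller than `exp(-A L^2)`.
  have hfac : Real.exp (-(A * L ^ 2)) ≤ (2 ^ (ℓ - 1) * L) ^ k / (k.factorial : ℝ) := by
    have h1 : (k.factorial : ℝ) ≤ (A * L) ^ k := by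
      calc (k.factorial : ℝ) ≤ (k : ℝ) ^ k := by exact_mod_cast Nat.factorial_le_pow k
        _ ≤ _ := by gcongr
    have h2 : (A * L) ^ k ≤ L ^ k * Real.exp (A * L ^ 2) := by
      rw [mul_comm A, mul_pow]
      gcongr
      calc A ^ k ≤ Real.exp L ^ k := by
            gcongr
            linarith [Real.add_one_le_exp L]
        _ = Real.exp (k * L) := (Real.exp_nat_mul _ _).symm
        _ ≤ _ := by
          refine Real.exp_le_exp.2 ?_
          calc (k : ℝ) * L ≤ (A * L) * L := by gcongr
            _ = _ := by ring
    have h3 : L ^ k ≤ (2 ^ (ℓ - 1) * L) ^ k := by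
      gcongr
      exact le_mul_of_one_le_left hL0.le (one_le_pow₀ (by norm_num))
    rw [Real.exp_neg, le_div_iff₀ (by positivity), inv_mul_le_iff₀ (Real.exp_pos _)]
    calc (k.factorial : ℝ) ≤ L ^ k * Real.exp (A * L ^ 2) := h1.trans h2
      _ ≤ (2 ^ (ℓ - 1) * L) ^ k * Real.exp (A * L ^ 2) := by gcongr
      _ = _ := mul_comm _ _
  -- All losses together are `exp(O(L^2))`, which `w` absorbs because `log x / L^4` tends to
  -- infinity.
  have hmain : 4 * R ^ ℓ * Real.exp (2 * ℓ * A * L ^ 2) * Real.exp ((ℓ + 1) * L) *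
      Real.exp (A * L ^ 2) ≤ Real.exp (Real.log x / L ^ 2) := by
    calc _ ≤ Real.exp L * Real.exp (2 * ℓ * A * L ^ 2) * Real.exp ((ℓ + 1) * L) *
          Real.exp (A * L ^ 2) := by gcongr
      _ = Real.exp (L + 2 * ℓ * A * L ^ 2 + (ℓ + 1) * L + A * L ^ 2) := by
          rw [Real.exp_add, Real.exp_add, Real.exp_add]
      _ ≤ _ := by
        refine Real.exp_le_exp.2 ?_
        have hLL : L ≤ L ^ 2 := le_self_pow₀ hL1 two_ne_zero
        calc L + 2 * ℓ * A * L ^ 2 + (ℓ + 1) * L + A * L ^ 2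
            ≤ L ^ 2 + 2 * ℓ * A * L ^ 2 + (ℓ + 1) * L ^ 2 + A * L ^ 2 := by gcongr
          _ = (1 + 2 * ℓ * A + (ℓ + 1) + A) * L ^ 2 := by ring
          _ ≤ (Real.log x / L ^ 4) * L ^ 2 := by gcongr
          _ = _ := by field_simp
  have hpowlog : Real.log x ^ (ℓ + 1) = Real.exp ((ℓ + 1) * L) := by
    rw [hlogx, ← Real.exp_nat_mul]; push_cast; rfl
  set E := Real.exp (Real.log x / L ^ 2) with hE
  have hE0 : 0 < E := Real.exp_pos _
  calc 4 * (x / E) * (((Nat.log 2 ⌊x⌋₊ + 1 : ℕ) : ℝ) ^ k * R) ^ ℓ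
      ≤ 4 * (x / E) * (Real.exp (2 * ℓ * A * L ^ 2) * R ^ ℓ) := by gcongr
    _ = x * (4 * R ^ ℓ * Real.exp (2 * ℓ * A * L ^ 2)) / E := by ring
    _ ≤ x / Real.log x ^ (ℓ + 1) * Real.exp (-(A * L ^ 2)) := by
        rw [hpowlog, Real.exp_neg, ← div_eq_mul_inv, div_div, div_le_div_iff₀ hE0 (by positivity)]
        calc _ = x * (4 * R ^ ℓ * Real.exp (2 * ℓ * A * L ^ 2) * Real.exp ((ℓ + 1) * L) *
              Real.exp (A * L ^ 2)) := by ring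
          _ ≤ _ := by gcongr
    _ ≤ _ := by gcongr

/-- The contribution of the non-exceptional integers, in terms of the moment sum. -/
theorem exists_card_unfolded_le (ℓ : ℕ) : ∃ (B : ℕ) (C : ℝ), 0 < C ∧ ∀ᶠ x : ℝ in atTop, ∀ j : ℕ,
    ((unfolded ℓ (j + 1) x (Real.exp (Real.log x / Real.log (Real.log x) ^ 2))).card : ℝ) ≤
      C * (x * Real.log (Real.log x) ^ B / Real.log x ^ (ℓ + 1)) * momentSum ℓ j ⌊x⌋₊ := by
  obtain ⟨B, C, hC, h⟩ := exists_card_sifted_le ℓ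
  refine ⟨B, C, hC, ?_⟩
  filter_upwards [h, tendsto_loglog.eventually_ge_atTop 1, eventually_log_pos,
    eventually_gt_atTop 0] with x hx hL1 hlog hx0 j
  set L := Real.log (Real.log x) with hL
  set w := Real.exp (Real.log x / L ^ 2) with hw
  unfold unfolded
  rw [Finset.card_sigma, Nat.cast_sum, momentSum, Finset.mul_sum]
  have hsub : ((Finset.Icc 1 ⌊x⌋₊).filter fun m : ℕ => omegaStar m + 1 = j + 1 ∧ m * w ≤ x) ⊆
      (Finset.Icc 1 ⌊x⌋₊).filter (fun m => omegaStar m = j) := by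
    intro m hm
    obtain ⟨h1, h2, -⟩ := Finset.mem_filter.1 hm
    exact Finset.mem_filter.2 ⟨h1, by omega⟩
  refine le_trans (Finset.sum_le_sum fun m hm => ?_)
    (Finset.sum_le_sum_of_subset_of_nonneg hsub fun m _ _ => by positivity)
  obtain ⟨h1, -, h3⟩ := Finset.mem_filter.1 hm
  have hm0 : m ≠ 0 := by have := (Finset.mem_Icc.1 h1).1; omega
  rw [Finset.card_sigma, Nat.cast_sum]
  have hbound : ∀ f ∈ frames ℓ m,
      ((sifted (fun i => (f i).1) (fun i => (f i).2) m x).card : ℝ) ≤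
        C * (x / m) * L ^ B / Real.log x ^ (ℓ + 1) := by
    intro f hf
    obtain ⟨hf1, hf2⟩ := Finset.mem_filter.1 hf
    exact hx m _ _ hm0 h3 (fun i => mem_normReps.1 (Fintype.mem_piFinset.1 hf1 i)) hf2
  refine (Finset.sum_le_sum hbound).trans ?_
  rw [Finset.sum_const, nsmul_eq_mul]
  calc ((frames ℓ m).card : ℝ) * (C * (x / m) * L ^ B / Real.log x ^ (ℓ + 1))
      ≤ ((normReps m).card : ℝ) ^ ℓ * (C * (x / m) * L ^ B / Real.log x ^ (ℓ + 1)) := by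
        gcongr
        exact_mod_cast card_frames_le ℓ m
    _ = _ := by ring

/-- The bounded shift costs `(1 + C/Λ)^j ≤ exp(CA)`, and raising the index multiplies by `Λ/(j+1) ≥
1/A`. -/
theorem pow_div_factorial_shift {Λ C A : ℝ} (hΛ : 0 < Λ) (hC : 0 ≤ C) {j : ℕ}
    (hj : ((j + 1 : ℕ) : ℝ) ≤ A * Λ) :
    (Λ + C) ^ j / (j.factorial : ℝ) ≤
      A * Real.exp (C * A) * (Λ ^ (j + 1) / ((j + 1).factorial : ℝ)) := by
  push_cast at hj
  have h1 : (Λ + C) ^ j ≤ Λ ^ j * Real.exp (C * A) := by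
    have h2 : Λ + C ≤ Λ * Real.exp (C / Λ) := by
      have := mul_le_mul_of_nonneg_left (Real.add_one_le_exp (C / Λ)) hΛ.le
      refine le_trans (le_of_eq ?_) this
      field_simp
      ring
    calc (Λ + C) ^ j ≤ (Λ * Real.exp (C / Λ)) ^ j := by gcongr
      _ = Λ ^ j * Real.exp (j * (C / Λ)) := by rw [mul_pow, ← Real.exp_nat_mul]
      _ ≤ _ := by
        refine mul_le_mul_of_nonneg_left (Real.exp_le_exp.2 ?_) (by positivity)
        rw [mul_div_assoc', div_le_iff₀ hΛ]
        nlinarith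
  have h3 : Λ ^ (j + 1) / ((j + 1).factorial : ℝ) = Λ ^ j / (j.factorial : ℝ) * (Λ / (j + 1)) := by
    rw [Nat.factorial_succ, pow_succ]
    push_cast
    field_simp
  have h4 : 1 ≤ A * (Λ / (j + 1)) := by
    rw [mul_div_assoc', le_div_iff₀ (by positivity)]
    linarith
  rw [h3]
  calc (Λ + C) ^ j / (j.factorial : ℝ) ≤ Λ ^ j * Real.exp (C * A) / (j.factorial : ℝ) := by gcongr
    _ = Λ ^ j * Real.exp (C * A) / (j.factorial : ℝ) * 1 := (mul_one _).symm
    _ ≤ Λ ^ j * Real.exp (C * A) / (j.factorial : ℝ) * (A * (Λ / (j + 1))) := by gcongr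
    _ = _ := by ring

end SquarePlusPrimeSquare

/-! ### Choice of parameters and conclusion. -/

namespace SquarePlusPrimeSquare

open Filter Topology

/-- The numerical conditions on the parameters hold for large `x`. -/
theorem eventually_parameters (A : ℝ) (hA : 0 < A) : ∀ᶠ x : ℝ in atTop, ∀ w : ℝ,
    w = Real.exp (Real.log x / Real.log (Real.log x) ^ 2) →
    2 < w ∧ sieveLevel x < w ∧ √x * sieveLevel x ≤ x / w ∧
    ∀ k : ℕ, (k : ℝ) ≤ A * Real.log (Real.log x) → (w ^ 3) ^ (k + 1) * w ≤ x := by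
  have hw2 := (Real.tendsto_exp_atTop.comp (tendsto_log_div_loglog_pow 2)).eventually_gt_atTop 2
  filter_upwards [hw2, tendsto_loglog.eventually_ge_atTop (3 * A + 4), eventually_log_pos,
    eventually_gt_atTop 0] with x hx2 hL hlog hx0 w hw
  set L := Real.log (Real.log x) with hLdef
  have hL4 : 4 ≤ L := by linarith
  have hL0 : 0 < L := by linarith
  have hxe : x = Real.exp (Real.log x) := (Real.exp_log hx0).symm
  have h16 : (16 : ℝ) ≤ L ^ 2 := by nlinarith
  have hdiv2 : Real.log x / L ^ 2 ≤ Real.log x / 16 := by gcongr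
  have hdiv4 : Real.log x / L ^ 4 < Real.log x / L ^ 2 := by
    gcongr
    · linarith
    · norm_num
  refine ⟨by rw [hw]; exact hx2, by rw [hw, sieveLevel]; exact Real.exp_lt_exp.2 hdiv4, ?_, ?_⟩
  · have hsqrt : √x = Real.exp (Real.log x / 2) := by
      rw [Real.exp_half, Real.exp_log hx0]
    rw [hsqrt, sieveLevel, hw, ← hLdef]
    conv_rhs => rw [hxe]
    rw [← Real.exp_add, ← Real.exp_sub, Real.log_exp]
    exact Real.exp_le_exp.2 (by linarith)
  · intro k hk
    rw [hw, ← pow_mul, ← pow_succ, ← Real.exp_nat_mul]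
    conv_rhs => rw [hxe]
    refine Real.exp_le_exp.2 ?_
    push_cast
    have h1 : 3 * ((k : ℝ) + 1) + 1 ≤ L ^ 2 := by nlinarith
    calc (3 * ((k : ℝ) + 1) + 1) * (Real.log x / L ^ 2) ≤ L ^ 2 * (Real.log x / L ^ 2) := by gcongr
      _ = _ := by field_simp

theorem exists_sum_choose_omegaStar_le (ℓ : ℕ) (hℓ : 1 ≤ ℓ) : ∃ (B : ℕ) (C : ℝ), 0 < C ∧
    ∀ A : ℝ, 0 < A → ∀ᶠ x : ℝ in atTop, ∀ k : ℕ, (k : ℝ) ≤ A * Real.log (Real.log x) →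
      ((∑ n ∈ (Finset.Icc 1 ⌊x⌋₊).filter (fun n => omegaStar n = k), (r₁ n).choose ℓ : ℕ) : ℝ) ≤
        C * (x * Real.log (Real.log x) ^ B / Real.log x ^ (ℓ + 1) *
          ((2 ^ (ℓ - 1) * Real.log (Real.log x)) ^ k / (k.factorial : ℝ))) := by
  classical
  obtain ⟨B, C, hC, hunf⟩ := exists_card_unfolded_le ℓ
  obtain ⟨C₁, hC₁, hpps⟩ := exists_primePowerSum_le ℓ hℓ
  set R : ℝ := ((normReps 1).card : ℝ) with hR
  have hR0 : 0 ≤ R := Nat.cast_nonneg _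
  -- The extra power of `L` absorbs the factor `A exp(C₁ A)` from the shift of `k`, so the constant
  -- is free of `A`; the `+ 1` pays for the exceptional integers.
  refine ⟨B + 1, C * (2 * R ^ ℓ) + 1, by positivity, fun A hA => ?_⟩
  filter_upwards [hunf, hpps, eventually_parameters A hA, eventually_exceptional_le ℓ A hA,
    tendsto_loglog.eventually_ge_atTop 1, eventually_log_pos, eventually_gt_atTop 0,
    tendsto_loglog.eventually_ge_atTop (A * Real.exp (C₁ * A))]
    with x hunf hpps hpar hexc hL1 hlog hx0 hLA k hk
  set L := Real.log (Real.log x) with hL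
  set w := Real.exp (Real.log x / L ^ 2) with hw
  obtain ⟨hw2, hzw, hzx, hwk⟩ := hpar w rfl
  have hL0 : 0 < L := by linarith
  set P := (2 ^ (ℓ - 1) * L) ^ k / (k.factorial : ℝ) with hP
  have hP0 : 0 ≤ P := by positivity
  set Q := x / Real.log x ^ (ℓ + 1) with hQ
  have hQ0 : 0 ≤ Q := by positivity
  set U := (Finset.Icc 1 ⌊x⌋₊).filter (fun n => omegaStar n = k) with hU
  have hUmem : ∀ n ∈ U, n ≠ 0 ∧ (n : ℝ) ≤ x ∧ n ≤ ⌊x⌋₊ ∧ omegaStar n = k := by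
    intro n hn
    obtain ⟨h1, h2⟩ := Finset.mem_filter.1 hn
    obtain ⟨h3, h4⟩ := Finset.mem_Icc.1 h1
    exact ⟨by omega, (Nat.le_floor_iff hx0.le).1 h4, h4, h2⟩
  have hexcsum : ((∑ n ∈ U.filter (IsExceptional x w), (r₁ n).choose ℓ : ℕ) : ℝ) ≤ Q * P := by
    refine le_trans ?_ (hexc k hk)
    push_cast
    have h1 : ∀ n ∈ U.filter (IsExceptional x w), ((r₁ n).choose ℓ : ℝ) ≤
        (((Nat.log 2 ⌊x⌋₊ + 1 : ℕ) : ℝ) ^ k * R) ^ ℓ := by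
      intro n hn
      obtain ⟨h2, -, h3, h4⟩ := hUmem n (Finset.mem_filter.1 hn).1
      have h5 := (r₁_le_card_normReps n).trans (card_normReps_le k n h2 h3 h4)
      have h6 := (Nat.choose_le_pow (r₁ n) ℓ).trans (Nat.pow_le_pow_left h5 ℓ)
      rw [hR]
      exact_mod_cast h6
    refine (Finset.sum_le_sum h1).trans ?_
    rw [Finset.sum_const, nsmul_eq_mul]
    push_cast
    refine mul_le_mul_of_nonneg_right ?_ (by positivity)
    refine le_trans ?_ (card_exceptional_le (by linarith) hx0.le hzx)
    exact Nat.cast_le.2 (Finset.card_le_card (Finset.filter_subset_filter _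
      (Finset.filter_subset _ _)))
  have hgoodsum : ((∑ n ∈ U.filter (fun n => ¬ IsExceptional x w n), (r₁ n).choose ℓ : ℕ) : ℝ) ≤
      C * (2 * R ^ ℓ) * (Q * L ^ (B + 1) * P) := by
    have h1 := sum_choose_le_card_unfolded (k := k) hℓ hw2 hzw
      (U.filter fun n => ¬ IsExceptional x w n) (fun n hn => by
        obtain ⟨hn1, hn2⟩ := Finset.mem_filter.1 hn
        obtain ⟨h2, h3, -, h4⟩ := hUmem n hn1
        simp only [IsExceptional, not_or, not_exists, not_and, not_le] at hn2
        refine ⟨h2, h3, h4, ?_, hn2.2.1, hn2.2.2⟩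
        exact lt_of_mul_lt_mul_right ((hwk k hk).trans_lt hn2.1) (by linarith))
    refine (Nat.cast_le.2 h1).trans ?_
    cases k with
    | zero =>
      -- The large prime is odd, so no unfolded parameter exists for `k = 0`.
      have : unfolded ℓ 0 x w = ∅ := by
        simp [unfolded]
      rw [this, Finset.card_empty, Nat.cast_zero]
      positivity
    | succ j =>
      set Λ := 2 ^ (ℓ - 1) * L with hΛ
      have hΛL : L ≤ Λ := le_mul_of_one_le_left hL0.le (one_le_pow₀ (by norm_num))
      have hmom : momentSum ℓ j ⌊x⌋₊ ≤ 2 * R ^ ℓ * (L * P) := by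
        refine (momentSum_le ℓ j ⌊x⌋₊).trans ?_
        have h2 : primePowerSum ℓ ⌊x⌋₊ ^ j / (j.factorial : ℝ) ≤ L * P := by
          calc primePowerSum ℓ ⌊x⌋₊ ^ j / (j.factorial : ℝ)
              ≤ (Λ + C₁) ^ j / (j.factorial : ℝ) :=
                div_le_div_of_nonneg_right
                  (pow_le_pow_left₀ (primePowerSum_nonneg _ _) hpps j) (Nat.cast_nonneg _)
            _ ≤ A * Real.exp (C₁ * A) * P :=
                pow_div_factorial_shift (hL0.trans_le hΛL) hC₁
                  (hk.trans (mul_le_mul_of_nonneg_left hΛL hA.le))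
            _ ≤ L * P := mul_le_mul_of_nonneg_right hLA hP0
        exact mul_le_mul_of_nonneg_left h2 (by positivity)
      calc _ ≤ _ := hunf j
        _ ≤ C * (x * L ^ B / Real.log x ^ (ℓ + 1)) * (2 * R ^ ℓ * (L * P)) :=
            mul_le_mul_of_nonneg_left hmom (by positivity)
        _ = _ := by rw [hQ]; ring
  rw [← Finset.sum_filter_add_sum_filter_not U (IsExceptional x w), Nat.cast_add]
  calc _ ≤ Q * P + C * (2 * R ^ ℓ) * (Q * L ^ (B + 1) * P) := add_le_add hexcsum hgoodsum
    _ ≤ Q * L ^ (B + 1) * P + C * (2 * R ^ ℓ) * (Q * L ^ (B + 1) * P) := by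
        gcongr
        exact le_mul_of_one_le_right hQ0 (one_le_pow₀ hL1)
    _ = _ := by rw [hQ]; ring

theorem omegaStar_of_cardDistinctFactors {n k : ℕ}
    (h : ArithmeticFunction.cardDistinctFactors n = k) : omegaStar n = k ∨ omegaStar n + 1 = k := by
  have h1 : n.primeFactors.card = k := by
    rw [← h]; exact (ArithmeticFunction.cardDistinctFactors_apply).symm
  have h2 := card_primeFactors_le n
  have h3 : omegaStar n ≤ n.primeFactors.card := Finset.card_filter_le _ _
  omega

theorem exists_sum_choose_two_le : ∃ (B : ℕ) (C : ℝ), 0 < C ∧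
    ∀ c A : ℝ, 0 < c → c ≤ A → ∀ᶠ x : ℝ in atTop, ∀ k : ℕ,
      c * Real.log (Real.log x) ≤ (k : ℝ) → (k : ℝ) ≤ A * Real.log (Real.log x) →
      ((∑ n ∈ (Finset.Icc 1 ⌊x⌋₊).filter
            (fun n => ArithmeticFunction.cardDistinctFactors n = k),
          (r₁ n).choose 2 : ℕ) : ℝ) ≤
        C * (x * Real.log (Real.log x) ^ B / Real.log x ^ 3 *
          ((2 * Real.log (Real.log x)) ^ k / (k.factorial : ℝ))) := by
  obtain ⟨B, C, hC, h⟩ := exists_sum_choose_omegaStar_le 2 one_le_two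
  -- The factor `2` covers the values `k` and `k - 1` of `omegaStar`. Rewriting the second term at
  -- index `k` costs `A ≤ L`.
  refine ⟨B + 1, 2 * C, by positivity, fun c A hc hcA => ?_⟩
  have hA : 0 < A := hc.trans_le hcA
  filter_upwards [h A hA, tendsto_loglog.eventually_ge_atTop 1, eventually_log_pos,
    eventually_gt_atTop 0, tendsto_loglog.eventually_ge_atTop A] with x hx hL1 hlog hx0 hLA k hck hk
  set L := Real.log (Real.log x) with hL
  have hL0 : 0 < L := by linarith
  -- The lower bound on `k` serves only to exclude `k = 0`, so that `k - 1` makes sense.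
  have hk0 : k ≠ 0 := by
    rintro rfl
    have : 0 < c * L := by positivity
    simp only [Nat.cast_zero] at hck
    linarith
  obtain ⟨j, rfl⟩ := Nat.exists_eq_succ_of_ne_zero hk0
  simp only [Nat.succ_eq_add_one] at *
  have h1 := hx (j + 1) hk
  have h2 := hx j (le_trans (by push_cast; linarith) hk)
  simp only [show 2 - 1 = 1 from rfl, pow_one, show 2 + 1 = 3 from rfl] at h1 h2
  have hsub : (Finset.Icc 1 ⌊x⌋₊).filter
      (fun n => ArithmeticFunction.cardDistinctFactors n = j + 1) ⊆
      (Finset.Icc 1 ⌊x⌋₊).filter (fun n => omegaStar n = j + 1) ∪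
        (Finset.Icc 1 ⌊x⌋₊).filter (fun n => omegaStar n = j) := by
    intro n hn
    obtain ⟨h3, h4⟩ := Finset.mem_filter.1 hn
    rw [Finset.mem_union, Finset.mem_filter, Finset.mem_filter]
    rcases omegaStar_of_cardDistinctFactors h4 with h5 | h5
    · exact Or.inl ⟨h3, h5⟩
    · exact Or.inr ⟨h3, by omega⟩
  have hsum := (Finset.sum_le_sum_of_subset (f := fun n => (r₁ n).choose 2) hsub).trans
    (Finset.sum_union_inter (s₁ := (Finset.Icc 1 ⌊x⌋₊).filter (fun n => omegaStar n = j + 1))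
      (s₂ := (Finset.Icc 1 ⌊x⌋₊).filter (fun n => omegaStar n = j))
      (f := fun n => (r₁ n).choose 2) ▸ Nat.le_add_right _ _)
  set P := (2 * L) ^ (j + 1) / ((j + 1).factorial : ℝ) with hP
  have hP0 : 0 ≤ P := by positivity
  set Q := x * L ^ B / Real.log x ^ 3 with hQ
  have hQ0 : 0 ≤ Q := by positivity
  have hshift : (2 * L) ^ j / (j.factorial : ℝ) ≤ L * P := by
    have h3 := pow_div_factorial_shift (Λ := 2 * L) (C := 0) (A := A) (j := j) (by positivity) le_rfl
      (hk.trans (mul_le_mul_of_nonneg_left (by linarith) hA.le))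
    simp only [add_zero, zero_mul, Real.exp_zero, mul_one] at h3
    exact h3.trans (mul_le_mul_of_nonneg_right hLA hP0)
  calc _ ≤ _ := Nat.cast_le.2 hsum
    _ ≤ C * (Q * P) + C * (Q * (L * P)) := by
        rw [Nat.cast_add]
        refine add_le_add h1 (h2.trans ?_)
        gcongr
    _ ≤ C * (Q * (L * P)) + C * (Q * (L * P)) := by
        gcongr
        exact le_mul_of_one_le_left hP0 hL1
    _ = _ := by rw [hQ]; ring

end SquarePlusPrimeSquare

theorem mainTheorem6 :
    -- the bound for every fixed `ℓ ≥ 1`, uniformly in `0 ≤ k ≤ A log log x`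
    (∀ ℓ : ℕ, 1 ≤ ℓ → ∃ (B : ℕ) (C : ℝ), 0 < C ∧
      ∀ A : ℝ, 0 < A → ∀ᶠ x : ℝ in Filter.atTop, ∀ k : ℕ,
        (k : ℝ) ≤ A * Real.log (Real.log x) →
        ((∑ n ∈ (Finset.Icc 1 ⌊x⌋₊).filter (fun n => SquarePlusPrimeSquare.omegaStar n = k),
            (SquarePlusPrimeSquare.r₁ n).choose ℓ : ℕ) : ℝ) ≤
          C * (x * Real.log (Real.log x) ^ B / Real.log x ^ (ℓ + 1) *
            ((2 ^ (ℓ - 1) * Real.log (Real.log x)) ^ k / (k.factorial : ℝ)))) ∧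
    -- the consequence of the case `ℓ = 2` for integers with exactly `k` distinct prime factors
    (∃ (B : ℕ) (C : ℝ), 0 < C ∧
      ∀ c A : ℝ, 0 < c → c ≤ A → ∀ᶠ x : ℝ in Filter.atTop, ∀ k : ℕ,
        c * Real.log (Real.log x) ≤ (k : ℝ) → (k : ℝ) ≤ A * Real.log (Real.log x) →
        ((∑ n ∈ (Finset.Icc 1 ⌊x⌋₊).filter
              (fun n => ArithmeticFunction.cardDistinctFactors n = k),
            (SquarePlusPrimeSquare.r₁ n).choose 2 : ℕ) : ℝ) ≤
          C * (x * Real.log (Real.log x) ^ B / Real.log x ^ 3 *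
            ((2 * Real.log (Real.log x)) ^ k / (k.factorial : ℝ)))) :=
  ⟨SquarePlusPrimeSquare.exists_sum_choose_omegaStar_le,
    SquarePlusPrimeSquare.exists_sum_choose_two_le⟩
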